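/- **Setting.** Let $m,n,h,N\ge 1$ and let $Y\in\mathbb R^{m\times n}$ have rank $r\ge 1$; without loss of generality $Y$ is (rectangular) diagonal with non-negative decreasing diagonal, so $Y_{rr}=\sigma_r(Y)>0$. $\|\cdot\|$ is the operator norm of matrices (Euclidean norm of vectors), $\|\cdot\|_F$ the Frobenius norm, $\sigma_k$ the $k$th largest singular value, $\lambda_1$ the largest eigenvalue of a symmetric matrix. Put $\kappa=\|Y\|/\sigma_r(Y)$ and $\gamma=\min(m,n)/r$. Let $\mathcal A:\mathbb R^{m\times n}\to\mathbb R^{N}$ be linear with adjoint $\mathcal A^*$ (for the Frobenius inner product). For $U\in\mathbb R^{m\times h}$, $V\in\mathbb R^{n\times h}$ write $$W=\begin{pmatrix}U\\V\end{pmatrix},\quad \hat Y=\begin{pmatrix}0&Y\\Y^\top&0\end{pmatrix},\quad J=\begin{pmatrix}I_m&0\\0&-I_n\end{pmatrix},\quad R=\hat Y-\tfrac12\left(WW^\top-JWW^\top J\right),$$ $$E^{\mathcal A}=(\mathcal A^*\mathcal A-I)(Y-UV^\top),\qquad \hat E^{\mathcal A}=\begin{pmatrix}0&E^{\mathcal A}\\(E^{\mathcal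 A})^\top&0\end{pmatrix}.$$ Let $P_A\in\mathbb R^{r\times(m+n)}$ and $P_N\in\mathbb R^{(m+n-2r)\times(m+n)}$ be given by $P_AW=\frac1{\sqrt2}(U_{1:r,:}+V_{1:r,:})$ and $P_NW=\begin{pmatrix}U_{r+1:m,:}\\V_{r+1:n,:}\end{pmatrix}$, and $P_\perp=\begin{pmatrix}P_N\\P_AJ\end{pmatrix}$. Put $$A=P_AW,\quad A^\dagger=A^\top(AA^\top)^{-1},\quad Q=A^\dagger A,\quad \tilde W=W-WQ,\quad F=P_\perp WA^\dagger .$$ **Perturbed gradient flow.** For a learning rate $\eta>0$, let $W_t$ be continuous with right derivative $$\frac{d}{dt}W_t=(R_t+E_t)W_t,\qquad E_t=\frac1\eta\ln\!\left(I+\eta R_{k\eta}+\eta\hat E^{\mathcal A}_{k\eta}\right)-R_t,\qquad k=\lfloor t/\eta\rfloor .$$ **Assumptions.** Let $T_2=\frac{5}{\sigma_r(Y)}\ln\!\left(\frac{\sigma_r(Y)}{\epsilon^2}\right)$. - $\alpha\ge1$, $\delta\le\frac1{64\alpha\kappa}$, $0<\epsilon\le\min\!\left(\frac{\sqrt\kappa}{\alpha\gamma},\frac{\delta}{3\alpha}\right)\sqrt{\|Y\|}$,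 $\|W_0\|\le\epsilon$ and $\sigma_r(A_0)\ge\epsilon/\alpha^2$. - $\mathcal A$ satisfies the restricted isometry property with rank $r+1$ and constant $\rho$: $(1-\rho)\|X\|_F^2\le\|\mathcal A(X)\|^2\le(1+\rho)\|X\|_F^2$ whenever $\operatorname{rank}X\le r+1$; moreover $\rho\le\frac{\delta^2}{16\sqrt r\,T_2\|Y\|}$ and $0<\eta\le\frac{\delta^2}{80\,T_2\|Y\|^2}$. **Theorem (warm-up phase).** Let $S^{warmup}$ be the set of $t\in[0,T_2]$ such that 1. $\|W_t\|\le\frac32\sqrt{\|Y\|}$; 2. $\|W_t^\top JW_t\|=\|U_t^\top U_t-V_t^\top V_t\|\le\left(1+\frac{5t}{T_2}\right)\delta^2\|Y\|$; 3. $\|P_AJW_t\|\le\frac{\delta}{3\alpha}\sqrt{\|Y\|}$; 4. $\|P_NW_t\|\le\delta\sqrt{8\|Y\|}$; 5. $\lambda_1\!\left(P_\perp\left(\hat Y+\tfrac12JW_tW_t^\top J\right)P_\perp^\top\right)\le2\delta\|Y\|$; 6. $\|F_t\|\le\alpha^2$; 7. $\|\tilde W_t\|\le\epsilon\exp\left(3\alpha\delta\|Y\|t\right)$;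 8. $\sigma_r(A_t)\ge\min\!\left(\sqrt{\sigma_r(Y)},\ \frac{\epsilon}{\alpha^2}\exp\!\left(\tfrac{2\sigma_r(Y)}5t\right)\right)$. Then $S^{warmup}=[0,T_2]$, i.e. all eight bounds hold for every $t\in[0,T_2]$. -/

import Mathlib

open Set
open scoped Matrix Matrix.Norms.L2Operator

noncomputable section

namespace MatrixSensing

variable {m n h N : ℕ}

/- Norms of matrices are operator norms between Euclidean spaces (`Matrix.Norms.L2Operator`);
vectors of measurements live in `EuclideanSpace ℝ (Fin N)`. -/

/-- The `k`-th largest singular value of `X`, for `k ≥ 1`, counted with multiplicity and equal to `0`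
beyond the rank. (Mathlib's sequence of singular values starts at index `0`.) -/
def sigma {p q : Type*} [Fintype p] [DecidableEq p] [Fintype q] [DecidableEq q]
    (k : ℕ) (X : Matrix p q ℝ) : ℝ :=
  (Matrix.toEuclideanLin X).singularValues (k - 1)

/-- The largest eigenvalue of a symmetric matrix with at least one row. -/
def lambdaMax {p : Type*} [Fintype p] [DecidableEq p] (X : Matrix p p ℝ) : ℝ :=
  sSup (spectrum ℝ X)

/-- The square of the Frobenius norm. -/
def frobSq (X : Matrix (Fin m) (Fin n) ℝ) : ℝ := ∑ i, ∑ j, X i j ^ 2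

/-- `Y` is a rectangular diagonal matrix with non-negative, decreasing diagonal. -/
structure IsSortedDiagonal (Y : Matrix (Fin m) (Fin n) ℝ) : Prop where
  off_diag : ∀ (i : Fin m) (j : Fin n), (i : ℕ) ≠ j → Y i j = 0
  nonneg : ∀ (i : Fin m) (j : Fin n), (i : ℕ) = j → 0 ≤ Y i j
  decreasing : ∀ (i i' : Fin m) (j j' : Fin n), (i : ℕ) = j → (i' : ℕ) = j' → i ≤ i' →
    Y i' j' ≤ Y i j

/-! ### Measurement operators -/

/-- Restricted isometry property with rank `s` and constant `ρ`. -/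
def RIP (𝒜 : Matrix (Fin m) (Fin n) ℝ →ₗ[ℝ] EuclideanSpace ℝ (Fin N)) (s : ℕ) (ρ : ℝ) : Prop :=
  ∀ X : Matrix (Fin m) (Fin n) ℝ, X.rank ≤ s →
    (1 - ρ) * frobSq X ≤ ‖𝒜 X‖ ^ 2 ∧ ‖𝒜 X‖ ^ 2 ≤ (1 + ρ) * frobSq X

/-- The adjoint of `𝒜` for the Frobenius inner product on matrices, entry by entry. -/
def adj (𝒜 : Matrix (Fin m) (Fin n) ℝ →ₗ[ℝ] EuclideanSpace ℝ (Fin N))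
    (y : EuclideanSpace ℝ (Fin N)) : Matrix (Fin m) (Fin n) ℝ :=
  Matrix.of fun i j => inner ℝ (𝒜 (Matrix.single i j 1)) y

theorem adj_spec (𝒜 : Matrix (Fin m) (Fin n) ℝ →ₗ[ℝ] EuclideanSpace ℝ (Fin N))
    (X : Matrix (Fin m) (Fin n) ℝ) (y : EuclideanSpace ℝ (Fin N)) :
    ∑ i, ∑ j, X i j * adj 𝒜 y i j = inner ℝ (𝒜 X) y := by
  conv_rhs => rw [Matrix.matrix_eq_sum_single X]
  simp only [map_sum, sum_inner, adj, Matrix.of_apply]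
  refine Finset.sum_congr rfl fun i _ => Finset.sum_congr rfl fun j _ => ?_
  have hs : Matrix.single i j (X i j) = X i j • Matrix.single i j (1 : ℝ) := by
    simp [Matrix.smul_single]
  rw [hs, map_smul, real_inner_smul_left]

/-! ### Block matrices and projections

The stacked factors `W = (U; V)` have rows indexed by `Fin m ⊕ Fin n`. -/

/-- The block matrix `(0, Z; Zᵀ, 0)`. -/
def dilation (Z : Matrix (Fin m) (Fin n) ℝ) : Matrix (Fin m ⊕ Fin n) (Fin m ⊕ Fin n) ℝ :=
  Matrix.fromBlocks 0 Z Zᵀ 0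

/-- The block matrix `J = (I_m, 0; 0, -I_n)`. -/
def J (m n : ℕ) : Matrix (Fin m ⊕ Fin n) (Fin m ⊕ Fin n) ℝ :=
  Matrix.fromBlocks 1 0 0 (-1)

/-- The `r × (m + n)` matrix `P_A` with `P_A W = (U_{1:r} + V_{1:r}) / √2`. -/
def PA (r m n : ℕ) : Matrix (Fin r) (Fin m ⊕ Fin n) ℝ :=
  Matrix.fromCols
    (Matrix.of fun i j => if (i : ℕ) = j then 1 / √2 else 0)
    (Matrix.of fun i j => if (i : ℕ) = j then 1 / √2 else 0)

/-- The `(m + n - 2r) × (m + n)` matrix `P_N` with `P_N W = (U_{r+1:m}; V_{r+1:n})`. -/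
def PN (r m n : ℕ) : Matrix (Fin (m - r) ⊕ Fin (n - r)) (Fin m ⊕ Fin n) ℝ :=
  Matrix.fromBlocks
    (Matrix.of fun i j => if r + (i : ℕ) = j then 1 else 0) 0
    0 (Matrix.of fun i j => if r + (i : ℕ) = j then 1 else 0)

/-- `P_⊥ = (P_N; P_A J)`. -/
def PP (r m n : ℕ) : Matrix ((Fin (m - r) ⊕ Fin (n - r)) ⊕ Fin r) (Fin m ⊕ Fin n) ℝ :=
  Matrix.fromRows (PN r m n) (PA r m n * J m n)

/-! ### The perturbed gradient flow -/

/-- `R = Ŷ - ½ (W Wᵀ - J W Wᵀ J)`. -/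
def residualR (Y : Matrix (Fin m) (Fin n) ℝ) (W : Matrix (Fin m ⊕ Fin n) (Fin h) ℝ) :
    Matrix (Fin m ⊕ Fin n) (Fin m ⊕ Fin n) ℝ :=
  dilation Y - (1 / 2 : ℝ) • (W * Wᵀ - J m n * W * Wᵀ * J m n)

/-- The measurement error `E^𝒜 = (𝒜* 𝒜 - I)(Y - U Vᵀ)`, where `W = (U; V)`. -/
def measError (𝒜 : Matrix (Fin m) (Fin n) ℝ →ₗ[ℝ] EuclideanSpace ℝ (Fin N))
    (Y : Matrix (Fin m) (Fin n) ℝ) (W : Matrix (Fin m ⊕ Fin n) (Fin h) ℝ) :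
    Matrix (Fin m) (Fin n) ℝ :=
  adj 𝒜 (𝒜 (Y - W.toRows₁ * W.toRows₂ᵀ)) - (Y - W.toRows₁ * W.toRows₂ᵀ)

/-- The perturbation `E_t = η⁻¹ ln(I + η R_{kη} + η Ê^𝒜_{kη}) - R_t` with `k = ⌊t/η⌋`; the logarithm
is that of a symmetric matrix, through the functional calculus. -/
def perturbation (𝒜 : Matrix (Fin m) (Fin n) ℝ →ₗ[ℝ] EuclideanSpace ℝ (Fin N))
    (Y : Matrix (Fin m) (Fin n) ℝ) (η : ℝ) (W : ℝ → Matrix (Fin m ⊕ Fin n) (Fin h) ℝ) (t : ℝ) :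
    Matrix (Fin m ⊕ Fin n) (Fin m ⊕ Fin n) ℝ :=
  (1 / η) • CFC.log (1 + η • residualR Y (W (⌊t / η⌋₊ * η))
      + η • dilation (measError 𝒜 Y (W (⌊t / η⌋₊ * η))))
    - residualR Y (W t)

/-- `W` is a perturbed gradient flow on `[0, T]`: it is continuous there and its right derivative is
`(R_t + E_t) W_t` (`E` jumps at multiples of `η`). -/
structure IsPerturbedGradientFlow
    (𝒜 : Matrix (Fin m) (Fin n) ℝ →ₗ[ℝ] EuclideanSpace ℝ (Fin N))
    (Y : Matrix (Fin m) (Fin n) ℝ) (η T : ℝ)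
    (W : ℝ → Matrix (Fin m ⊕ Fin n) (Fin h) ℝ) : Prop where
  continuousOn : ContinuousOn W (Icc 0 T)
  rightDeriv : ∀ t ∈ Ico 0 T,
    HasDerivWithinAt W ((residualR Y (W t) + perturbation 𝒜 Y η W t) * W t) (Ici t) t

/-! ### Signal, nuisance and misalignment -/

/-- `A = P_A W`. -/
def signalA (r : ℕ) (W : Matrix (Fin m ⊕ Fin n) (Fin h) ℝ) : Matrix (Fin r) (Fin h) ℝ :=
  PA r m n * W

/-- `A† = Aᵀ (A Aᵀ)⁻¹`. -/
def pinvA (r : ℕ) (W : Matrix (Fin m ⊕ Fin n) (Fin h) ℝ) : Matrix (Fin h) (Fin r) ℝ :=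
  (signalA r W)ᵀ * (signalA r W * (signalA r W)ᵀ)⁻¹

/-- `Q = A† A`. -/
def projQ (r : ℕ) (W : Matrix (Fin m ⊕ Fin n) (Fin h) ℝ) : Matrix (Fin h) (Fin h) ℝ :=
  pinvA r W * signalA r W

/-- The nuisance part `W̃ = W - W Q`. -/
def nuisance (r : ℕ) (W : Matrix (Fin m ⊕ Fin n) (Fin h) ℝ) :
    Matrix (Fin m ⊕ Fin n) (Fin h) ℝ :=
  W - W * projQ r W

/-- The misalignment `F = P_⊥ W A†`. -/
def misalignment (r : ℕ) (W : Matrix (Fin m ⊕ Fin n) (Fin h) ℝ) :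
    Matrix ((Fin (m - r) ⊕ Fin (n - r)) ⊕ Fin r) (Fin r) ℝ :=
  PP r m n * W * pinvA r W

/-! ### Parameters, assumptions and the warm-up set -/

/-- The condition number `κ = ‖Y‖ / σ_r(Y)`. -/
def kappa (r : ℕ) (Y : Matrix (Fin m) (Fin n) ℝ) : ℝ := ‖Y‖ / sigma r Y

/-- `γ = min(m, n) / r`. -/
def gamma (r m n : ℕ) : ℝ := (min m n : ℕ) / (r : ℝ)

/-- `T₂ = (5 / σ_r(Y)) ln(σ_r(Y) / ε²)`. -/
def T2 (r : ℕ) (Y : Matrix (Fin m) (Fin n) ℝ) (ε : ℝ) : ℝ :=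
  5 / sigma r Y * Real.log (sigma r Y / ε ^ 2)

/-- The assumption on the parameters and on the initialization `W₀`. -/
structure InitAssumption (r : ℕ) (Y : Matrix (Fin m) (Fin n) ℝ) (α δ ε : ℝ)
    (W₀ : Matrix (Fin m ⊕ Fin n) (Fin h) ℝ) : Prop where
  one_le_alpha : 1 ≤ α
  delta_le : δ ≤ 1 / (64 * α * kappa r Y)
  eps_pos : 0 < ε
  eps_le : ε ≤ min (√(kappa r Y) / (α * gamma r m n)) (δ / (3 * α)) * √‖Y‖
  norm_le : ‖W₀‖ ≤ ε
  le_sigma : ε / α ^ 2 ≤ sigma r (signalA r W₀)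

/-- The assumption on the measurement operator and the learning rate, with end time `T`. -/
structure SensingAssumption (𝒜 : Matrix (Fin m) (Fin n) ℝ →ₗ[ℝ] EuclideanSpace ℝ (Fin N))
    (r : ℕ) (Y : Matrix (Fin m) (Fin n) ℝ) (δ ρ η T : ℝ) : Prop where
  rip : RIP 𝒜 (r + 1) ρ
  rho_le : ρ ≤ δ ^ 2 / (16 * √r * T * ‖Y‖)
  eta_pos : 0 < η
  eta_le : η ≤ δ ^ 2 / (80 * T * ‖Y‖ ^ 2)

/-- The set `S^warmup` of times in `[0, T₂]` at which all eight bounds hold. -/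
def warmupSet (r : ℕ) (Y : Matrix (Fin m) (Fin n) ℝ) (α δ ε : ℝ)
    (W : ℝ → Matrix (Fin m ⊕ Fin n) (Fin h) ℝ) : Set ℝ :=
  {t | t ∈ Icc 0 (T2 r Y ε) ∧
    ‖W t‖ ≤ 3 / 2 * √‖Y‖ ∧
    ‖(W t)ᵀ * J m n * W t‖ ≤ (1 + 5 * t / T2 r Y ε) * δ ^ 2 * ‖Y‖ ∧
    ‖PA r m n * J m n * W t‖ ≤ δ / (3 * α) * √‖Y‖ ∧
    ‖PN r m n * W t‖ ≤ δ * √(8 * ‖Y‖) ∧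
    lambdaMax (PP r m n * (dilation Y + (1 / 2 : ℝ) • (J m n * W t * (W t)ᵀ * J m n))
      * (PP r m n)ᵀ) ≤ 2 * δ * ‖Y‖ ∧
    ‖misalignment r (W t)‖ ≤ α ^ 2 ∧
    ‖nuisance r (W t)‖ ≤ ε * Real.exp (3 * α * δ * ‖Y‖ * t) ∧
    min (√(sigma r Y)) (ε / α ^ 2 * Real.exp (2 * sigma r Y / 5 * t))
      ≤ sigma r (signalA r (W t))}

end MatrixSensing

end

/-!
The theorem is a bootstrap in continuous time: as long as the eight bounds hold, none of them can be
the first to fail.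

*Geometry.* The symmetric dilation `Ŷ` anticommutes with `J`, and `P_A`, `P_⊥` are the projections
onto its positive and its non-positive eigenspaces (`SpectralFrame`, `spectralFrame`). In these
coordinates `A = P_A W` grows at rate at least `σ_r(Y)`, `B = P_A J W` decays at that rate, and
`N = P_N W` is neutral. What drives `B` and `N` is the imbalance `WᵀJW`, which the unperturbed flow
conserves (`deriv_imbalance`).

*Barriers.* Each bound is a semidefinite constraint. At a time when it is active, only the null
vectors of the constraint matter, that is, the extremal singular vectors or eigenvectors. If the
constraint has positive derivative along them, it persists for a short time (`eventually_posSemidef`,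
`eventually_opNorm_le`), without any differentiability of singular values. The derivatives along
extremal vectors are computed in the lemmas `growth_*`, and compared with the allowed rates in the
lemmas `eventually_*`, which `eventually_warmupBounds` collects. Two of the bounds lean on each
other: the misalignment `F` contracts provided that the nuisance part is small relative to the
signal, and this comparison only involves the exponential bounds on the two. The bound on `N` is
replaced by a sharper one which increases with time, because the cubic damping that confines `N`
may be weaker than the perturbation.

*Perturbation.* The barriers tolerate a perturbation of norm `δ² / T₂` (`norm_perturbation_le`). The
restricted isometry property is polarized against matrices of rank one
(`RIP.norm_deviation_le_frob`). It controls the measurement error of the part of `Y - U Vᵀ` of low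
rank directly, and that of the nuisance part after cutting it into blocks of `r` rows or columns
(`RIP.norm_deviation_le_gamma`). The logarithm differs from its argument to second order in `η`
(`norm_log_one_add_sub_le`), and the residual drifts little within a step of length `η`, on which the
flow is linear. This estimate uses the bounds at the last multiple of `η`, hence at earlier times;
therefore the induction over `[0, T₂]` is `forall_mem_Icc_of_real_induction`.
-/

noncomputable section

namespace MatrixSensing

set_option linter.unusedSectionVars false

open Filter Topology

/-! ### Operator norms, quadratic forms and derivatives of matrices -/

section Tools

variable {p q k : Type*} [Fintype p] [Fintype q] [Fintype k]
  [DecidableEq p] [DecidableEq q] [DecidableEq k]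

theorem dotProduct_self_eq_norm_sq (u : p → ℝ) : u ⬝ᵥ u = ‖WithLp.toLp 2 u‖ ^ 2 := by
  rw [EuclideanSpace.real_norm_sq_eq]
  simp [dotProduct, pow_two]

theorem dotProduct_eq_inner (u v : p → ℝ) :
    u ⬝ᵥ v = inner ℝ (WithLp.toLp 2 u) (WithLp.toLp 2 v) := by
  rw [EuclideanSpace.inner_eq_star_dotProduct]
  simp [dotProduct_comm]

theorem norm_transpose (M : Matrix p q ℝ) : ‖Mᵀ‖ = ‖M‖ := by
  rw [← Matrix.conjTranspose_eq_transpose_of_trivial, Matrix.l2_opNorm_conjTranspose]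

theorem norm_mulVec_toLp_le (M : Matrix p q ℝ) (u : q → ℝ) :
    ‖WithLp.toLp 2 (M *ᵥ u)‖ ≤ ‖M‖ * ‖WithLp.toLp 2 u‖ :=
  Matrix.l2_opNorm_mulVec M (WithLp.toLp 2 u)

theorem abs_dotProduct_le (u v : p → ℝ) :
    |u ⬝ᵥ v| ≤ ‖WithLp.toLp 2 u‖ * ‖WithLp.toLp 2 v‖ := by
  rw [dotProduct_eq_inner]
  exact abs_real_inner_le_norm _ _

theorem abs_dotProduct_mulVec_le (M : Matrix p q ℝ) (u : p → ℝ) (v : q → ℝ) :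
    |u ⬝ᵥ M *ᵥ v| ≤ ‖M‖ * ‖WithLp.toLp 2 u‖ * ‖WithLp.toLp 2 v‖ := by
  calc _ ≤ _ := abs_dotProduct_le _ _
    _ ≤ ‖WithLp.toLp 2 u‖ * (‖M‖ * ‖WithLp.toLp 2 v‖) := by
        gcongr; exact norm_mulVec_toLp_le _ _
    _ = _ := by ring

theorem norm_toLp_of_dotProduct {u : p → ℝ} {b : ℝ} (hb : 0 ≤ b) (hu : u ⬝ᵥ u = b ^ 2) :
    ‖WithLp.toLp 2 u‖ = b := by
  rw [dotProduct_self_eq_norm_sq] at hu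
  exact (pow_left_inj₀ (norm_nonneg _) hb two_ne_zero).1 hu

theorem dotProduct_mulVec_self_le (M : Matrix p q ℝ) (u : q → ℝ) :
    (M *ᵥ u) ⬝ᵥ (M *ᵥ u) ≤ ‖M‖ ^ 2 * (u ⬝ᵥ u) := by
  rw [dotProduct_self_eq_norm_sq, dotProduct_self_eq_norm_sq, ← mul_pow]
  gcongr
  exact norm_mulVec_toLp_le _ _

theorem opNorm_le_of_dotProduct {M : Matrix p q ℝ} {b : ℝ} (hb : 0 ≤ b)
    (h : ∀ u : q → ℝ, (M *ᵥ u) ⬝ᵥ (M *ᵥ u) ≤ b ^ 2 * (u ⬝ᵥ u)) : ‖M‖ ≤ b := by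
  rw [Matrix.l2_opNorm_def]
  refine ContinuousLinearMap.opNorm_le_bound _ hb fun u => ?_
  have h1 := h u.ofLp
  rw [dotProduct_self_eq_norm_sq, dotProduct_self_eq_norm_sq, ← mul_pow] at h1
  exact le_of_sq_le_sq h1 (by positivity)

theorem posSemidef_of_dotProduct {M : Matrix p p ℝ} (hM : Mᵀ = M)
    (h : ∀ u, 0 ≤ u ⬝ᵥ M *ᵥ u) : M.PosSemidef :=
  Matrix.PosSemidef.of_dotProduct_mulVec_nonneg
    (by rw [Matrix.IsHermitian, Matrix.conjTranspose_eq_transpose_of_trivial, hM])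
    (fun u => by simpa using h u)

theorem _root_.Matrix.PosSemidef.dotProduct_nonneg {M : Matrix p p ℝ} (hM : M.PosSemidef)
    (u : p → ℝ) : 0 ≤ u ⬝ᵥ M *ᵥ u := by
  simpa using hM.dotProduct_mulVec_nonneg u

theorem _root_.Matrix.PosSemidef.mulVec_eq_zero_of_dotProduct {M : Matrix p p ℝ}
    (hM : M.PosSemidef) {u : p → ℝ} (hu : u ⬝ᵥ M *ᵥ u = 0) : M *ᵥ u = 0 :=
  (hM.dotProduct_mulVec_zero_iff u).1 (by simpa using hu)

theorem _root_.Matrix.PosSemidef.transpose_eq {M : Matrix p p ℝ} (hM : M.PosSemidef) :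
    Mᵀ = M := by
  have := hM.isHermitian
  rwa [Matrix.IsHermitian, Matrix.conjTranspose_eq_transpose_of_trivial] at this

theorem mulVec_dotProduct (M : Matrix p q ℝ) (u : q → ℝ) (v : p → ℝ) :
    (M *ᵥ u) ⬝ᵥ v = u ⬝ᵥ Mᵀ *ᵥ v := by
  rw [dotProduct_comm, Matrix.dotProduct_mulVec, ← Matrix.mulVec_transpose, dotProduct_comm]

/-- A bound on the operator norm as a semidefinite constraint. This form turns the norm bounds into
instances of the barrier `eventually_posSemidef`. -/
theorem posSemidef_smul_one_sub_iff {M : Matrix p q ℝ} {b : ℝ} (hb : 0 ≤ b) :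
    (b ^ 2 • (1 : Matrix q q ℝ) - Mᵀ * M).PosSemidef ↔ ‖M‖ ≤ b := by
  have key : ∀ u : q → ℝ, u ⬝ᵥ (b ^ 2 • (1 : Matrix q q ℝ) - Mᵀ * M) *ᵥ u
      = b ^ 2 * (u ⬝ᵥ u) - (M *ᵥ u) ⬝ᵥ (M *ᵥ u) := by
    intro u
    rw [Matrix.sub_mulVec, dotProduct_sub, Matrix.smul_mulVec, Matrix.one_mulVec,
      dotProduct_smul, smul_eq_mul, ← Matrix.mulVec_mulVec, mulVec_dotProduct]
  constructor
  · intro h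
    refine opNorm_le_of_dotProduct hb fun u => ?_
    have := h.dotProduct_nonneg u
    rw [key] at this
    linarith
  · intro h
    refine posSemidef_of_dotProduct (by simp) fun u => ?_
    rw [key]
    have h1 := dotProduct_mulVec_self_le M u
    have h2 : ‖M‖ ^ 2 * (u ⬝ᵥ u) ≤ b ^ 2 * (u ⬝ᵥ u) := by
      have : 0 ≤ u ⬝ᵥ u := by rw [dotProduct_self_eq_norm_sq]; positivity
      gcongr
    linarith

/-- Matrix multiplication as a continuous bilinear map. -/
def mulL (p q k : Type*) [Fintype p] [Fintype q] [Fintype k]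
    [DecidableEq p] [DecidableEq q] [DecidableEq k] :
    Matrix p q ℝ →L[ℝ] Matrix q k ℝ →L[ℝ] Matrix p k ℝ :=
  LinearMap.mkContinuous₂
    (LinearMap.mk₂ ℝ (fun (A : Matrix p q ℝ) (B : Matrix q k ℝ) => A * B)
      Matrix.add_mul (fun c A B => Matrix.smul_mul c A B) Matrix.mul_add
      (fun c A B => Matrix.mul_smul A c B)) 1
    (fun A B => by simpa using Matrix.l2_opNorm_mul A B)

theorem hasDerivWithinAt_mul {X : ℝ → Matrix p q ℝ} {X' : Matrix p q ℝ}
    {V : ℝ → Matrix q k ℝ} {V' : Matrix q k ℝ} {s : Set ℝ} {t : ℝ}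
    (hX : HasDerivWithinAt X X' s t) (hV : HasDerivWithinAt V V' s t) :
    HasDerivWithinAt (fun t => X t * V t) (X' * V t + X t * V') s t := by
  have h := (mulL p q k).hasDerivWithinAt_of_bilinear hX hV
  rw [add_comm]
  exact h

/-- Transposition as a continuous linear map. -/
def transposeL (p q : Type*) [Fintype p] [Fintype q] [DecidableEq p] [DecidableEq q] :
    Matrix p q ℝ →L[ℝ] Matrix q p ℝ :=
  LinearMap.mkContinuous
    { toFun := fun A => Aᵀ
      map_add' := fun A B => Matrix.transpose_add A B
      map_smul' := fun c A => Matrix.transpose_smul c A } 1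
    (fun A => by simpa using (norm_transpose A).le)

theorem hasDerivWithinAt_transpose {X : ℝ → Matrix p q ℝ} {X' : Matrix p q ℝ} {s : Set ℝ} {t : ℝ}
    (hX : HasDerivWithinAt X X' s t) : HasDerivWithinAt (fun t => (X t)ᵀ) X'ᵀ s t :=
  (transposeL p q).hasFDerivAt.comp_hasDerivWithinAt t hX

theorem hasDerivWithinAt_const_mul (M : Matrix p q ℝ) {V : ℝ → Matrix q k ℝ} {V' : Matrix q k ℝ}
    {s : Set ℝ} {t : ℝ} (hV : HasDerivWithinAt V V' s t) :
    HasDerivWithinAt (fun t => M * V t) (M * V') s t := by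
  simpa using hasDerivWithinAt_mul (hasDerivWithinAt_const t s M) hV

theorem hasDerivWithinAt_inv {X : ℝ → Matrix p p ℝ} {X' : Matrix p p ℝ} {s : Set ℝ} {t : ℝ}
    (hX : HasDerivWithinAt X X' s t) (hu : IsUnit (X t)) :
    HasDerivWithinAt (fun t => (X t)⁻¹) (-((X t)⁻¹ * X' * (X t)⁻¹)) s t := by
  obtain ⟨x, hx⟩ := hu
  have h := hasFDerivAt_ringInverse (𝕜 := ℝ) x
  rw [hx] at h
  have h2 := h.comp_hasDerivWithinAt t hX
  have e : (↑x⁻¹ : Matrix p p ℝ) = (X t)⁻¹ := by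
    rw [← hx, Matrix.coe_units_inv]
  have : Ring.inverse ∘ X = fun t => (X t)⁻¹ := by
    ext1 t; simp [Matrix.nonsing_inv_eq_ringInverse]
  rw [this] at h2
  simpa [e] using h2

end Tools

/-! ### Barriers for matrix-valued functions and real induction -/

section Barrier

variable {p q : Type*} [Fintype p] [Fintype q] [DecidableEq p] [DecidableEq q]

theorem continuous_dotProduct_mulVec :
    Continuous fun z : Matrix p p ℝ × EuclideanSpace ℝ p => z.2.ofLp ⬝ᵥ z.1 *ᵥ z.2.ofLp := by
  have h : Continuous fun z : Matrix p p ℝ × EuclideanSpace ℝ p => z.2.ofLp :=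
    (PiLp.continuous_ofLp 2 _).comp continuous_snd
  exact h.dotProduct (continuous_fst.matrix_mulVec h)

/-- A barrier for the cone of positive semidefinite matrices: if at time `t` the right derivative of
`N` is positive on every null vector of `N t`, then `N` stays positive semidefinite for a short time.
The time is uniform over directions because the unit sphere is compact. -/
theorem eventually_posSemidef {N : ℝ → Matrix p p ℝ} {N' : Matrix p p ℝ} {t : ℝ}
    (hsymm : ∀ t, (N t)ᵀ = N t) (hd : HasDerivWithinAt N N' (Ici t) t) (h0 : (N t).PosSemidef)
    (hker : ∀ u : p → ℝ, u ⬝ᵥ u = 1 → N t *ᵥ u = 0 → 0 < u ⬝ᵥ N' *ᵥ u) :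
    ∀ᶠ t' in 𝓝[>] t, (N t').PosSemidef := by
  have hcont : Tendsto N (𝓝[>] t) (𝓝 (N t)) :=
    hd.continuousWithinAt.mono_left (nhdsWithin_mono _ Ioi_subset_Ici_self)
  have hslope : Tendsto (slope N t) (𝓝[>] t) (𝓝 N') :=
    (hasDerivWithinAt_iff_tendsto_slope' (self_notMem_Ioi)).1 (hd.Ioi_of_Ici)
  have key : ∀ u ∈ Metric.sphere (0 : EuclideanSpace ℝ p) 1,
      ∀ᶠ z : ℝ × EuclideanSpace ℝ p in 𝓝 (t, u),
        t < z.1 → 0 ≤ z.2.ofLp ⬝ᵥ N z.1 *ᵥ z.2.ofLp := by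
    intro u hu
    have hu1 : u.ofLp ⬝ᵥ u.ofLp = 1 := by
      rw [dotProduct_self_eq_norm_sq]
      rw [WithLp.toLp_ofLp, mem_sphere_zero_iff_norm.1 hu, one_pow]
    have aux : ∀ {X : ℝ → Matrix p p ℝ} {X0 : Matrix p p ℝ}, Tendsto X (𝓝[>] t) (𝓝 X0) →
        0 < u.ofLp ⬝ᵥ X0 *ᵥ u.ofLp → ∀ᶠ z : ℝ × EuclideanSpace ℝ p in 𝓝[>] t ×ˢ 𝓝 u,
          0 < z.2.ofLp ⬝ᵥ X z.1 *ᵥ z.2.ofLp := by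
      intro X X0 hX hpos
      have h1 : Tendsto (fun z : ℝ × EuclideanSpace ℝ p => (X z.1, z.2)) (𝓝[>] t ×ˢ 𝓝 u)
          (𝓝 (X0, u)) := by
        rw [nhds_prod_eq]
        exact (hX.comp tendsto_fst).prodMk tendsto_snd
      exact ((continuous_dotProduct_mulVec (p := p)).continuousAt.tendsto.comp h1).eventually
        (lt_mem_nhds hpos)
    have h2 : ∀ᶠ z : ℝ × EuclideanSpace ℝ p in 𝓝[>] t ×ˢ 𝓝 u,
        0 ≤ z.2.ofLp ⬝ᵥ N z.1 *ᵥ z.2.ofLp := by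
      rcases (h0.dotProduct_nonneg u.ofLp).lt_or_eq with h | h
      · filter_upwards [aux hcont h] with z hz using hz.le
      · -- on the kernel of `N t` the first-order term decides
        have h3 := aux hslope (hker u.ofLp hu1 (h0.mulVec_eq_zero_of_dotProduct h.symm))
        have h4 : ∀ᶠ z : ℝ × EuclideanSpace ℝ p in 𝓝[>] t ×ˢ 𝓝 u, t < z.1 :=
          tendsto_fst.eventually (eventually_mem_nhdsWithin)
        filter_upwards [h3, h4] with z hz hlt
        have e : N z.1 = N t + (z.1 - t) • slope N t z.1 := by
          rw [slope_def_module, smul_smul, mul_inv_cancel₀ (by linarith), one_smul]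
          abel
        rw [e, Matrix.add_mulVec, Matrix.smul_mulVec, dotProduct_add, dotProduct_smul, smul_eq_mul]
        have := h0.dotProduct_nonneg z.2.ofLp
        have := mul_pos (sub_pos.2 hlt) hz
        linarith
    rw [nhdsWithin, inf_comm] at h2
    have e : (𝓟 (Ioi t) ⊓ 𝓝 t) ×ˢ 𝓝 u = 𝓟 (Ioi t ×ˢ univ) ⊓ 𝓝 (t, u) := by
      rw [nhds_prod_eq, ← prod_principal_principal, prod_inf_prod]
      simp
    rw [e, inf_comm, eventually_inf_principal] at h2
    filter_upwards [h2] with z hz hlt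
    exact hz ⟨hlt, trivial⟩
  have h5 := (isCompact_sphere (0 : EuclideanSpace ℝ p) 1).eventually_forall_of_forall_eventually
    (x₀ := t) (P := fun x v => t < x → 0 ≤ v.ofLp ⬝ᵥ N x *ᵥ v.ofLp) key
  filter_upwards [nhdsWithin_le_nhds h5, self_mem_nhdsWithin] with t' ht' hlt
  refine posSemidef_of_dotProduct (hsymm t') fun u => ?_
  by_cases hu : u = 0
  · simp [hu]
  have hn : 0 < ‖WithLp.toLp 2 u‖ := by
    rw [norm_pos_iff]
    simpa using hu
  have h6 := ht' (‖WithLp.toLp 2 u‖⁻¹ • WithLp.toLp 2 u) (by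
    simp [norm_smul, hn.ne']) hlt
  have e : (‖WithLp.toLp 2 u‖⁻¹ • WithLp.toLp 2 u).ofLp = ‖WithLp.toLp 2 u‖⁻¹ • u := rfl
  rw [e, Matrix.mulVec_smul, dotProduct_smul, smul_dotProduct, smul_eq_mul, smul_eq_mul] at h6
  have hi : 0 < ‖WithLp.toLp 2 u‖⁻¹ := inv_pos.2 hn
  exact nonneg_of_mul_nonneg_right (nonneg_of_mul_nonneg_right h6 hi) hi

/-- A moving barrier for the operator norm. Only the top singular vectors `u` of `X t` matter, and only
when the bound is attained; along them `X` has to grow more slowly than `b`. -/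
theorem eventually_opNorm_le {X : ℝ → Matrix p q ℝ} {X' : Matrix p q ℝ} {b : ℝ → ℝ} {b' t : ℝ}
    (hX : HasDerivWithinAt X X' (Ici t) t) (hb : HasDerivWithinAt b b' (Ici t) t) (hpos : 0 < b t)
    (h0 : ‖X t‖ ≤ b t)
    (htop : ∀ u : q → ℝ, u ⬝ᵥ u = 1 → (X t)ᵀ *ᵥ (X t *ᵥ u) = b t ^ 2 • u →
      (X t *ᵥ u) ⬝ᵥ (X t *ᵥ u) = b t ^ 2 → (X t *ᵥ u) ⬝ᵥ (X' *ᵥ u) < b t * b') :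
    ∀ᶠ t' in 𝓝[>] t, ‖X t'‖ ≤ b t' := by
  have hd : HasDerivWithinAt (fun t => b t ^ 2 • (1 : Matrix q q ℝ) - (X t)ᵀ * X t)
      ((2 * b t * b') • (1 : Matrix q q ℝ) - (X'ᵀ * X t + (X t)ᵀ * X')) (Ici t) t := by
    refine HasDerivWithinAt.sub ?_ (hasDerivWithinAt_mul (hasDerivWithinAt_transpose hX) hX)
    have := (hb.pow 2).smul_const (1 : Matrix q q ℝ)
    simpa using this
  have h1 := eventually_posSemidef (fun t => by simp) hd
    ((posSemidef_smul_one_sub_iff hpos.le).2 h0) (by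
      intro u hu hz
      rw [Matrix.sub_mulVec, Matrix.smul_mulVec, Matrix.one_mulVec, ← Matrix.mulVec_mulVec,
        sub_eq_zero] at hz
      have hn : (X t *ᵥ u) ⬝ᵥ (X t *ᵥ u) = b t ^ 2 := by
        rw [mulVec_dotProduct, ← hz, dotProduct_smul, hu, smul_eq_mul, mul_one]
      have h2 := htop u hu hz.symm hn
      rw [Matrix.sub_mulVec, Matrix.smul_mulVec, Matrix.one_mulVec, Matrix.add_mulVec,
        ← Matrix.mulVec_mulVec, ← Matrix.mulVec_mulVec, dotProduct_sub, dotProduct_smul,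
        dotProduct_add, hu, ← mulVec_dotProduct, ← mulVec_dotProduct, smul_eq_mul]
      have := dotProduct_comm (X' *ᵥ u) (X t *ᵥ u)
      linarith)
  have hbpos : ∀ᶠ t' in 𝓝[>] t, 0 < b t' :=
    (hb.continuousWithinAt.mono_left (nhdsWithin_mono _ Ioi_subset_Ici_self)).eventually
      (lt_mem_nhds hpos)
  filter_upwards [h1, hbpos] with t' h2 h3
  exact (posSemidef_smul_one_sub_iff h3.le).1 h2

end Barrier

/-- Real induction on `[0, T]`, in the form in which the step may use the property at all earlier
times. -/
theorem forall_mem_Icc_of_real_induction {P : ℝ → Prop} {T : ℝ} (h0 : P 0)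
    (hlim : ∀ t ∈ Ioc 0 T, (∀ t' ∈ Ico 0 t, P t') → P t)
    (hstep : ∀ t ∈ Ico 0 T, (∀ t' ∈ Icc 0 t, P t') → ∀ᶠ t' in 𝓝[>] t, P t') :
    ∀ t ∈ Icc 0 T, P t := by
  have main : ∀ t ∈ Icc 0 T, ∀ t' ∈ Icc 0 t, P t' := by
    intro t ht
    rcases eq_or_lt_of_le ht.1 with h | hT
    · rw [← h]
      intro t' ht'
      have : t' = 0 := le_antisymm ht'.2 ht'.1
      rwa [this]
    set S : Set ℝ := {x | ∀ t' ∈ Icc 0 x, P t'} with hS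
    have hclosed : IsClosed (S ∩ Icc 0 T) := by
      refine isClosed_of_closure_subset fun x hx => ?_
      have hxT : x ∈ Icc 0 T := by
        have := closure_mono (inter_subset_right) hx
        rwa [isClosed_Icc.closure_eq] at this
      refine ⟨?_, hxT⟩
      have hlt : ∀ t' ∈ Ico 0 x, P t' := by
        intro t' ht'
        obtain ⟨z, hz, hzS⟩ := mem_closure_iff.1 hx (Ioi t') isOpen_Ioi ht'.2
        exact hzS.1 t' ⟨ht'.1, (mem_Ioi.1 hz).le⟩
      intro t' ht'
      rcases eq_or_lt_of_le ht'.2 with h | h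
      · rcases eq_or_lt_of_le ht'.1 with h' | h'
        · rwa [← h']
        · subst h
          exact hlim t' ⟨h', hxT.2⟩ hlt
      · exact hlt t' ⟨ht'.1, h⟩
    have h0S : (0 : ℝ) ∈ S := by
      intro t' ht'
      have : t' = 0 := le_antisymm ht'.2 ht'.1
      rwa [this]
    refine hclosed.Icc_subset_of_forall_mem_nhdsWithin h0S (fun x hx => ?_) ht
    have h1 := hstep x hx.2 hx.1
    obtain ⟨z, hz, hzP⟩ := mem_nhdsGT_iff_exists_Ioo_subset.1 h1
    refine mem_nhdsGT_iff_exists_Ioo_subset.2 ⟨z, hz, fun w hw => ?_⟩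
    intro t' ht'
    rcases le_or_gt t' x with h | h
    · exact hx.1 t' ⟨ht'.1, h⟩
    · exact hzP ⟨h, ht'.2.trans_lt hw.2⟩
  exact fun t ht => main t ht t ⟨ht.1, le_rfl⟩

/-! ### Growth of the factor, the imbalance and the signal-free blocks -/

section Growth

variable {p a b c k : Type*} [Fintype p] [Fintype a] [Fintype b] [Fintype c] [Fintype k]
  [DecidableEq p] [DecidableEq a] [DecidableEq b] [DecidableEq c] [DecidableEq k]

theorem abs_dotProduct_mulVec_le_of_le {M : Matrix a b ℝ} {x : a → ℝ} {v : b → ℝ} {l r m : ℝ}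
    (hl : 0 ≤ l) (hr : 0 ≤ r) (hx : x ⬝ᵥ x = l ^ 2) (hv : v ⬝ᵥ v = r ^ 2) (hM : ‖M‖ ≤ m) :
    |x ⬝ᵥ M *ᵥ v| ≤ m * l * r := by
  have h := abs_dotProduct_mulVec_le M x v
  rw [norm_toLp_of_dotProduct hl hx, norm_toLp_of_dotProduct hr hv] at h
  exact h.trans (by gcongr)

theorem norm_mul_le_of_le {M : Matrix a b ℝ} {V : Matrix b c ℝ} {m v : ℝ}
    (hM : ‖M‖ ≤ m) (hV : ‖V‖ ≤ v) : ‖M * V‖ ≤ m * v :=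
  (Matrix.l2_opNorm_mul M V).trans
    (mul_le_mul hM hV (norm_nonneg _) ((norm_nonneg _).trans hM))

theorem norm_transpose_le {M : Matrix a b ℝ} {m : ℝ} (hM : ‖M‖ ≤ m) : ‖Mᵀ‖ ≤ m := by
  rwa [norm_transpose]

theorem zero_le_dotProduct_self (u : p → ℝ) : 0 ≤ u ⬝ᵥ u := by
  rw [dotProduct_self_eq_norm_sq]; positivity

/-- Growth of the largest singular value `w` of `W`: the cubic term `-w⁴ / 2` confines `W`, and the
skew part of the cubic term contributes only through the imbalance `K`. -/
theorem growth_factor {Yh J E : Matrix p p ℝ} {W D : Matrix p k ℝ} {K : Matrix k k ℝ}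
    {y w κ e : ℝ} {u : k → ℝ} (hJ : Jᵀ = J) (hY : ‖Yh‖ ≤ y) (hE : ‖E‖ ≤ e)
    (hKdef : K = Wᵀ * J * W) (hK : ‖K‖ ≤ κ) (hw : 0 ≤ w)
    (hD : D = Yh * W - (1 / 2 : ℝ) • (W * (Wᵀ * W)) + (1 / 2 : ℝ) • (J * W * K) + E * W)
    (hu : u ⬝ᵥ u = 1) (h1 : Wᵀ *ᵥ (W *ᵥ u) = w ^ 2 • u) (h2 : (W *ᵥ u) ⬝ᵥ (W *ᵥ u) = w ^ 2) :
    (W *ᵥ u) ⬝ᵥ (D *ᵥ u) ≤ y * w ^ 2 - w ^ 4 / 2 + κ ^ 2 / 2 + e * w ^ 2 := by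
  have t1 := (abs_le.1 (abs_dotProduct_mulVec_le_of_le hw hw h2 h2 hY)).2
  have t4 := (abs_le.1 (abs_dotProduct_mulVec_le_of_le hw hw h2 h2 hE)).2
  have t2 : (W *ᵥ u) ⬝ᵥ (W *ᵥ (Wᵀ *ᵥ (W *ᵥ u))) = w ^ 4 := by
    rw [h1, Matrix.mulVec_smul, dotProduct_smul, h2, smul_eq_mul]; ring
  have t3 : (W *ᵥ u) ⬝ᵥ (J *ᵥ (W *ᵥ (K *ᵥ u))) ≤ κ ^ 2 := by
    have e1 : (W *ᵥ u) ⬝ᵥ (J *ᵥ (W *ᵥ (K *ᵥ u))) = (K *ᵥ u) ⬝ᵥ (K *ᵥ u) := by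
      conv_rhs => rw [mulVec_dotProduct]
      rw [mulVec_dotProduct, hKdef]
      simp [Matrix.mulVec_mulVec, Matrix.mul_assoc, hJ]
    rw [e1]
    have := dotProduct_mulVec_self_le K u
    rw [hu, mul_one] at this
    exact this.trans (pow_le_pow_left₀ (norm_nonneg _) hK 2)
  rw [hD]
  simp only [Matrix.add_mulVec, Matrix.sub_mulVec, Matrix.smul_mulVec, ← Matrix.mulVec_mulVec,
    dotProduct_add, dotProduct_sub, dotProduct_smul, smul_eq_mul, t2]
  nlinarith

/-- The imbalance `WᵀJW` is driven by the perturbation only: the contribution of `Yh` cancels since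
`Yh` anticommutes with `J`, and the two cubic terms cancel each other. -/
theorem deriv_imbalance {Yh J E : Matrix p p ℝ} {W D : Matrix p k ℝ} {K : Matrix k k ℝ}
    (hJ : Jᵀ = J) (hJJ : J * J = 1) (hYJ : Yh * J = -(J * Yh)) (hY : Yhᵀ = Yh)
    (hKdef : K = Wᵀ * J * W)
    (hD : D = Yh * W - (1 / 2 : ℝ) • (W * (Wᵀ * W)) + (1 / 2 : ℝ) • (J * W * K) + E * W) :
    Dᵀ * (J * W) + Wᵀ * (J * D) = Wᵀ * (Eᵀ * J + J * E) * W := by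
  have hJJ' : ∀ X : Matrix p k ℝ, J * (J * X) = X := fun X => by
    rw [← Matrix.mul_assoc, hJJ, Matrix.one_mul]
  have hYJ' : ∀ X : Matrix p k ℝ, Yh * (J * X) = -(J * (Yh * X)) := fun X => by
    rw [← Matrix.mul_assoc, hYJ, Matrix.neg_mul, Matrix.mul_assoc]
  have hKt : Kᵀ = K := by simp [hKdef, hJ, Matrix.mul_assoc]
  rw [hD]
  simp only [Matrix.transpose_add, Matrix.transpose_sub, Matrix.transpose_smul,
    Matrix.transpose_mul, Matrix.transpose_transpose, hJ, hY, hKt, Matrix.add_mul, Matrix.sub_mul,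
    Matrix.smul_mul, Matrix.mul_add, Matrix.mul_sub, Matrix.mul_smul, Matrix.mul_assoc, hJJ', hYJ',
    Matrix.mul_neg]
  rw [hKdef]
  simp only [Matrix.mul_assoc]
  abel

/-- Growth of the largest singular value of a block `B` of rows which is contracted at rate `s` by the
target, damped by `Wᵀ W`, and forced by `X`. -/
theorem growth_damped_block {S : Matrix a a ℝ} {W : Matrix p k ℝ} {B X B' : Matrix a k ℝ}
    {s l x : ℝ} {u : k → ℝ} (hl : 0 ≤ l)
    (hS : ∀ v : a → ℝ, s * (v ⬝ᵥ v) ≤ v ⬝ᵥ S *ᵥ v) (hX : ‖X‖ ≤ x)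
    (hB' : B' = -(S * B) - (1 / 2 : ℝ) • (B * (Wᵀ * W)) + X)
    (hu : u ⬝ᵥ u = 1) (h1 : Bᵀ *ᵥ (B *ᵥ u) = l ^ 2 • u) (h2 : (B *ᵥ u) ⬝ᵥ (B *ᵥ u) = l ^ 2) :
    (B *ᵥ u) ⬝ᵥ (B' *ᵥ u) ≤ -s * l ^ 2 - l ^ 2 / 2 * ((W *ᵥ u) ⬝ᵥ (W *ᵥ u)) + x * l := by
  have t1 := hS (B *ᵥ u)
  rw [h2] at t1
  have t2 : (B *ᵥ u) ⬝ᵥ (B *ᵥ (Wᵀ *ᵥ (W *ᵥ u))) = l ^ 2 * ((W *ᵥ u) ⬝ᵥ (W *ᵥ u)) := by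
    rw [dotProduct_comm, mulVec_dotProduct, h1, dotProduct_smul, dotProduct_comm,
      ← mulVec_dotProduct W, smul_eq_mul]
  have t3 := (abs_le.1 (abs_dotProduct_mulVec_le_of_le (M := X) hl zero_le_one h2
    (hu.trans (one_pow 2).symm) hX)).2
  rw [hB']
  simp only [Matrix.add_mulVec, Matrix.sub_mulVec, Matrix.smul_mulVec, ← Matrix.mulVec_mulVec,
    dotProduct_add, dotProduct_sub, dotProduct_smul, smul_eq_mul, t2, Matrix.neg_mulVec,
    dotProduct_neg]
  nlinarith

/-- Growth of the top eigenvalue `l` of `H + ½ Z Zᵀ`, along an eigenvector `u`. Since `H ⪯ 0`, the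
eigenvalue equation turns the damping of `Z` into a contraction of order `l²`. -/
theorem growth_top_eigenvalue {H : Matrix c c ℝ} {W : Matrix p k ℝ} {Z Z' X : Matrix c k ℝ}
    {B : Matrix a k ℝ} {l z x : ℝ} {u : c → ℝ} (hl : 0 ≤ l) (hz : ‖Z‖ ≤ z)
    (hH : ∀ v : c → ℝ, v ⬝ᵥ H *ᵥ v ≤ 0) (hHt : Hᵀ = H) (hX : ‖X‖ ≤ x)
    (hW : Wᵀ * W = Bᵀ * B + Zᵀ * Z)
    (hZ' : Z' = -(H * Z) - (1 / 2 : ℝ) • (Z * (Wᵀ * W)) + X)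
    (hu : u ⬝ᵥ u = 1) (h1 : (H + (1 / 2 : ℝ) • (Z * Zᵀ)) *ᵥ u = l • u) :
    u ⬝ᵥ ((Z' * Zᵀ) *ᵥ u) ≤ - 2 * l ^ 2 + x * z := by
  set v := Zᵀ *ᵥ u with hv
  have e1 : H *ᵥ u + (1 / 2 : ℝ) • (Z *ᵥ v) = l • u := by
    rw [← h1, Matrix.add_mulVec, Matrix.smul_mulVec, ← Matrix.mulVec_mulVec]
  have e2 : Z *ᵥ v = (2 : ℝ) • (l • u - H *ᵥ u) := by
    rw [← e1, add_sub_cancel_left, smul_smul]; norm_num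
  have t0 : v ⬝ᵥ v = 2 * l - 2 * (u ⬝ᵥ H *ᵥ u) := by
    rw [hv, mulVec_dotProduct, Matrix.transpose_transpose, ← hv, e2, dotProduct_smul,
      dotProduct_sub, dotProduct_smul, hu]
    simp only [smul_eq_mul]; ring
  have t1 : -(u ⬝ᵥ H *ᵥ (Z *ᵥ v)) - (1 / 2) * (u ⬝ᵥ Z *ᵥ (Zᵀ *ᵥ (Z *ᵥ v))) = - l * (v ⬝ᵥ v) := by
    have e3 : u ⬝ᵥ H *ᵥ (Z *ᵥ v) = (H *ᵥ u) ⬝ᵥ (Z *ᵥ v) := by rw [mulVec_dotProduct, hHt]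
    have e4 : u ⬝ᵥ Z *ᵥ (Zᵀ *ᵥ (Z *ᵥ v)) = (Z *ᵥ v) ⬝ᵥ (Z *ᵥ v) := by
      rw [mulVec_dotProduct, hv, mulVec_dotProduct]; simp
    have e5 : (H *ᵥ u) ⬝ᵥ (Z *ᵥ v) + (1 / 2) * ((Z *ᵥ v) ⬝ᵥ (Z *ᵥ v)) = l * (v ⬝ᵥ v) := by
      rw [← smul_eq_mul (1 / 2 : ℝ), ← smul_dotProduct, ← add_dotProduct, e1, smul_dotProduct, hv,
        mulVec_dotProduct]
      simp
    rw [e3, e4]; linarith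
  have t2 : 0 ≤ u ⬝ᵥ Z *ᵥ (Bᵀ *ᵥ (B *ᵥ v)) := by
    have : u ⬝ᵥ Z *ᵥ (Bᵀ *ᵥ (B *ᵥ v)) = (B *ᵥ v) ⬝ᵥ (B *ᵥ v) := by
      rw [mulVec_dotProduct, hv, mulVec_dotProduct]; simp
    rw [this]; exact zero_le_dotProduct_self _
  have hu' : u ⬝ᵥ u = 1 ^ 2 := by simpa using hu
  have t3 := (abs_le.1 (abs_dotProduct_mulVec_le_of_le zero_le_one zero_le_one hu' hu'
    (norm_mul_le_of_le hX (norm_transpose_le hz)))).2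
  rw [← Matrix.mulVec_mulVec, ← hv] at t3
  rw [← Matrix.mulVec_mulVec, ← hv, hZ', hW]
  simp only [Matrix.add_mulVec, Matrix.sub_mulVec, Matrix.smul_mulVec, ← Matrix.mulVec_mulVec,
    dotProduct_add, dotProduct_sub, dotProduct_smul, smul_eq_mul, Matrix.neg_mulVec,
    dotProduct_neg, Matrix.mul_add]
  have := hH u
  nlinarith

end Growth

/-! ### Growth of the signal, the nuisance part and the misalignment -/

section Alignment

variable {p a c k : Type*} [Fintype p] [Fintype a] [Fintype c] [Fintype k]
  [DecidableEq p] [DecidableEq a] [DecidableEq c] [DecidableEq k]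

/-- Growth of the smallest eigenvalue `g` of `A Aᵀ`. The terms that involve `C` are
proportional to `g` as well, since `C Aᵀ = F A Aᵀ` and `Aᵀ u` has squared norm `g`. -/
theorem growth_signal {PA : Matrix a p ℝ} {PP : Matrix c p ℝ} {E : Matrix p p ℝ} {S : Matrix a a ℝ}
    {W : Matrix p k ℝ} {A B A' : Matrix a k ℝ} {C Z : Matrix c k ℝ} {F : Matrix c a ℝ}
    {s f zb γ e g : ℝ} {u : a → ℝ}
    (hS : ∀ v : a → ℝ, s * (v ⬝ᵥ v) ≤ v ⬝ᵥ S *ᵥ v)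
    (hWdec : W = PAᵀ * A + PPᵀ * C) (hWW : Wᵀ * W = Aᵀ * A + Cᵀ * C)
    (hA' : A' = S * A + (1 / 2 : ℝ) • (B * (Bᵀ * A)) + (1 / 2 : ℝ) • (B * (Zᵀ * C))
      - (1 / 2 : ℝ) • (A * (Wᵀ * W)) + PA * E * W)
    (hF : C * Aᵀ = F * (A * Aᵀ)) (hfn : ‖F‖ ≤ f) (hzb : ‖B * Zᵀ‖ ≤ zb) (hγ : ‖C‖ ≤ γ)
    (hPA : ‖PA‖ ≤ 1) (hPP : ‖PP‖ ≤ 1) (hE : ‖E‖ ≤ e) (hg : 0 ≤ g)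
    (hu : u ⬝ᵥ u = 1) (h1 : A *ᵥ (Aᵀ *ᵥ u) = g • u) :
    g * (s - zb * f / 2 - g / 2 - γ ^ 2 / 2 - e * (1 + f)) ≤ u ⬝ᵥ ((A' * Aᵀ) *ᵥ u) := by
  set v := Aᵀ *ᵥ u with hv
  have hu' : u ⬝ᵥ u = 1 ^ 2 := by simpa using hu
  have hvv : v ⬝ᵥ v = g := by
    rw [hv, mulVec_dotProduct, Matrix.transpose_transpose, ← hv, h1, dotProduct_smul, hu]; simp
  have hCv : C *ᵥ v = g • (F *ᵥ u) := by
    rw [hv, Matrix.mulVec_mulVec, hF, ← Matrix.mulVec_mulVec, ← Matrix.mulVec_mulVec, ← hv, h1,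
      Matrix.mulVec_smul]
  have hWv : W *ᵥ v = g • ((PAᵀ + PPᵀ * F) *ᵥ u) := by
    rw [hWdec, Matrix.add_mulVec, ← Matrix.mulVec_mulVec, ← Matrix.mulVec_mulVec, h1, hCv,
      Matrix.mulVec_smul, Matrix.mulVec_smul, ← smul_add, Matrix.add_mulVec, Matrix.mulVec_mulVec]
  have t1 := hS u
  rw [hu, mul_one] at t1
  have t2 : 0 ≤ u ⬝ᵥ B *ᵥ (Bᵀ *ᵥ u) := by
    rw [← Matrix.transpose_transpose B, ← mulVec_dotProduct, Matrix.transpose_transpose]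
    exact zero_le_dotProduct_self _
  have t3 := (abs_le.1 (abs_dotProduct_mulVec_le_of_le zero_le_one zero_le_one hu' hu'
    (norm_mul_le_of_le hzb hfn))).1
  have hWn : ‖PAᵀ + PPᵀ * F‖ ≤ 1 + f := by
    refine (norm_add_le _ _).trans (add_le_add (norm_transpose_le hPA) ?_)
    simpa using norm_mul_le_of_le (norm_transpose_le hPP) hfn
  have t5 := (abs_le.1 (abs_dotProduct_mulVec_le_of_le zero_le_one zero_le_one hu' hu'
    (norm_mul_le_of_le (norm_mul_le_of_le hPA hE) hWn))).1
  have t4 : u ⬝ᵥ A *ᵥ (Wᵀ *ᵥ (W *ᵥ v)) ≤ g ^ 2 + γ ^ 2 * g := by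
    have e1 : u ⬝ᵥ A *ᵥ (Wᵀ *ᵥ (W *ᵥ v)) = v ⬝ᵥ (Wᵀ * W) *ᵥ v := by
      rw [← Matrix.transpose_transpose A, ← mulVec_dotProduct, ← hv, Matrix.mulVec_mulVec]
    have e2 := dotProduct_mulVec_self_le C v
    rw [hvv] at e2
    have e3 : ‖C‖ ^ 2 * g ≤ γ ^ 2 * g := by gcongr
    rw [e1, hWW, Matrix.add_mulVec, ← Matrix.mulVec_mulVec, ← Matrix.mulVec_mulVec, dotProduct_add,
      h1, ← mulVec_dotProduct C]
    have e4 : v ⬝ᵥ Aᵀ *ᵥ (g • u) = g ^ 2 := by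
      rw [Matrix.mulVec_smul, ← hv, dotProduct_smul, hvv, smul_eq_mul]; ring
    rw [e4]; linarith
  rw [← Matrix.mulVec_mulVec, ← hv, hA']
  simp only [Matrix.add_mulVec, Matrix.sub_mulVec, Matrix.smul_mulVec, ← Matrix.mulVec_mulVec,
    dotProduct_add, dotProduct_sub, dotProduct_smul, smul_eq_mul, h1, hCv, Matrix.mulVec_smul]
  rw [hWv]
  simp only [Matrix.mulVec_smul, dotProduct_smul, smul_eq_mul]
  simp only [← Matrix.mulVec_mulVec] at t3 t5 t4
  rw [hWv] at t4
  have m1 := mul_le_mul_of_nonneg_left t1 hg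
  have m2 := mul_nonneg hg t2
  have m3 := mul_le_mul_of_nonneg_left t3 hg
  have m5 := mul_le_mul_of_nonneg_left t5 hg
  simp only [Matrix.mulVec_smul, dotProduct_smul, smul_eq_mul, Matrix.add_mulVec,
    ← Matrix.mulVec_mulVec] at t4 m5 ⊢
  linarith

/-- The velocity of `C` relative to `F A`. The part of `½ C Wᵀ W` along the rows of `A` cancels. -/
theorem relative_velocity {PA : Matrix a p ℝ} {PP : Matrix c p ℝ} {E : Matrix p p ℝ}
    {S : Matrix a a ℝ} {H : Matrix c c ℝ}
    {W : Matrix p k ℝ} {A B A' : Matrix a k ℝ} {C Z C' : Matrix c k ℝ} {F : Matrix c a ℝ}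
    (hWdec : W = PAᵀ * A + PPᵀ * C) (hWW : Wᵀ * W = Aᵀ * A + Cᵀ * C)
    (hA' : A' = S * A + (1 / 2 : ℝ) • (B * (Bᵀ * A)) + (1 / 2 : ℝ) • (B * (Zᵀ * C))
      - (1 / 2 : ℝ) • (A * (Wᵀ * W)) + PA * E * W)
    (hC' : C' = H * C + (1 / 2 : ℝ) • (Z * (Zᵀ * C)) + (1 / 2 : ℝ) • (Z * (Bᵀ * A))
      - (1 / 2 : ℝ) • (C * (Wᵀ * W)) + PP * E * W)
    (hCA : (C - F * A) * Aᵀ = 0) :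
    C' - F * A' = (H + (1 / 2 : ℝ) • (Z * Zᵀ)) * C
      + ((1 / 2 : ℝ) • (B * Zᵀ)ᵀ - F * S - (1 / 2 : ℝ) • (F * (B * Bᵀ))) * A
      - (1 / 2 : ℝ) • (F * (B * Zᵀ) * C) - (1 / 2 : ℝ) • ((C - F * A) * (C - F * A)ᵀ * C)
      + (PP - F * PA) * E * (PAᵀ * A + PPᵀ * C) := by
  have h1 : (C - F * A) * (C - F * A)ᵀ * C = (C - F * A) * (Wᵀ * W) := by
    rw [hWW, Matrix.transpose_sub, Matrix.transpose_mul, Matrix.mul_sub, ← Matrix.mul_assoc _ Aᵀ,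
      hCA, Matrix.zero_mul, sub_zero, Matrix.mul_add, ← Matrix.mul_assoc _ Aᵀ, hCA,
      Matrix.zero_mul, zero_add, Matrix.mul_assoc]
  rw [h1, ← hWdec, hA', hC']
  simp only [Matrix.add_mul, Matrix.sub_mul, Matrix.mul_add, Matrix.mul_sub, Matrix.smul_mul,
    Matrix.mul_smul, Matrix.mul_assoc, Matrix.transpose_mul, Matrix.transpose_transpose, smul_sub]
  abel

theorem norm_sub_mul_le {PA : Matrix a p ℝ} {PP : Matrix c p ℝ} {F : Matrix c a ℝ} {f : ℝ}
    (hPA : ‖PA‖ ≤ 1) (hPP : ‖PP‖ ≤ 1) (hfn : ‖F‖ ≤ f) : ‖PP - F * PA‖ ≤ 1 + f := by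
  refine (norm_sub_le _ _).trans (add_le_add hPP ?_)
  simpa using norm_mul_le_of_le hfn hPA

/-- Growth of the nuisance part `C - F A`. Its top singular vectors are orthogonal to the rows of `A`,
so the derivative `F'` of the misalignment does not contribute, and what drives `C` is the matrix
`H + ½ Z Zᵀ`, whose top eigenvalue is under control. -/
theorem growth_nuisance {PA : Matrix a p ℝ} {PP : Matrix c p ℝ} {E : Matrix p p ℝ}
    {S : Matrix a a ℝ} {H : Matrix c c ℝ}
    {W : Matrix p k ℝ} {A B A' : Matrix a k ℝ} {C Z C' : Matrix c k ℝ} {F F' : Matrix c a ℝ}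
    {f zb e g l : ℝ} {v : k → ℝ}
    (hWdec : W = PAᵀ * A + PPᵀ * C) (hWW : Wᵀ * W = Aᵀ * A + Cᵀ * C)
    (hA' : A' = S * A + (1 / 2 : ℝ) • (B * (Bᵀ * A)) + (1 / 2 : ℝ) • (B * (Zᵀ * C))
      - (1 / 2 : ℝ) • (A * (Wᵀ * W)) + PA * E * W)
    (hC' : C' = H * C + (1 / 2 : ℝ) • (Z * (Zᵀ * C)) + (1 / 2 : ℝ) • (Z * (Bᵀ * A))
      - (1 / 2 : ℝ) • (C * (Wᵀ * W)) + PP * E * W)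
    (hCA : (C - F * A) * Aᵀ = 0)
    (hG : ∀ x : c → ℝ, x ⬝ᵥ (H + (1 / 2 : ℝ) • (Z * Zᵀ)) *ᵥ x ≤ g * (x ⬝ᵥ x))
    (hfn : ‖F‖ ≤ f) (hzb : ‖B * Zᵀ‖ ≤ zb)
    (hPA : ‖PA‖ ≤ 1) (hPP : ‖PP‖ ≤ 1) (hE : ‖E‖ ≤ e) (hl : 0 < l)
    (h1 : (C - F * A)ᵀ *ᵥ ((C - F * A) *ᵥ v) = l ^ 2 • v)
    (h2 : ((C - F * A) *ᵥ v) ⬝ᵥ ((C - F * A) *ᵥ v) = l ^ 2) :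
    ((C - F * A) *ᵥ v) ⬝ᵥ ((C' - (F' * A + F * A')) *ᵥ v)
      ≤ l ^ 2 * (g + f * zb / 2 + (1 + f) * e) := by
  -- a top singular vector of `C - F A` is orthogonal to the rows of `A`
  have hAv : A *ᵥ v = 0 := by
    have h3 : A * (C - F * A)ᵀ = 0 := by
      rw [← Matrix.transpose_eq_zero, Matrix.transpose_mul, Matrix.transpose_transpose, hCA]
    have h4 : l ^ 2 • (A *ᵥ v) = 0 := by
      rw [← Matrix.mulVec_smul, ← h1, Matrix.mulVec_mulVec, h3, Matrix.zero_mulVec]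
    exact (smul_eq_zero.1 h4).resolve_left (by positivity)
  have hx : (C - F * A) *ᵥ v = C *ᵥ v := by
    rw [Matrix.sub_mulVec, ← Matrix.mulVec_mulVec, hAv, Matrix.mulVec_zero, sub_zero]
  have hrel := relative_velocity hWdec hWW hA' hC' hCA
  have e0 : (C' - (F' * A + F * A')) *ᵥ v = (C' - F * A') *ᵥ v := by
    rw [← sub_sub, sub_right_comm, Matrix.sub_mulVec (C' - F * A'), ← Matrix.mulVec_mulVec, hAv,
      Matrix.mulVec_zero, sub_zero]
  rw [e0, hrel]
  rw [hx] at h2 ⊢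
  set x := C *ᵥ v with hxdef
  have t1 := hG x
  rw [h2] at t1
  have t3 := (abs_le.1 (abs_dotProduct_mulVec_le_of_le hl.le hl.le h2 h2
    (norm_mul_le_of_le hfn hzb))).1
  have t4 : 0 ≤ x ⬝ᵥ (((C - F * A) * (C - F * A)ᵀ) *ᵥ x) := by
    rw [← Matrix.mulVec_mulVec]
    have := zero_le_dotProduct_self ((C - F * A)ᵀ *ᵥ x)
    rwa [mulVec_dotProduct, Matrix.transpose_transpose] at this
  have t5 := (abs_le.1 (abs_dotProduct_mulVec_le_of_le hl.le hl.le h2 h2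
    (norm_mul_le_of_le (norm_mul_le_of_le (norm_sub_mul_le hPA hPP hfn) hE)
      (norm_transpose_le hPP)))).2
  have e5 : ((PP - F * PA) * E * (PAᵀ * A + PPᵀ * C)) *ᵥ v = ((PP - F * PA) * E * PPᵀ) *ᵥ x := by
    rw [Matrix.mul_add, Matrix.add_mulVec, ← Matrix.mul_assoc, ← Matrix.mulVec_mulVec _ _ A, hAv,
      Matrix.mulVec_zero, zero_add, ← Matrix.mul_assoc, ← Matrix.mulVec_mulVec]
  rw [Matrix.add_mulVec, e5]
  simp only [Matrix.add_mulVec _ _ v, Matrix.sub_mulVec _ _ v, Matrix.smul_mulVec _ _ v,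
    ← Matrix.mulVec_mulVec v, hAv, ← hxdef, Matrix.mulVec_zero, dotProduct_add, dotProduct_sub,
    dotProduct_smul, smul_eq_mul, dotProduct_zero]
  linarith

/-- Growth of the misalignment `F`: a contraction at rate `s`, the growth rate of the signal, against
an expansion at rate `g`, the top eigenvalue of `H + ½ Z Zᵀ`. The nuisance part enters as
`ct ^ 2 * m`, its square relative to the smallest eigenvalue of `A Aᵀ`. -/
theorem growth_misalignment {PA : Matrix a p ℝ} {PP : Matrix c p ℝ} {E : Matrix p p ℝ}
    {S : Matrix a a ℝ} {H : Matrix c c ℝ}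
    {W : Matrix p k ℝ} {A B A' : Matrix a k ℝ} {C Z C' : Matrix c k ℝ} {F : Matrix c a ℝ}
    {f zb e g m ct s : ℝ} {u : a → ℝ}
    (hS : ∀ v : a → ℝ, s * (v ⬝ᵥ v) ≤ v ⬝ᵥ S *ᵥ v)
    (hWdec : W = PAᵀ * A + PPᵀ * C) (hWW : Wᵀ * W = Aᵀ * A + Cᵀ * C)
    (hA' : A' = S * A + (1 / 2 : ℝ) • (B * (Bᵀ * A)) + (1 / 2 : ℝ) • (B * (Zᵀ * C))
      - (1 / 2 : ℝ) • (A * (Wᵀ * W)) + PA * E * W)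
    (hC' : C' = H * C + (1 / 2 : ℝ) • (Z * (Zᵀ * C)) + (1 / 2 : ℝ) • (Z * (Bᵀ * A))
      - (1 / 2 : ℝ) • (C * (Wᵀ * W)) + PP * E * W)
    (hM : A * Aᵀ * (A * Aᵀ)⁻¹ = 1) (hFdef : F = C * Aᵀ * (A * Aᵀ)⁻¹)
    (hCA : (C - F * A) * Aᵀ = 0)
    (hG : ∀ x : c → ℝ, x ⬝ᵥ (H + (1 / 2 : ℝ) • (Z * Zᵀ)) *ᵥ x ≤ g * (x ⬝ᵥ x))
    (hfn : ‖F‖ ≤ f) (hzb : ‖B * Zᵀ‖ ≤ zb) (hct : ‖C - F * A‖ ≤ ct) (hm : ‖(A * Aᵀ)⁻¹‖ ≤ m)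
    (hPA : ‖PA‖ ≤ 1) (hPP : ‖PP‖ ≤ 1) (hE : ‖E‖ ≤ e) (hf : 0 ≤ f)
    (hu : u ⬝ᵥ u = 1) (h1 : Fᵀ *ᵥ (F *ᵥ u) = f ^ 2 • u)
    (h2 : (F *ᵥ u) ⬝ᵥ (F *ᵥ u) = f ^ 2) :
    (F *ᵥ u) ⬝ᵥ ((((C' - F * A') * Aᵀ + (C - F * A) * A'ᵀ) * (A * Aᵀ)⁻¹) *ᵥ u)
      ≤ f ^ 2 * (g - s) + f * (zb / 2 + f ^ 2 * zb / 2 + (1 + f) * e * (1 + f)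
        + ct ^ 2 * m * (zb / 2 + e)) := by
  set w := (A * Aᵀ)⁻¹ *ᵥ u with hw
  set v := Aᵀ *ᵥ w with hv
  have hAv : A *ᵥ v = u := by
    rw [hv, hw, Matrix.mulVec_mulVec, Matrix.mulVec_mulVec, hM, Matrix.one_mulVec]
  have hCv : C *ᵥ v = F *ᵥ u := by
    rw [hv, hw, Matrix.mulVec_mulVec, Matrix.mulVec_mulVec, hFdef]
  set x := F *ᵥ u with hx
  set Ct := C - F * A with hCt
  have hu' : u ⬝ᵥ u = 1 ^ 2 := by simpa using hu
  have hCtC : Ct * Ctᵀ = Ct * Cᵀ := by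
    conv_lhs => rw [hCt, Matrix.transpose_sub, Matrix.transpose_mul, ← hCt, Matrix.mul_sub,
      ← Matrix.mul_assoc _ Aᵀ, hCA, Matrix.zero_mul, sub_zero]
  -- the velocity of `A` seen from the nuisance part, whose rows are orthogonal to those of `A`
  have e1 : Ct * A'ᵀ = Ct * Ctᵀ * ((1 / 2 : ℝ) • (B * Zᵀ)ᵀ + PP * (PA * E)ᵀ)
      - (1 / 2 : ℝ) • (Ct * Ctᵀ * (C * Aᵀ)) := by
    have e11 : Wᵀ * (PA * E)ᵀ = Aᵀ * (PA * (PA * E)ᵀ) + Cᵀ * (PP * (PA * E)ᵀ) := by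
      conv_lhs => rw [hWdec]
      simp [Matrix.add_mul, Matrix.mul_assoc]
    have e12 : ∀ X : Matrix k a ℝ, Ct * (Aᵀ * (A * X)) = 0 := fun X => by
      rw [← Matrix.mul_assoc, hCA, Matrix.zero_mul]
    have e13 : ∀ X : Matrix a a ℝ, Ct * (Aᵀ * X) = 0 := fun X => by
      rw [← Matrix.mul_assoc, hCA, Matrix.zero_mul]
    rw [hA', hWW, hCtC]
    simp only [Matrix.transpose_add, Matrix.transpose_sub, Matrix.transpose_smul,
      Matrix.transpose_mul _ W, e11]
    simp only [Matrix.transpose_add,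
      Matrix.transpose_mul, Matrix.transpose_transpose, Matrix.mul_add, Matrix.mul_sub,
      Matrix.mul_smul, Matrix.mul_assoc, e13, smul_zero, zero_add, smul_add]
    abel
  rw [← Matrix.mulVec_mulVec, ← hw, Matrix.add_mulVec, ← Matrix.mulVec_mulVec, ← hv,
    relative_velocity hWdec hWW hA' hC' hCA, ← hCt, e1]
  have e2 : (C * Aᵀ) *ᵥ w = x := by rw [← Matrix.mulVec_mulVec, ← hv, hCv]
  have e3 : (PAᵀ * A + PPᵀ * C) *ᵥ v = (PAᵀ + PPᵀ * F) *ᵥ u := by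
    rw [Matrix.add_mulVec, ← Matrix.mulVec_mulVec, ← Matrix.mulVec_mulVec, hAv, hCv,
      Matrix.add_mulVec, Matrix.mulVec_mulVec]
  have hww : ‖WithLp.toLp 2 w‖ ≤ m := by
    have := norm_mulVec_toLp_le (A * Aᵀ)⁻¹ u
    rw [norm_toLp_of_dotProduct zero_le_one hu', mul_one] at this
    exact this.trans hm
  have t1 := hG x
  rw [h2] at t1
  have t2 := (abs_le.1 (abs_dotProduct_mulVec_le_of_le hf zero_le_one h2 hu'
    (norm_transpose_le hzb))).2
  have t3 : f ^ 2 * s ≤ x ⬝ᵥ (F * S) *ᵥ u := by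
    have : x ⬝ᵥ (F * S) *ᵥ u = f ^ 2 * (u ⬝ᵥ S *ᵥ u) := by
      rw [← Matrix.mulVec_mulVec, ← Matrix.transpose_transpose F, ← mulVec_dotProduct,
        h1, smul_dotProduct, smul_eq_mul]
    rw [this]
    have := hS u
    rw [hu, mul_one] at this
    gcongr
  have t4 : 0 ≤ x ⬝ᵥ (F * (B * Bᵀ)) *ᵥ u := by
    have : x ⬝ᵥ (F * (B * Bᵀ)) *ᵥ u = f ^ 2 * ((Bᵀ *ᵥ u) ⬝ᵥ (Bᵀ *ᵥ u)) := by
      rw [← Matrix.mulVec_mulVec, ← Matrix.transpose_transpose F, ← mulVec_dotProduct,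
        h1, smul_dotProduct, smul_eq_mul, mulVec_dotProduct,
        Matrix.transpose_transpose, Matrix.mulVec_mulVec]
    rw [this]
    exact mul_nonneg (sq_nonneg _) (zero_le_dotProduct_self _)
  have t5 := (abs_le.1 (abs_dotProduct_mulVec_le_of_le hf hf h2 h2
    (norm_mul_le_of_le hfn hzb))).1
  have t6 : 0 ≤ x ⬝ᵥ ((Ct * Ctᵀ) *ᵥ x) := by
    have := zero_le_dotProduct_self (Ctᵀ *ᵥ x)
    rwa [mulVec_dotProduct, Matrix.transpose_transpose, Matrix.mulVec_mulVec] at this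
  have hWn : ‖PAᵀ + PPᵀ * F‖ ≤ 1 + f := by
    refine (norm_add_le _ _).trans (add_le_add (norm_transpose_le hPA) ?_)
    simpa using norm_mul_le_of_le (norm_transpose_le hPP) hfn
  have t7 := (abs_le.1 (abs_dotProduct_mulVec_le_of_le hf zero_le_one h2 hu'
    (norm_mul_le_of_le (norm_mul_le_of_le (norm_sub_mul_le hPA hPP hfn) hE) hWn))).2
  have hn8 : ‖Ct * Ctᵀ * ((1 / 2 : ℝ) • (B * Zᵀ)ᵀ + PP * (PA * E)ᵀ)‖ ≤ ct * ct * (zb / 2 + e) := by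
    refine norm_mul_le_of_le (norm_mul_le_of_le hct (norm_transpose_le hct)) ?_
    refine (norm_add_le _ _).trans (add_le_add ?_ ?_)
    · rw [norm_smul, norm_transpose]; norm_num; linarith
    · simpa using norm_mul_le_of_le hPP (norm_transpose_le (norm_mul_le_of_le hPA hE))
  have t8 : x ⬝ᵥ (Ct * Ctᵀ * ((1 / 2 : ℝ) • (B * Zᵀ)ᵀ + PP * (PA * E)ᵀ)) *ᵥ w
      ≤ ct * ct * (zb / 2 + e) * f * m := by
    refine (le_abs_self _).trans ((abs_dotProduct_mulVec_le _ _ _).trans ?_)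
    rw [norm_toLp_of_dotProduct hf h2]
    have := (norm_nonneg _).trans hn8
    gcongr
  rw [Matrix.add_mulVec _ _ v, ← Matrix.mulVec_mulVec v ((PP - F * PA) * E), e3,
    Matrix.sub_mulVec _ _ w, Matrix.smul_mulVec _ _ w, ← Matrix.mulVec_mulVec w _ (C * Aᵀ), e2,
    Matrix.mulVec_mulVec u]
  simp only [Matrix.add_mulVec _ _ v, Matrix.sub_mulVec _ _ v, Matrix.smul_mulVec _ _ v,
    ← Matrix.mulVec_mulVec v, hAv, hCv, dotProduct_add, dotProduct_sub,
    dotProduct_smul, smul_eq_mul]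
  simp only [Matrix.sub_mulVec _ _ u, Matrix.smul_mulVec _ _ u, dotProduct_sub,
    dotProduct_smul, smul_eq_mul]
  linarith

end Alignment

/-! ### The spectral frame and the bounds to be propagated -/

section Frame

variable {p a b c k : Type*} [Fintype p] [Fintype a] [Fintype b] [Fintype c] [Fintype k]
  [DecidableEq p] [DecidableEq a] [DecidableEq b] [DecidableEq c] [DecidableEq k]

/-- The spectral geometry of the target: `Yh` is the symmetric dilation of `Y`, anticommuting with
the involution `J`; `PA` and `PP` project onto the eigenspaces of `Yh` for its `r` positive
eigenvalues (with block `S ⪰ s`) and for the others (with block `H ⪯ 0`), and `PN` projects onto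
its kernel. -/
structure SpectralFrame (PA : Matrix a p ℝ) (PP : Matrix c p ℝ) (PN : Matrix b p ℝ)
    (J Yh : Matrix p p ℝ) (S : Matrix a a ℝ) (H : Matrix c c ℝ) (JN : Matrix b b ℝ)
    (y s : ℝ) : Prop where
  J_transpose : Jᵀ = J
  J_mul_J : J * J = 1
  Yh_transpose : Yhᵀ = Yh
  Yh_mul_J : Yh * J = -(J * Yh)
  norm_Yh : ‖Yh‖ ≤ y
  resolution : PAᵀ * PA + PPᵀ * PP = 1
  PA_mul_Yh : PA * Yh = S * PA
  PP_mul_Yh : PP * Yh = H * PP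
  PN_mul_Yh : PN * Yh = 0
  PN_mul_J : PN * J = JN * PN
  norm_JN : ‖JN‖ ≤ 1
  PP_split : ∀ v : p → ℝ, (PP *ᵥ v) ⬝ᵥ (PP *ᵥ v)
    = (PN *ᵥ v) ⬝ᵥ (PN *ᵥ v) + ((PA * J) *ᵥ v) ⬝ᵥ ((PA * J) *ᵥ v)
  S_lower : ∀ v : a → ℝ, s * (v ⬝ᵥ v) ≤ v ⬝ᵥ S *ᵥ v
  H_transpose : Hᵀ = H
  H_nonpos : ∀ v : c → ℝ, v ⬝ᵥ H *ᵥ v ≤ 0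

/-- The velocity of the flow at `W` with perturbation `E`, expanded. -/
def velocity (J Yh E : Matrix p p ℝ) (W : Matrix p k ℝ) : Matrix p k ℝ :=
  Yh * W - (1 / 2 : ℝ) • (W * (Wᵀ * W)) + (1 / 2 : ℝ) • (J * W * (Wᵀ * J * W)) + E * W

theorem norm_le_one_of_mul_self {M : Matrix a b ℝ} (h : ∀ v, (M *ᵥ v) ⬝ᵥ (M *ᵥ v) ≤ v ⬝ᵥ v) :
    ‖M‖ ≤ 1 :=
  opNorm_le_of_dotProduct zero_le_one fun u => by simpa using h u

namespace SpectralFrame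

variable {PA : Matrix a p ℝ} {PP : Matrix c p ℝ} {PN : Matrix b p ℝ}
    {J Yh : Matrix p p ℝ} {S : Matrix a a ℝ} {H : Matrix c c ℝ} {JN : Matrix b b ℝ} {y s : ℝ}

theorem norm_J (h : SpectralFrame PA PP PN J Yh S H JN y s) : ‖J‖ ≤ 1 := by
  refine norm_le_one_of_mul_self fun v => ?_
  rw [mulVec_dotProduct, h.J_transpose, Matrix.mulVec_mulVec, h.J_mul_J, Matrix.one_mulVec]

theorem dotProduct_eq (h : SpectralFrame PA PP PN J Yh S H JN y s) (v : p → ℝ) :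
    v ⬝ᵥ v = (PA *ᵥ v) ⬝ᵥ (PA *ᵥ v) + (PP *ᵥ v) ⬝ᵥ (PP *ᵥ v) := by
  rw [mulVec_dotProduct, mulVec_dotProduct, ← dotProduct_add, Matrix.mulVec_mulVec,
    Matrix.mulVec_mulVec, ← Matrix.add_mulVec, h.resolution, Matrix.one_mulVec]

theorem norm_PA (h : SpectralFrame PA PP PN J Yh S H JN y s) : ‖PA‖ ≤ 1 :=
  norm_le_one_of_mul_self fun v => by
    rw [h.dotProduct_eq v]; linarith [zero_le_dotProduct_self (PP *ᵥ v)]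

theorem norm_PP (h : SpectralFrame PA PP PN J Yh S H JN y s) : ‖PP‖ ≤ 1 :=
  norm_le_one_of_mul_self fun v => by
    rw [h.dotProduct_eq v]; linarith [zero_le_dotProduct_self (PA *ᵥ v)]

theorem norm_PN (h : SpectralFrame PA PP PN J Yh S H JN y s) : ‖PN‖ ≤ 1 :=
  norm_le_one_of_mul_self fun v => by
    rw [h.dotProduct_eq v, h.PP_split]
    linarith [zero_le_dotProduct_self (PA *ᵥ v), zero_le_dotProduct_self ((PA * J) *ᵥ v)]

theorem norm_PP_mul_le (h : SpectralFrame PA PP PN J Yh S H JN y s) (X : Matrix p k ℝ) :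
    ‖PP * X‖ ≤ ‖PN * X‖ + ‖PA * J * X‖ := by
  refine opNorm_le_of_dotProduct (by positivity) fun u => ?_
  have h1 := dotProduct_mulVec_self_le (PN * X) u
  have h2 := dotProduct_mulVec_self_le (PA * J * X) u
  have h3 := h.PP_split (X *ᵥ u)
  simp only [Matrix.mulVec_mulVec] at h3
  have h4 := mul_nonneg (mul_nonneg (norm_nonneg (PN * X)) (norm_nonneg (PA * J * X)))
    (zero_le_dotProduct_self u)
  rw [h3]
  nlinarith

theorem decomposition (h : SpectralFrame PA PP PN J Yh S H JN y s) (X : Matrix p k ℝ) :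
    X = PAᵀ * (PA * X) + PPᵀ * (PP * X) := by
  rw [← Matrix.mul_assoc, ← Matrix.mul_assoc, ← Matrix.add_mul, h.resolution, Matrix.one_mul]

theorem gram (h : SpectralFrame PA PP PN J Yh S H JN y s) (X V : Matrix p k ℝ) :
    Xᵀ * V = (PA * X)ᵀ * (PA * V) + (PP * X)ᵀ * (PP * V) := by
  conv_lhs => rw [h.decomposition V, Matrix.mul_add]
  simp only [Matrix.transpose_mul, Matrix.mul_assoc]

theorem gram_J (h : SpectralFrame PA PP PN J Yh S H JN y s) (W : Matrix p k ℝ) :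
    Wᵀ * W = (PA * J * W)ᵀ * (PA * J * W) + (PP * J * W)ᵀ * (PP * J * W) := by
  have e : Wᵀ * W = (J * W)ᵀ * (J * W) := by
    rw [Matrix.transpose_mul, h.J_transpose, Matrix.mul_assoc, ← Matrix.mul_assoc J, h.J_mul_J,
      Matrix.one_mul]
  rw [e, h.gram (J * W) (J * W)]
  simp only [Matrix.mul_assoc]

theorem imbalance_eq (h : SpectralFrame PA PP PN J Yh S H JN y s) (W : Matrix p k ℝ) :
    Wᵀ * J * W = (PA * J * W)ᵀ * (PA * W) + (PP * J * W)ᵀ * (PP * W) := by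
  have e : Wᵀ * J * W = (J * W)ᵀ * W := by rw [Matrix.transpose_mul, h.J_transpose]
  rw [e, h.gram (J * W) W]
  simp only [Matrix.mul_assoc]

theorem PA_mul_velocity (h : SpectralFrame PA PP PN J Yh S H JN y s) (E : Matrix p p ℝ)
    (W : Matrix p k ℝ) :
    PA * velocity J Yh E W = S * (PA * W)
      + (1 / 2 : ℝ) • (PA * J * W * ((PA * J * W)ᵀ * (PA * W)))
      + (1 / 2 : ℝ) • (PA * J * W * ((PP * J * W)ᵀ * (PP * W)))
      - (1 / 2 : ℝ) • (PA * W * (Wᵀ * W)) + PA * E * W := by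
  rw [velocity, h.imbalance_eq]
  simp only [Matrix.mul_add, Matrix.mul_sub, Matrix.mul_smul, ← Matrix.mul_assoc, h.PA_mul_Yh,
    smul_add]
  abel

theorem PP_mul_velocity (h : SpectralFrame PA PP PN J Yh S H JN y s) (E : Matrix p p ℝ)
    (W : Matrix p k ℝ) :
    PP * velocity J Yh E W = H * (PP * W)
      + (1 / 2 : ℝ) • (PP * J * W * ((PP * J * W)ᵀ * (PP * W)))
      + (1 / 2 : ℝ) • (PP * J * W * ((PA * J * W)ᵀ * (PA * W)))
      - (1 / 2 : ℝ) • (PP * W * (Wᵀ * W)) + PP * E * W := by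
  rw [velocity, h.imbalance_eq]
  simp only [Matrix.mul_add, Matrix.mul_sub, Matrix.mul_smul, ← Matrix.mul_assoc, h.PP_mul_Yh,
    smul_add]
  abel

theorem PA_mul_J_mul_velocity (h : SpectralFrame PA PP PN J Yh S H JN y s)
    (E : Matrix p p ℝ) (W : Matrix p k ℝ) :
    PA * J * velocity J Yh E W = -(S * (PA * J * W))
      - (1 / 2 : ℝ) • (PA * J * W * (Wᵀ * W))
      + ((1 / 2 : ℝ) • (PA * W * (Wᵀ * J * W)) + PA * J * E * W) := by
  have e1 : PA * J * Yh = -(S * PA * J) := by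
    rw [Matrix.mul_assoc, ← neg_eq_iff_eq_neg.2 h.Yh_mul_J, Matrix.mul_neg, ← Matrix.mul_assoc,
      h.PA_mul_Yh]
  have e2 : PA * J * J = PA := by rw [Matrix.mul_assoc, h.J_mul_J, Matrix.mul_one]
  rw [velocity]
  simp only [Matrix.mul_add, Matrix.mul_sub, Matrix.mul_smul, ← Matrix.mul_assoc, e1, e2,
    Matrix.neg_mul]
  abel

theorem PP_mul_J_mul_velocity (h : SpectralFrame PA PP PN J Yh S H JN y s)
    (E : Matrix p p ℝ) (W : Matrix p k ℝ) :
    PP * J * velocity J Yh E W = -(H * (PP * J * W))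
      - (1 / 2 : ℝ) • (PP * J * W * (Wᵀ * W))
      + ((1 / 2 : ℝ) • (PP * W * (Wᵀ * J * W)) + PP * J * E * W) := by
  have e1 : PP * J * Yh = -(H * PP * J) := by
    rw [Matrix.mul_assoc, ← neg_eq_iff_eq_neg.2 h.Yh_mul_J, Matrix.mul_neg, ← Matrix.mul_assoc,
      h.PP_mul_Yh]
  have e2 : PP * J * J = PP := by rw [Matrix.mul_assoc, h.J_mul_J, Matrix.mul_one]
  rw [velocity]
  simp only [Matrix.mul_add, Matrix.mul_sub, Matrix.mul_smul, ← Matrix.mul_assoc, e1, e2,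
    Matrix.neg_mul]
  abel

theorem PN_mul_velocity (h : SpectralFrame PA PP PN J Yh S H JN y s)
    (E : Matrix p p ℝ) (W : Matrix p k ℝ) :
    PN * velocity J Yh E W = -((0 : Matrix b b ℝ) * (PN * W))
      - (1 / 2 : ℝ) • (PN * W * (Wᵀ * W))
      + ((1 / 2 : ℝ) • (JN * (PN * W) * (Wᵀ * J * W)) + PN * E * W) := by
  rw [velocity]
  simp only [Matrix.mul_add, Matrix.mul_sub, Matrix.mul_smul, ← Matrix.mul_assoc, h.PN_mul_Yh,
    h.PN_mul_J, Matrix.zero_mul, neg_zero, zero_sub]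
  abel

end SpectralFrame

/-- The scalar relations between the parameters of the warm-up phase, with `q = √‖Y‖`. -/
structure WarmupParams (q s α δ ε T : ℝ) : Prop where
  q_pos : 0 < q
  s_pos : 0 < s
  s_le : s ≤ q ^ 2
  one_le_alpha : 1 ≤ α
  delta_pos : 0 < δ
  delta_le : 64 * α * δ * q ^ 2 ≤ s
  eps_pos : 0 < ε
  T_pos : 0 < T
  five_le : 5 ≤ T * s
  nuisance_le : ∀ t ∈ Icc 0 T, (ε * Real.exp (3 * α * δ * q ^ 2 * t)) ^ 2
    ≤ α ^ 4 * min s (ε ^ 2 / α ^ 4 * Real.exp (4 * s / 5 * t))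

/-- The bounds propagated along the warm-up phase. Compared with the eight bounds of the warm-up
set, the bound on `PN * W` is sharper and grows with `t`, which absorbs the perturbation. -/
structure WarmupBounds (PA : Matrix a p ℝ) (PP : Matrix c p ℝ) (PN : Matrix b p ℝ)
    (J : Matrix p p ℝ) (H : Matrix c c ℝ) (q s α δ ε T t : ℝ) (W : Matrix p k ℝ) : Prop where
  norm_W : ‖W‖ ≤ 3 / 2 * q
  norm_imbalance : ‖Wᵀ * J * W‖ ≤ (1 + 5 * t / T) * δ ^ 2 * q ^ 2
  norm_B : ‖PA * J * W‖ ≤ δ / (3 * α) * q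
  norm_N : ‖PN * W‖ ≤ (5 / 2 + t / (4 * T)) * δ * q
  top_eigenvalue : ((2 * δ * q ^ 2) • (1 : Matrix c c ℝ)
    - (H + (1 / 2 : ℝ) • (PP * J * W * (PP * J * W)ᵀ))).PosSemidef
  norm_F : ‖PP * W * (PA * W)ᵀ * (PA * W * (PA * W)ᵀ)⁻¹‖ ≤ α ^ 2
  norm_nuisance : ‖PP * W - PP * W * (PA * W)ᵀ * (PA * W * (PA * W)ᵀ)⁻¹ * (PA * W)‖
    ≤ ε * Real.exp (3 * α * δ * q ^ 2 * t)
  signal : (PA * W * (PA * W)ᵀ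
    - min s (ε ^ 2 / α ^ 4 * Real.exp (4 * s / 5 * t)) • (1 : Matrix a a ℝ)).PosSemidef

theorem isUnit_of_posSemidef_sub {M : Matrix a a ℝ} {g : ℝ} (hg : 0 < g)
    (h : (M - g • (1 : Matrix a a ℝ)).PosSemidef) : IsUnit M := by
  have : M = (M - g • (1 : Matrix a a ℝ)) + g • 1 := by abel
  rw [this]
  exact (Matrix.PosDef.posSemidef_add h (Matrix.PosDef.one.smul hg)).isUnit

theorem norm_inv_le_of_posSemidef_sub {M : Matrix a a ℝ} {g : ℝ} (hg : 0 < g)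
    (h : (M - g • (1 : Matrix a a ℝ)).PosSemidef) : ‖M⁻¹‖ ≤ g⁻¹ := by
  have hu := isUnit_of_posSemidef_sub hg h
  refine opNorm_le_of_dotProduct (by positivity) fun u => ?_
  set w := M⁻¹ *ᵥ u with hw
  have hMw : M *ᵥ w = u := by
    rw [hw, Matrix.mulVec_mulVec, Matrix.mul_nonsing_inv _ ((Matrix.isUnit_iff_isUnit_det _).1 hu),
      Matrix.one_mulVec]
  have h1 := h.dotProduct_nonneg w
  rw [Matrix.sub_mulVec, hMw, Matrix.smul_mulVec, Matrix.one_mulVec, dotProduct_sub,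
    dotProduct_smul, smul_eq_mul] at h1
  have h2 := (abs_le.1 (abs_dotProduct_le w u)).2
  rw [dotProduct_self_eq_norm_sq] at h1 ⊢
  rw [dotProduct_self_eq_norm_sq]
  have h3 : ‖WithLp.toLp 2 w‖ ≤ g⁻¹ * ‖WithLp.toLp 2 u‖ := by
    rcases (norm_nonneg (WithLp.toLp 2 w)).eq_or_lt with h0 | h0
    · rw [← h0]; positivity
    · rw [inv_mul_eq_div, le_div_iff₀ hg]
      nlinarith
  rw [← mul_pow]
  gcongr

end Frame

/-! ### Persistence of the bounds -/

namespace WarmupParams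

variable {q s α δ ε T : ℝ}

theorem alpha_delta_le (hp : WarmupParams q s α δ ε T) : α * δ * q ^ 2 ≤ s / 64 := by
  have := hp.delta_le; linarith

theorem delta_mul_le (hp : WarmupParams q s α δ ε T) : δ * q ^ 2 ≤ α * δ * q ^ 2 := by
  have := mul_pos hp.delta_pos (pow_pos hp.q_pos 2)
  nlinarith [hp.one_le_alpha]

theorem alpha_mul_delta_le (hp : WarmupParams q s α δ ε T) : α * δ ≤ 1 / 64 := by
  have h1 := hp.alpha_delta_le
  have h2 := hp.s_le
  have h3 := pow_pos hp.q_pos 2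
  by_contra! h
  nlinarith

theorem delta_le_one_div (hp : WarmupParams q s α δ ε T) : δ ≤ 1 / 64 := by
  have := hp.alpha_mul_delta_le
  nlinarith [hp.one_le_alpha, hp.delta_pos]

/-- The size of the perturbation, measured against the spectral gap. -/
theorem perturbation_le (hp : WarmupParams q s α δ ε T) : δ ^ 2 / T ≤ δ ^ 2 * s / 5 := by
  rw [div_le_div_iff₀ hp.T_pos (by norm_num)]
  nlinarith [hp.five_le, pow_pos hp.delta_pos 2]

end WarmupParams

section Step

variable {p a b c k : Type*} [Fintype p] [Fintype a] [Fintype b] [Fintype c] [Fintype k]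
  [DecidableEq p] [DecidableEq a] [DecidableEq b] [DecidableEq c] [DecidableEq k]
  {PA : Matrix a p ℝ} {PP : Matrix c p ℝ} {PN : Matrix b p ℝ}
  {J Yh : Matrix p p ℝ} {S : Matrix a a ℝ} {H : Matrix c c ℝ} {JN : Matrix b b ℝ}
  {q s α δ ε T t : ℝ} {W : ℝ → Matrix p k ℝ} {E : Matrix p p ℝ}

theorem WarmupBounds.norm_imbalance_le {W : Matrix p k ℝ} (hp : WarmupParams q s α δ ε T)
    (ht : t ≤ T) (hb : WarmupBounds PA PP PN J H q s α δ ε T t W) :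
    ‖Wᵀ * J * W‖ ≤ 6 * δ ^ 2 * q ^ 2 := by
  refine hb.norm_imbalance.trans ?_
  have : 5 * t / T ≤ 5 := by rw [div_le_iff₀ hp.T_pos]; linarith
  have h2 : 1 + 5 * t / T ≤ 6 := by linarith
  gcongr

/-- At the level `3 / 2 * q` the cubic damping beats the growth rate `q ^ 2` of the target. -/
theorem eventually_norm_factor_le (hf : SpectralFrame PA PP PN J Yh S H JN (q ^ 2) s)
    (hp : WarmupParams q s α δ ε T) (ht : t ∈ Ico 0 T) (hE : ‖E‖ ≤ δ ^ 2 / T)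
    (hd : HasDerivWithinAt W (velocity J Yh E (W t)) (Ici t) t)
    (hb : WarmupBounds PA PP PN J H q s α δ ε T t (W t)) :
    ∀ᶠ t' in 𝓝[>] t, ‖W t'‖ ≤ 3 / 2 * q := by
  have hq := hp.q_pos
  refine eventually_opNorm_le (b := fun _ => 3 / 2 * q) hd (hasDerivWithinAt_const _ _ _)
    (by positivity) hb.norm_W fun u hu h1 h2 => ?_
  refine (growth_factor hf.J_transpose hf.norm_Yh (hE.trans hp.perturbation_le) rfl
    (hb.norm_imbalance_le hp ht.2.le) (by positivity) rfl hu h1 h2).trans_lt ?_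
  rw [mul_zero]
  have h3 : δ ^ 2 ≤ 1 / 64 ^ 2 := by
    have := hp.delta_pos; have := hp.delta_le_one_div
    nlinarith
  have h4 : δ ^ 2 * s / 5 ≤ q ^ 2 / 100 := by
    nlinarith [hp.s_le, hp.s_pos, sq_nonneg δ]
  have h5 : (6 * δ ^ 2 * q ^ 2) ^ 2 ≤ q ^ 4 / 100 := by
    have : (6 * δ ^ 2 * q ^ 2) ^ 2 ≤ (1 / 10 * q ^ 2) ^ 2 := by
      gcongr; linarith
    linarith [this, show (1 / 10 * q ^ 2) ^ 2 = q ^ 4 / 100 by ring]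
  have h6 : δ ^ 2 * s / 5 * (3 / 2 * q) ^ 2 ≤ q ^ 2 / 100 * (3 / 2 * q) ^ 2 := by gcongr
  have h7 : 0 < q ^ 4 := by positivity
  nlinarith

/-- The imbalance grows at rate at most `9 / 2 * δ² q² / T`, within the allowed rate `5 * δ² q² / T`. -/
theorem eventually_norm_imbalance_le (hf : SpectralFrame PA PP PN J Yh S H JN (q ^ 2) s)
    (hp : WarmupParams q s α δ ε T) (ht : t ∈ Ico 0 T) (hE : ‖E‖ ≤ δ ^ 2 / T)
    (hd : HasDerivWithinAt W (velocity J Yh E (W t)) (Ici t) t)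
    (hb : WarmupBounds PA PP PN J H q s α δ ε T t (W t)) :
    ∀ᶠ t' in 𝓝[>] t, ‖(W t')ᵀ * J * W t'‖ ≤ (1 + 5 * t' / T) * δ ^ 2 * q ^ 2 := by
  have hq := hp.q_pos
  have hδ := hp.delta_pos
  have hT := hp.T_pos
  have hbd : HasDerivWithinAt (fun x : ℝ => (1 + 5 * x / T) * δ ^ 2 * q ^ 2)
      (5 / T * δ ^ 2 * q ^ 2) (Ici t) t := by
    have := ((((((hasDerivAt_id t).const_mul 5).div_const T).const_add 1).mul_const
      (δ ^ 2)).mul_const (q ^ 2)).hasDerivWithinAt (s := Ici t)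
    simpa using this
  have hpos : 0 < (1 + 5 * t / T) * δ ^ 2 * q ^ 2 := by
    have := ht.1; positivity
  have hXd : HasDerivWithinAt (fun x => (W x)ᵀ * (J * W x))
      ((W t)ᵀ * (Eᵀ * J + J * E) * W t) (Ici t) t := by
    rw [← deriv_imbalance hf.J_transpose hf.J_mul_J hf.Yh_mul_J hf.Yh_transpose rfl rfl]
    exact hasDerivWithinAt_mul (hasDerivWithinAt_transpose hd) (hasDerivWithinAt_const_mul J hd)
  simp only [← Matrix.mul_assoc] at hXd
  refine eventually_opNorm_le hXd hbd hpos hb.norm_imbalance fun u hu h1 h2 => ?_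
  have hEJ : ‖Eᵀ * J + J * E‖ ≤ δ ^ 2 / T * 1 + 1 * (δ ^ 2 / T) :=
    (norm_add_le _ _).trans (add_le_add (norm_mul_le_of_le (norm_transpose_le hE) hf.norm_J)
      (norm_mul_le_of_le hf.norm_J hE))
  have hn := norm_mul_le_of_le (norm_mul_le_of_le (norm_transpose_le hb.norm_W) hEJ) hb.norm_W
  have hn2 := (abs_le.1 (abs_dotProduct_mulVec_le_of_le hpos.le zero_le_one h2
    (hu.trans (one_pow 2).symm) hn)).2
  refine hn2.trans_lt ?_
  have e1 : 3 / 2 * q * (δ ^ 2 / T * 1 + 1 * (δ ^ 2 / T)) * (3 / 2 * q)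
      = 9 / 2 * (δ ^ 2 / T * q ^ 2) := by ring
  have e2 : 5 / T * δ ^ 2 * q ^ 2 = 5 * (δ ^ 2 / T * q ^ 2) := by ring
  rw [e1, e2, mul_one, mul_comm]
  have : 0 < δ ^ 2 / T * q ^ 2 := by positivity
  gcongr
  norm_num

/-- The block `PA * J * W` is contracted at rate `s`, which beats the imbalance and the perturbation. -/
theorem eventually_norm_skew_signal_le (hf : SpectralFrame PA PP PN J Yh S H JN (q ^ 2) s)
    (hp : WarmupParams q s α δ ε T) (ht : t ∈ Ico 0 T) (hE : ‖E‖ ≤ δ ^ 2 / T)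
    (hd : HasDerivWithinAt W (velocity J Yh E (W t)) (Ici t) t)
    (hb : WarmupBounds PA PP PN J H q s α δ ε T t (W t)) :
    ∀ᶠ t' in 𝓝[>] t, ‖PA * J * W t'‖ ≤ δ / (3 * α) * q := by
  have hq := hp.q_pos
  have hδ := hp.delta_pos
  have hα : 0 < α := zero_lt_one.trans_le hp.one_le_alpha
  have hs := hp.s_pos
  have hpos : 0 < δ / (3 * α) * q := by positivity
  refine eventually_opNorm_le (b := fun _ => δ / (3 * α) * q) (hasDerivWithinAt_const_mul _ hd)
    (hasDerivWithinAt_const _ _ _) hpos hb.norm_B fun u hu h1 h2 => ?_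
  have hX : ‖(1 / 2 : ℝ) • (PA * W t * ((W t)ᵀ * J * W t)) + PA * J * E * W t‖
      ≤ 1 / 2 * (1 * (3 / 2 * q) * (6 * δ ^ 2 * q ^ 2))
        + 1 * 1 * (δ ^ 2 * s / 5) * (3 / 2 * q) := by
    refine (norm_add_le _ _).trans (add_le_add ?_ ?_)
    · rw [norm_smul, Real.norm_of_nonneg (by norm_num)]
      gcongr
      exact norm_mul_le_of_le (norm_mul_le_of_le hf.norm_PA hb.norm_W)
        (hb.norm_imbalance_le hp ht.2.le)
    · exact norm_mul_le_of_le (norm_mul_le_of_le (norm_mul_le_of_le hf.norm_PA hf.norm_J)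
        (hE.trans hp.perturbation_le)) hb.norm_W
  refine (growth_damped_block hpos.le hf.S_lower hX (hf.PA_mul_J_mul_velocity E (W t)) hu h1
    h2).trans_lt ?_
  rw [mul_zero]
  have h3 := mul_nonneg (sq_nonneg (δ / (3 * α) * q)) (zero_le_dotProduct_self (W t *ᵥ u))
  have h4 : 1 / 2 * (1 * (3 / 2 * q) * (6 * δ ^ 2 * q ^ 2)) + 1 * 1 * (δ ^ 2 * s / 5) * (3 / 2 * q)
      < s * (δ / (3 * α) * q) := by
    have e : s * (δ / (3 * α) * q) = δ * q * (s / (3 * α)) := by field_simp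
    have e' : 1 / 2 * (1 * (3 / 2 * q) * (6 * δ ^ 2 * q ^ 2))
      + 1 * 1 * (δ ^ 2 * s / 5) * (3 / 2 * q) = δ * q * (9 / 2 * (δ * q ^ 2) + 3 / 10 * (δ * s)) := by
      ring
    rw [e, e']
    gcongr
    rw [lt_div_iff₀ (by positivity)]
    have h5 := hp.alpha_delta_le
    have h6 : α * δ * s ≤ s / 64 := by
      have := hp.alpha_mul_delta_le
      nlinarith
    nlinarith
  nlinarith

/-- The block `PN * W` is not contracted by the target. It is kept small by the cubic damping, up to
the perturbation, which the time-dependent part of the bound absorbs. -/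
theorem eventually_norm_kernel_le (hf : SpectralFrame PA PP PN J Yh S H JN (q ^ 2) s)
    (hp : WarmupParams q s α δ ε T) (ht : t ∈ Ico 0 T) (hE : ‖E‖ ≤ δ ^ 2 / T)
    (hd : HasDerivWithinAt W (velocity J Yh E (W t)) (Ici t) t)
    (hb : WarmupBounds PA PP PN J H q s α δ ε T t (W t)) :
    ∀ᶠ t' in 𝓝[>] t, ‖PN * W t'‖ ≤ (5 / 2 + t' / (4 * T)) * δ * q := by
  have hq := hp.q_pos
  have hδ := hp.delta_pos
  have hT := hp.T_pos
  have ht0 := ht.1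
  have hpos : 0 < (5 / 2 + t / (4 * T)) * δ * q := by positivity
  have hbd : HasDerivWithinAt (fun x : ℝ => (5 / 2 + x / (4 * T)) * δ * q)
      (1 / (4 * T) * δ * q) (Ici t) t := by
    have := (((((hasDerivAt_id t).div_const (4 * T)).const_add (5 / 2)).mul_const
      δ).mul_const q).hasDerivWithinAt (s := Ici t)
    simpa using this
  refine eventually_opNorm_le (hasDerivWithinAt_const_mul _ hd) hbd hpos hb.norm_N
    fun u hu h1 h2 => ?_
  set l := (5 / 2 + t / (4 * T)) * δ * q with hl
  have hX : ‖(1 / 2 : ℝ) • (JN * (PN * W t) * ((W t)ᵀ * J * W t)) + PN * E * W t‖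
      ≤ 1 / 2 * (1 * l * (6 * δ ^ 2 * q ^ 2)) + 1 * (δ ^ 2 / T) * (3 / 2 * q) := by
    refine (norm_add_le _ _).trans (add_le_add ?_ ?_)
    · rw [norm_smul, Real.norm_of_nonneg (by norm_num)]
      gcongr
      exact norm_mul_le_of_le (norm_mul_le_of_le hf.norm_JN hb.norm_N)
        (hb.norm_imbalance_le hp ht.2.le)
    · exact norm_mul_le_of_le (norm_mul_le_of_le hf.norm_PN hE) hb.norm_W
  refine (growth_damped_block (s := 0) hpos.le (by simp) hX (hf.PN_mul_velocity E (W t)) hu h1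
    h2).trans_lt ?_
  -- above `√6 δ q` the cubic damping beats the imbalance
  have h3 : 6 * δ ^ 2 * q ^ 2 ≤ l ^ 2 := by
    have : (5 / 2 * δ * q) ^ 2 ≤ l ^ 2 := by
      have : 0 ≤ t / (4 * T) := by positivity
      rw [hl]; gcongr; linarith
    nlinarith [sq_nonneg (δ * q)]
  have h4 : l ^ 2 ≤ (W t *ᵥ u) ⬝ᵥ (W t *ᵥ u) := by
    rw [← h2, ← Matrix.mulVec_mulVec]
    refine (dotProduct_mulVec_self_le PN _).trans ?_
    have := pow_le_one₀ (n := 2) (norm_nonneg _) hf.norm_PN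
    have := zero_le_dotProduct_self (W t *ᵥ u)
    nlinarith
  have h5 : 1 * (δ ^ 2 / T) * (3 / 2 * q) < 1 / (4 * T) * δ * q := by
    have e1 : 1 * (δ ^ 2 / T) * (3 / 2 * q) = δ * q / T * (3 / 2 * δ) := by ring
    have e2 : 1 / (4 * T) * δ * q = δ * q / T * (1 / 4) := by field_simp
    rw [e1, e2]
    gcongr
    linarith [hp.delta_le_one_div]
  have h6 : 1 / 2 * l ^ 2 * (6 * δ ^ 2 * q ^ 2) ≤ 1 / 2 * l ^ 2 * ((W t *ᵥ u) ⬝ᵥ (W t *ᵥ u)) := by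
    gcongr; linarith
  nlinarith

/-- The contraction `2 * (2 * δ * q²)²` beats the imbalance, which is of order `δ² q⁴` with a smaller
constant. -/
theorem eventually_top_eigenvalue_le (hf : SpectralFrame PA PP PN J Yh S H JN (q ^ 2) s)
    (hp : WarmupParams q s α δ ε T) (ht : t ∈ Ico 0 T) (hE : ‖E‖ ≤ δ ^ 2 / T)
    (hd : HasDerivWithinAt W (velocity J Yh E (W t)) (Ici t) t)
    (hb : WarmupBounds PA PP PN J H q s α δ ε T t (W t)) :
    ∀ᶠ t' in 𝓝[>] t, ((2 * δ * q ^ 2) • (1 : Matrix c c ℝ)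
      - (H + (1 / 2 : ℝ) • (PP * J * W t' * (PP * J * W t')ᵀ))).PosSemidef := by
  have hq := hp.q_pos
  have hδ := hp.delta_pos
  have hZ := hasDerivWithinAt_const_mul (PP * J) hd
  set Z' := PP * J * velocity J Yh E (W t) with hZ'
  have hG := ((hasDerivWithinAt_mul hZ (hasDerivWithinAt_transpose hZ)).const_smul
    (1 / 2 : ℝ)).const_add H |>.const_sub ((2 * δ * q ^ 2) • (1 : Matrix c c ℝ))
  refine eventually_posSemidef (fun t => by simp [hf.H_transpose]) hG hb.top_eigenvalue
    fun u hu hz => ?_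
  rw [Matrix.sub_mulVec, Matrix.smul_mulVec, Matrix.one_mulVec, sub_eq_zero] at hz
  have hPJ : ‖PP * J * W t‖ ≤ 1 * 1 * (3 / 2 * q) :=
    norm_mul_le_of_le (norm_mul_le_of_le hf.norm_PP hf.norm_J) hb.norm_W
  have hX : ‖(1 / 2 : ℝ) • (PP * W t * ((W t)ᵀ * J * W t)) + PP * J * E * W t‖
      ≤ 1 / 2 * (1 * (3 / 2 * q) * (6 * δ ^ 2 * q ^ 2))
        + 1 * 1 * (δ ^ 2 * s / 5) * (3 / 2 * q) := by
    refine (norm_add_le _ _).trans (add_le_add ?_ ?_)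
    · rw [norm_smul, Real.norm_of_nonneg (by norm_num)]
      gcongr
      exact norm_mul_le_of_le (norm_mul_le_of_le hf.norm_PP hb.norm_W)
        (hb.norm_imbalance_le hp ht.2.le)
    · exact norm_mul_le_of_le (norm_mul_le_of_le (norm_mul_le_of_le hf.norm_PP hf.norm_J)
        (hE.trans hp.perturbation_le)) hb.norm_W
  have key := growth_top_eigenvalue (by positivity) hPJ hf.H_nonpos hf.H_transpose hX
    (hf.gram_J (W t)) (hf.PP_mul_J_mul_velocity E (W t)) hu hz.symm
  rw [← hZ'] at key
  have e1 : u ⬝ᵥ ((PP * J * W t * Z'ᵀ) *ᵥ u) = u ⬝ᵥ ((Z' * (PP * J * W t)ᵀ) *ᵥ u) := by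
    rw [dotProduct_comm, mulVec_dotProduct]
    simp
  rw [Matrix.neg_mulVec, dotProduct_neg, Matrix.smul_mulVec, dotProduct_smul, Matrix.add_mulVec,
    dotProduct_add, e1, smul_eq_mul]
  have h4 : δ ^ 2 * s ≤ δ ^ 2 * q ^ 2 := by
    gcongr; exact hp.s_le
  have h5 : 0 < δ ^ 2 * q ^ 4 := by positivity
  nlinarith [mul_le_mul_of_nonneg_right h4 (sq_nonneg q)]

end Step

section AlignmentStep

variable {p a b c k : Type*} [Fintype p] [Fintype a] [Fintype b] [Fintype c] [Fintype k]
  [DecidableEq p] [DecidableEq a] [DecidableEq b] [DecidableEq c] [DecidableEq k]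
  {PA : Matrix a p ℝ} {PP : Matrix c p ℝ} {PN : Matrix b p ℝ}
  {J Yh : Matrix p p ℝ} {S : Matrix a a ℝ} {H : Matrix c c ℝ} {JN : Matrix b b ℝ}
  {q s α δ ε T t : ℝ} {W : ℝ → Matrix p k ℝ} {E : Matrix p p ℝ}

namespace WarmupParams

theorem threshold_pos (hp : WarmupParams q s α δ ε T) (t : ℝ) :
    0 < min s (ε ^ 2 / α ^ 4 * Real.exp (4 * s / 5 * t)) := by
  have := hp.eps_pos
  have : 0 < α := zero_lt_one.trans_le hp.one_le_alpha
  exact lt_min hp.s_pos (by positivity)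

theorem perturbation_mul_le (hp : WarmupParams q s α δ ε T) :
    α ^ 2 * (δ ^ 2 * s / 5) ≤ s / 20000 := by
  have h1 := hp.alpha_mul_delta_le
  have h2 : 0 ≤ α * δ := mul_nonneg (zero_le_one.trans hp.one_le_alpha) hp.delta_pos.le
  have h3 : (α * δ) ^ 2 ≤ (1 / 64) ^ 2 := by gcongr
  have e : α ^ 2 * (δ ^ 2 * s / 5) = (α * δ) ^ 2 * s / 5 := by ring
  rw [e]
  nlinarith [hp.s_pos]

end WarmupParams

namespace WarmupBounds

variable {W : Matrix p k ℝ}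

theorem isUnit_gram (hp : WarmupParams q s α δ ε T)
    (hb : WarmupBounds PA PP PN J H q s α δ ε T t W) : IsUnit (PA * W * (PA * W)ᵀ) :=
  isUnit_of_posSemidef_sub (hp.threshold_pos t) hb.signal

theorem gram_mul_inv (hp : WarmupParams q s α δ ε T)
    (hb : WarmupBounds PA PP PN J H q s α δ ε T t W) :
    PA * W * (PA * W)ᵀ * (PA * W * (PA * W)ᵀ)⁻¹ = 1 :=
  Matrix.mul_nonsing_inv _ ((Matrix.isUnit_iff_isUnit_det _).1 (hb.isUnit_gram hp))

theorem misalignment_mul_gram (hp : WarmupParams q s α δ ε T)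
    (hb : WarmupBounds PA PP PN J H q s α δ ε T t W) :
    PP * W * (PA * W)ᵀ
      = PP * W * (PA * W)ᵀ * (PA * W * (PA * W)ᵀ)⁻¹ * (PA * W * (PA * W)ᵀ) := by
  rw [Matrix.mul_assoc _ _ (PA * W * (PA * W)ᵀ), Matrix.nonsing_inv_mul _
    ((Matrix.isUnit_iff_isUnit_det _).1 (hb.isUnit_gram hp)), Matrix.mul_one]

theorem nuisance_mul_signal (hp : WarmupParams q s α δ ε T)
    (hb : WarmupBounds PA PP PN J H q s α δ ε T t W) :
    (PP * W - PP * W * (PA * W)ᵀ * (PA * W * (PA * W)ᵀ)⁻¹ * (PA * W)) * (PA * W)ᵀ = 0 := by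
  rw [Matrix.sub_mul, Matrix.mul_assoc (_ * _) (PA * W), ← hb.misalignment_mul_gram hp, sub_self]

theorem top_eigenvalue_le (hb : WarmupBounds PA PP PN J H q s α δ ε T t W) (x : c → ℝ) :
    x ⬝ᵥ (H + (1 / 2 : ℝ) • (PP * J * W * (PP * J * W)ᵀ)) *ᵥ x ≤ 2 * δ * q ^ 2 * (x ⬝ᵥ x) := by
  have := hb.top_eigenvalue.dotProduct_nonneg x
  rw [Matrix.sub_mulVec, dotProduct_sub, Matrix.smul_mulVec, Matrix.one_mulVec, dotProduct_smul,
    smul_eq_mul] at this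
  linarith

theorem norm_cross_le (hf : SpectralFrame PA PP PN J Yh S H JN (q ^ 2) s)
    (hp : WarmupParams q s α δ ε T) (hb : WarmupBounds PA PP PN J H q s α δ ε T t W) :
    ‖PA * J * W * (PP * J * W)ᵀ‖ ≤ δ * q ^ 2 / (2 * α) := by
  have hα : 0 < α := zero_lt_one.trans_le hp.one_le_alpha
  have := norm_mul_le_of_le hb.norm_B (norm_transpose_le
    (norm_mul_le_of_le (norm_mul_le_of_le hf.norm_PP hf.norm_J) hb.norm_W))
  refine this.trans_eq ?_
  field_simp

end WarmupBounds

/-- The smallest eigenvalue of `A Aᵀ` grows at relative rate at least `9 / 10 * s` below the level `s`,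
more than the rate `4 / 5 * s` of the bound. -/
theorem eventually_signal_ge (hf : SpectralFrame PA PP PN J Yh S H JN (q ^ 2) s)
    (hp : WarmupParams q s α δ ε T) (ht : t ∈ Ico 0 T) (hE : ‖E‖ ≤ δ ^ 2 / T)
    (hd : HasDerivWithinAt W (velocity J Yh E (W t)) (Ici t) t)
    (hb : WarmupBounds PA PP PN J H q s α δ ε T t (W t)) :
    ∀ᶠ t' in 𝓝[>] t, (PA * W t' * (PA * W t')ᵀ
      - min s (ε ^ 2 / α ^ 4 * Real.exp (4 * s / 5 * t')) • (1 : Matrix a a ℝ)).PosSemidef := by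
  have hδ := hp.delta_pos
  have hα : 0 < α := zero_lt_one.trans_le hp.one_le_alpha
  have hgpos := hp.threshold_pos t
  have hgs := min_le_left s (ε ^ 2 / α ^ 4 * Real.exp (4 * s / 5 * t))
  set g := min s (ε ^ 2 / α ^ 4 * Real.exp (4 * s / 5 * t)) with hg
  have hA := hasDerivWithinAt_const_mul PA hd
  have hAA := hasDerivWithinAt_mul hA (hasDerivWithinAt_transpose hA)
  -- it suffices to follow either branch of the minimum
  have main : ∀ (cf : ℝ → ℝ) (cf' : ℝ), HasDerivWithinAt cf cf' (Ici t) t → cf t = g →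
      cf' ≤ 4 * s / 5 * g →
      ∀ᶠ t' in 𝓝[>] t, (PA * W t' * (PA * W t')ᵀ - cf t' • (1 : Matrix a a ℝ)).PosSemidef := by
    intro cf cf' hcf hcg hcf'
    refine eventually_posSemidef (fun t => by simp) (hAA.sub (hcf.smul_const 1))
      (by rw [hcg]; exact hb.signal) fun u hu hz => ?_
    rw [Matrix.sub_mulVec, Matrix.smul_mulVec, Matrix.one_mulVec, hcg, sub_eq_zero,
      ← Matrix.mulVec_mulVec] at hz
    have hγ : ‖PP * W t‖ ≤ 37 / 12 * δ * q := by
      refine (hf.norm_PP_mul_le (W t)).trans ((add_le_add hb.norm_N hb.norm_B).trans ?_)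
      have h1 : t / (4 * T) ≤ 1 / 4 := by
        rw [div_le_div_iff₀ (by linarith [hp.T_pos]) (by norm_num)]; linarith [ht.2]
      have h2 : δ / (3 * α) ≤ δ / 3 := by
        gcongr; linarith [hp.one_le_alpha]
      have h3 := mul_le_mul_of_nonneg_right h1 (mul_pos hδ hp.q_pos).le
      have h4 := mul_le_mul_of_nonneg_right h2 hp.q_pos.le
      nlinarith
    have key := growth_signal hf.S_lower (hf.decomposition (W t)) (hf.gram (W t) (W t))
      (hf.PA_mul_velocity E (W t)) (hb.misalignment_mul_gram hp) hb.norm_F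
      (hb.norm_cross_le hf hp) hγ hf.norm_PA hf.norm_PP (hE.trans hp.perturbation_le) hgpos.le hu hz
    have e1 : u ⬝ᵥ ((PA * W t * (PA * velocity J Yh E (W t))ᵀ) *ᵥ u)
        = u ⬝ᵥ ((PA * velocity J Yh E (W t) * (PA * W t)ᵀ) *ᵥ u) := by
      rw [dotProduct_comm, mulVec_dotProduct]; simp
    rw [Matrix.sub_mulVec, dotProduct_sub, Matrix.add_mulVec, dotProduct_add, e1, Matrix.smul_mulVec,
      Matrix.one_mulVec, dotProduct_smul, hu, smul_eq_mul, mul_one]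
    have h5 : δ * q ^ 2 / (2 * α) * α ^ 2 / 2 ≤ s / 256 := by
      have : δ * q ^ 2 / (2 * α) * α ^ 2 / 2 = α * δ * q ^ 2 / 4 := by field_simp; norm_num
      rw [this]; linarith [hp.alpha_delta_le]
    have h6 : (37 / 12 * δ * q) ^ 2 / 2 ≤ s / 800 := by
      have h1 := hp.delta_mul_le.trans hp.alpha_delta_le
      have h2 := hp.delta_le_one_div
      have h3 : δ * (δ * q ^ 2) ≤ 1 / 64 * (s / 64) := by
        gcongr
      nlinarith [hp.s_pos]
    have h7 : δ ^ 2 * s / 5 * (1 + α ^ 2) ≤ s / 10000 := by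
      have h1 := hp.perturbation_mul_le
      have h2 : 1 ≤ α ^ 2 := one_le_pow₀ hp.one_le_alpha
      have h3 : 0 ≤ δ ^ 2 * s / 5 := by have := hp.s_pos; positivity
      nlinarith
    have h8 : g * (9 / 20 * s) ≤ g * (s - δ * q ^ 2 / (2 * α) * α ^ 2 / 2 - g / 2
        - (37 / 12 * δ * q) ^ 2 / 2 - δ ^ 2 * s / 5 * (1 + α ^ 2)) := by
      gcongr
      linarith [hp.s_pos]
    have h9 := mul_pos hgpos hp.s_pos
    linarith
  rcases le_total s (ε ^ 2 / α ^ 4 * Real.exp (4 * s / 5 * t)) with h | h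
  · have := main (fun _ => s) 0 (hasDerivWithinAt_const _ _ _) (min_eq_left h).symm
      (by have := hp.s_pos; positivity)
    filter_upwards [this] with t' h1
    have h2 : ((s - min s (ε ^ 2 / α ^ 4 * Real.exp (4 * s / 5 * t'))) •
      (1 : Matrix a a ℝ)).PosSemidef := Matrix.PosSemidef.one.smul (by simp)
    have h3 := h1.add h2
    rw [sub_smul] at h3
    simpa using h3
  · have hder : HasDerivWithinAt (fun x => ε ^ 2 / α ^ 4 * Real.exp (4 * s / 5 * x))
        (4 * s / 5 * g) (Ici t) t := by
      have := (((hasDerivAt_id t).const_mul (4 * s / 5)).exp.const_mul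
        (ε ^ 2 / α ^ 4)).hasDerivWithinAt (s := Ici t)
      rw [hg, min_eq_right h]
      convert! this using 1
      simp only [id]; ring
    have := main _ _ hder (min_eq_right h).symm le_rfl
    filter_upwards [this] with t' h1
    have h2 : ((ε ^ 2 / α ^ 4 * Real.exp (4 * s / 5 * t')
      - min s (ε ^ 2 / α ^ 4 * Real.exp (4 * s / 5 * t'))) •
      (1 : Matrix a a ℝ)).PosSemidef := Matrix.PosSemidef.one.smul (by simp)
    have h3 := h1.add h2
    rw [sub_smul] at h3
    simpa using h3

/-- The velocity of `F = C A†` in terms of the velocity `D` of `W`. -/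
theorem hasDerivWithinAt_misalignment (hp : WarmupParams q s α δ ε T)
    {D : Matrix p k ℝ} (hd : HasDerivWithinAt W D (Ici t) t)
    (hb : WarmupBounds PA PP PN J H q s α δ ε T t (W t)) {F : ℝ → Matrix c a ℝ}
    (hF : F = fun t => PP * W t * (PA * W t)ᵀ * (PA * W t * (PA * W t)ᵀ)⁻¹) :
    HasDerivWithinAt F
      (((PP * D - F t * (PA * D)) * (PA * W t)ᵀ
        + (PP * W t - F t * (PA * W t)) * (PA * D)ᵀ) * (PA * W t * (PA * W t)ᵀ)⁻¹)
      (Ici t) t := by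
  have hA := hasDerivWithinAt_const_mul PA hd
  have hC := hasDerivWithinAt_const_mul PP hd
  have hAA := hasDerivWithinAt_mul hA (hasDerivWithinAt_transpose hA)
  have h := hasDerivWithinAt_mul (hasDerivWithinAt_mul hC (hasDerivWithinAt_transpose hA))
    (hasDerivWithinAt_inv hAA (hb.isUnit_gram hp))
  rw [hF]
  convert! h using 1
  simp only [Matrix.add_mul, Matrix.sub_mul, Matrix.mul_add, Matrix.mul_assoc,
    Matrix.mul_neg]
  abel

/-- The nuisance part never exceeds `α²` times the smallest singular value of the signal
(`WarmupParams.nuisance_le`), so that the contraction of `F` at rate about `s` decides. -/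
theorem eventually_norm_misalignment_le (hf : SpectralFrame PA PP PN J Yh S H JN (q ^ 2) s)
    (hp : WarmupParams q s α δ ε T) (ht : t ∈ Ico 0 T) (hE : ‖E‖ ≤ δ ^ 2 / T)
    (hd : HasDerivWithinAt W (velocity J Yh E (W t)) (Ici t) t)
    (hb : WarmupBounds PA PP PN J H q s α δ ε T t (W t)) :
    ∀ᶠ t' in 𝓝[>] t,
      ‖PP * W t' * (PA * W t')ᵀ * (PA * W t' * (PA * W t')ᵀ)⁻¹‖ ≤ α ^ 2 := by
  have hδ := hp.delta_pos
  have hs := hp.s_pos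
  have hα : 0 < α := zero_lt_one.trans_le hp.one_le_alpha
  refine eventually_opNorm_le (b := fun _ => α ^ 2)
    (hasDerivWithinAt_misalignment hp hd hb rfl) (hasDerivWithinAt_const _ _ _) (by positivity)
    hb.norm_F fun u hu h1 h2 => ?_
  have hgpos := hp.threshold_pos t
  refine (growth_misalignment hf.S_lower (hf.decomposition (W t)) (hf.gram (W t) (W t))
    (hf.PA_mul_velocity E (W t)) (hf.PP_mul_velocity E (W t)) (hb.gram_mul_inv hp) rfl
    (hb.nuisance_mul_signal hp) hb.top_eigenvalue_le hb.norm_F (hb.norm_cross_le hf hp)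
    hb.norm_nuisance (norm_inv_le_of_posSemidef_sub hgpos hb.signal) hf.norm_PA hf.norm_PP
    (hE.trans hp.perturbation_le) (by positivity) hu h1 h2).trans_lt ?_
  rw [mul_zero]
  have h3 : (ε * Real.exp (3 * α * δ * q ^ 2 * t)) ^ 2
      * (min s (ε ^ 2 / α ^ 4 * Real.exp (4 * s / 5 * t)))⁻¹ ≤ (α ^ 2) ^ 2 := by
    rw [← div_eq_mul_inv, div_le_iff₀ hgpos, ← pow_mul]
    exact hp.nuisance_le t ⟨ht.1, ht.2.le⟩
  have hf1 : 1 ≤ α ^ 2 := one_le_pow₀ hp.one_le_alpha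
  set f := α ^ 2 with hfd
  have hz : 0 ≤ δ * q ^ 2 / (2 * α) := by positivity
  have he : 0 ≤ δ ^ 2 * s / 5 := by positivity
  have h4 := mul_le_mul_of_nonneg_right h3 (show 0 ≤ δ * q ^ 2 / (2 * α) / 2 + δ ^ 2 * s / 5 by
    positivity)
  have h5 : δ * q ^ 2 / (2 * α) * f ≤ s / 128 := by
    have : δ * q ^ 2 / (2 * α) * f = α * δ * q ^ 2 / 2 := by rw [hfd]; field_simp
    rw [this]; linarith [hp.alpha_delta_le]
  have h6 : f * (δ ^ 2 * s / 5) ≤ s / 20000 := hp.perturbation_mul_le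
  have h7 := hp.delta_mul_le.trans hp.alpha_delta_le
  set z := δ * q ^ 2 / (2 * α) with hzdef
  set e := δ ^ 2 * s / 5 with hedef
  have h8 : z / 2 + f ^ 2 * z / 2 + (1 + f) * e * (1 + f) + f ^ 2 * (z / 2 + e)
      ≤ f * (3 / 2 * (z * f) + 5 * (f * e)) := by
    have : 0 ≤ f - 1 := by linarith
    nlinarith [mul_nonneg this hz, mul_nonneg this he, mul_nonneg (mul_nonneg this hz) this,
      mul_nonneg (mul_nonneg this he) this]
  have h9 : f * (3 / 2 * (z * f) + 5 * (f * e)) ≤ f * (s / 10) := by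
    gcongr; linarith
  have h10 : f ^ 2 * (2 * δ * q ^ 2 - s) ≤ f ^ 2 * (- s / 2) := by
    gcongr; linarith
  have h11 : f * (z / 2 + f ^ 2 * z / 2 + (1 + f) * e * (1 + f)
      + (ε * Real.exp (3 * α * δ * q ^ 2 * t)) ^ 2
      * (min s (ε ^ 2 / α ^ 4 * Real.exp (4 * s / 5 * t)))⁻¹ * (z / 2 + e)) ≤ f * (f * (s / 10)) := by
    gcongr; linarith
  have h12 : 0 < f ^ 2 * s := by positivity
  nlinarith

/-- The relative growth rate is `2 δ q²` from the top eigenvalue, plus at most `α δ q²` from the cross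
term and the perturbation; together at most `3 α δ q²`. -/
theorem eventually_norm_nuisance_le (hf : SpectralFrame PA PP PN J Yh S H JN (q ^ 2) s)
    (hp : WarmupParams q s α δ ε T) (hE : ‖E‖ ≤ δ ^ 2 / T)
    (hd : HasDerivWithinAt W (velocity J Yh E (W t)) (Ici t) t)
    (hb : WarmupBounds PA PP PN J H q s α δ ε T t (W t)) :
    ∀ᶠ t' in 𝓝[>] t,
      ‖PP * W t' - PP * W t' * (PA * W t')ᵀ * (PA * W t' * (PA * W t')ᵀ)⁻¹ * (PA * W t')‖
        ≤ ε * Real.exp (3 * α * δ * q ^ 2 * t') := by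
  have hδ := hp.delta_pos
  have hq := hp.q_pos
  have hs := hp.s_pos
  have hα : 0 < α := zero_lt_one.trans_le hp.one_le_alpha
  have hpos : 0 < ε * Real.exp (3 * α * δ * q ^ 2 * t) := by have := hp.eps_pos; positivity
  have hbd : HasDerivWithinAt (fun x => ε * Real.exp (3 * α * δ * q ^ 2 * x))
      (3 * α * δ * q ^ 2 * (ε * Real.exp (3 * α * δ * q ^ 2 * t))) (Ici t) t := by
    have := (((hasDerivAt_id t).const_mul (3 * α * δ * q ^ 2)).exp.const_mul
      ε).hasDerivWithinAt (s := Ici t)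
    convert! this using 1
    simp only [id]; ring
  have hXd := (hasDerivWithinAt_const_mul PP hd).sub (hasDerivWithinAt_mul
    (hasDerivWithinAt_misalignment hp hd hb rfl) (hasDerivWithinAt_const_mul PA hd))
  refine eventually_opNorm_le hXd hbd hpos hb.norm_nuisance fun u hu h1 h2 => ?_
  refine (growth_nuisance (hf.decomposition (W t)) (hf.gram (W t) (W t))
    (hf.PA_mul_velocity E (W t)) (hf.PP_mul_velocity E (W t))
    (hb.nuisance_mul_signal hp) hb.top_eigenvalue_le hb.norm_F (hb.norm_cross_le hf hp)
    hf.norm_PA hf.norm_PP (hE.trans hp.perturbation_le) hpos h1 h2).trans_lt ?_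
  set l := ε * Real.exp (3 * α * δ * q ^ 2 * t)
  have e1 : l * (3 * α * δ * q ^ 2 * l) = l ^ 2 * (3 * (α * δ * q ^ 2)) := by ring
  rw [e1]
  gcongr
  have h5 : α ^ 2 * (δ * q ^ 2 / (2 * α)) / 2 = α * δ * q ^ 2 / 4 := by field_simp; norm_num
  have h6 := hp.delta_mul_le
  have h7 : (1 + α ^ 2) * (δ ^ 2 * s / 5) ≤ α * δ * q ^ 2 / 100 := by
    have h1 : 1 ≤ α ^ 2 := one_le_pow₀ hp.one_le_alpha
    have h2 : (1 + α ^ 2) * (δ ^ 2 * s / 5) ≤ (2 * α ^ 2) * (δ ^ 2 * q ^ 2 / 5) := by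
      gcongr
      · linarith
      · exact hp.s_le
    have h3 := mul_le_mul_of_nonneg_right hp.alpha_mul_delta_le
      (show 0 ≤ α * δ * q ^ 2 by positivity)
    nlinarith
  have h8 : 0 < α * δ * q ^ 2 := by positivity
  rw [h5]
  linarith

/-- The bounds persist for a short time. -/
theorem eventually_warmupBounds (hf : SpectralFrame PA PP PN J Yh S H JN (q ^ 2) s)
    (hp : WarmupParams q s α δ ε T) (ht : t ∈ Ico 0 T) (hE : ‖E‖ ≤ δ ^ 2 / T)
    (hd : HasDerivWithinAt W (velocity J Yh E (W t)) (Ici t) t)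
    (hb : WarmupBounds PA PP PN J H q s α δ ε T t (W t)) :
    ∀ᶠ t' in 𝓝[>] t, WarmupBounds PA PP PN J H q s α δ ε T t' (W t') := by
  filter_upwards [eventually_norm_factor_le hf hp ht hE hd hb,
    eventually_norm_imbalance_le hf hp ht hE hd hb,
    eventually_norm_skew_signal_le hf hp ht hE hd hb,
    eventually_norm_kernel_le hf hp ht hE hd hb,
    eventually_top_eigenvalue_le hf hp ht hE hd hb,
    eventually_norm_misalignment_le hf hp ht hE hd hb,
    eventually_norm_nuisance_le hf hp hE hd hb,
    eventually_signal_ge hf hp ht hE hd hb] with t' h1 h2 h3 h4 h5 h6 h7 h8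
  exact ⟨h1, h2, h3, h4, h5, h6, h7, h8⟩

theorem tendsto_matrix_mul {l : Filter ℝ} {X : ℝ → Matrix a b ℝ} {V : ℝ → Matrix b c ℝ}
    {X0 : Matrix a b ℝ} {V0 : Matrix b c ℝ} (hX : Tendsto X l (𝓝 X0)) (hV : Tendsto V l (𝓝 V0)) :
    Tendsto (fun x => X x * V x) l (𝓝 (X0 * V0)) :=
  ((continuous_fst.matrix_mul continuous_snd).tendsto (X0, V0)).comp (hX.prodMk_nhds hV)

theorem tendsto_matrix_transpose {l : Filter ℝ} {X : ℝ → Matrix a b ℝ}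
    {X0 : Matrix a b ℝ} (hX : Tendsto X l (𝓝 X0)) : Tendsto (fun x => (X x)ᵀ) l (𝓝 X0ᵀ) :=
  ((transposeL a b).continuous.tendsto X0).comp hX

theorem tendsto_matrix_inv {l : Filter ℝ} {X : ℝ → Matrix a a ℝ}
    {X0 : Matrix a a ℝ} (hX : Tendsto X l (𝓝 X0)) (hu : IsUnit X0) :
    Tendsto (fun x => (X x)⁻¹) l (𝓝 X0⁻¹) := by
  obtain ⟨x, rfl⟩ := hu
  simp only [Matrix.nonsing_inv_eq_ringInverse]
  exact (NormedRing.inverse_continuousAt x).tendsto.comp hX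

theorem posSemidef_of_tendsto {l : Filter ℝ} [l.NeBot] {N : ℝ → Matrix a a ℝ}
    {N0 : Matrix a a ℝ} (hN : Tendsto N l (𝓝 N0)) (h : ∀ᶠ x in l, (N x).PosSemidef) :
    N0.PosSemidef := by
  refine posSemidef_of_dotProduct ?_ fun u => ?_
  · refine tendsto_nhds_unique_of_eventuallyEq (tendsto_matrix_transpose hN) hN ?_
    filter_upwards [h] with x hx using hx.transpose_eq
  · have h1 : Tendsto (fun x => u ⬝ᵥ N x *ᵥ u) l (𝓝 (u ⬝ᵥ N0 *ᵥ u)) :=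
      ((continuous_const.dotProduct (continuous_id.matrix_mulVec continuous_const)).tendsto
        N0).comp hN
    refine ge_of_tendsto h1 ?_
    filter_upwards [h] with x hx using hx.dotProduct_nonneg u

/-- The bounds are closed conditions along a continuous path. The bound on the signal comes first,
since it makes the misalignment continuous. -/
theorem warmupBounds_of_tendsto (hp : WarmupParams q s α δ ε T) {l : Filter ℝ} [l.NeBot]
    (hl : l ≤ 𝓝 t) (hW : Tendsto W l (𝓝 (W t)))
    (hb : ∀ᶠ x in l, WarmupBounds PA PP PN J H q s α δ ε T x (W x)) :
    WarmupBounds PA PP PN J H q s α δ ε T t (W t) := by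
  have hlim : ∀ {g : ℝ → ℝ}, Continuous g → Tendsto g l (𝓝 (g t)) := fun hg =>
    (hg.tendsto t).mono_left hl
  have hA := tendsto_matrix_mul (tendsto_const_nhds (x := PA)) hW
  have hC := tendsto_matrix_mul (tendsto_const_nhds (x := PP)) hW
  have hZ := tendsto_matrix_mul (tendsto_const_nhds (x := PP * J)) hW
  have hAA := tendsto_matrix_mul hA (tendsto_matrix_transpose hA)
  have hsig : (PA * W t * (PA * W t)ᵀ - min s (ε ^ 2 / α ^ 4 * Real.exp (4 * s / 5 * t)) •
      (1 : Matrix a a ℝ)).PosSemidef := by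
    refine posSemidef_of_tendsto (hAA.sub (Tendsto.smul_const
      (hlim (g := fun t => min s (ε ^ 2 / α ^ 4 * Real.exp (4 * s / 5 * t))) (by fun_prop)) _)) ?_
    filter_upwards [hb] with x hx using hx.signal
  have hF := tendsto_matrix_mul (tendsto_matrix_mul hC (tendsto_matrix_transpose hA))
    (tendsto_matrix_inv hAA (isUnit_of_posSemidef_sub (hp.threshold_pos t) hsig))
  refine ⟨?_, ?_, ?_, ?_, ?_, ?_, ?_, hsig⟩
  · exact le_of_tendsto hW.norm (hb.mono fun x hx => hx.norm_W)
  · exact le_of_tendsto_of_tendsto (tendsto_matrix_mul (tendsto_matrix_mul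
      (tendsto_matrix_transpose hW) tendsto_const_nhds) hW).norm
      (hlim (g := fun t => (1 + 5 * t / T) * δ ^ 2 * q ^ 2) (by fun_prop))
      (hb.mono fun x hx => hx.norm_imbalance)
  · exact le_of_tendsto (tendsto_matrix_mul tendsto_const_nhds hW).norm
      (hb.mono fun x hx => hx.norm_B)
  · exact le_of_tendsto_of_tendsto (tendsto_matrix_mul tendsto_const_nhds hW).norm
      (hlim (g := fun t => (5 / 2 + t / (4 * T)) * δ * q) (by fun_prop))
      (hb.mono fun x hx => hx.norm_N)
  · exact posSemidef_of_tendsto (((tendsto_matrix_mul hZ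
      (tendsto_matrix_transpose hZ)).const_smul _).const_add H |>.const_sub _)
      (hb.mono fun x hx => hx.top_eigenvalue)
  · exact le_of_tendsto hF.norm (hb.mono fun x hx => hx.norm_F)
  · exact le_of_tendsto_of_tendsto (hC.sub (tendsto_matrix_mul hF hA)).norm
      (hlim (g := fun t => ε * Real.exp (3 * α * δ * q ^ 2 * t)) (by fun_prop))
      (hb.mono fun x hx => hx.norm_nuisance)

end AlignmentStep

section

variable {m n h N : ℕ}

/-! ### The restricted isometry property in operator norm -/

section Measurement

/-- The operator norm is determined by pairs of unit vectors. -/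
theorem opNorm_le_of_bilin {p q : Type*} [Fintype p] [Fintype q] [DecidableEq p] [DecidableEq q]
    {M : Matrix p q ℝ} {b : ℝ} (hb : 0 ≤ b)
    (h : ∀ (u : p → ℝ) (v : q → ℝ), u ⬝ᵥ u = 1 → v ⬝ᵥ v = 1 → u ⬝ᵥ M *ᵥ v ≤ b) : ‖M‖ ≤ b := by
  rw [Matrix.l2_opNorm_def]
  refine ContinuousLinearMap.opNorm_le_of_re_inner_le hb fun v u hv hu => ?_
  have h1 := h u.ofLp v.ofLp (by rw [dotProduct_self_eq_norm_sq, WithLp.toLp_ofLp, hu, one_pow])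
    (by rw [dotProduct_self_eq_norm_sq, WithLp.toLp_ofLp, hv, one_pow])
  rw [dotProduct_comm, dotProduct_eq_inner] at h1
  exact h1

theorem rank_add_le {p q : Type*} [Fintype q] [Finite p] (M V : Matrix p q ℝ) :
    (M + V).rank ≤ M.rank + V.rank := by
  rw [Matrix.rank, Matrix.rank, Matrix.rank, Matrix.mulVecLin_add]
  exact (Submodule.finrank_mono (LinearMap.range_add_le _ _)).trans
    (Submodule.finrank_add_le_finrank_add_finrank _ _)

theorem frobSq_nonneg (X : Matrix (Fin m) (Fin n) ℝ) : 0 ≤ frobSq X :=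
  Finset.sum_nonneg fun _ _ => Finset.sum_nonneg fun _ _ => sq_nonneg _

theorem eq_zero_of_frobSq_eq_zero {X : Matrix (Fin m) (Fin n) ℝ} (h0 : frobSq X = 0) : X = 0 := by
  ext i j
  have h1 := (Finset.sum_eq_zero_iff_of_nonneg fun i _ =>
    Finset.sum_nonneg fun j _ => sq_nonneg (X i j)).1 h0 i (Finset.mem_univ i)
  have h2 := (Finset.sum_eq_zero_iff_of_nonneg fun j _ => sq_nonneg (X i j)).1 h1 j
    (Finset.mem_univ j)
  simpa using h2

theorem frobSq_eq_trace (X : Matrix (Fin m) (Fin n) ℝ) : frobSq X = (Xᵀ * X).trace := by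
  rw [frobSq, Finset.sum_comm]
  simp [Matrix.trace, Matrix.mul_apply, pow_two]

/-- `‖X‖_F² ≤ rank X * ‖X‖²`: the eigenvalues of `Xᵀ X` are at most `‖X‖²`, and `rank X` of them are
nonzero. -/
theorem frobSq_le_rank_mul (X : Matrix (Fin m) (Fin n) ℝ) : frobSq X ≤ X.rank * ‖X‖ ^ 2 := by
  have hX : (Xᵀ * X).IsHermitian := by
    simpa using Matrix.isHermitian_conjTranspose_mul_self X
  have hr : X.rank = (Finset.univ.filter fun i => hX.eigenvalues i ≠ 0).card := by
    rw [← Matrix.rank_transpose_mul_self X, hX.rank_eq_card_non_zero_eigs, Fintype.card_subtype]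
  have hle : ∀ i, hX.eigenvalues i ≤ ‖X‖ ^ 2 := by
    intro i
    have h1 := hX.mulVec_eigenvectorBasis i
    set v := (hX.eigenvectorBasis i).ofLp with hv
    have hv1 : v ⬝ᵥ v = 1 := by
      rw [dotProduct_self_eq_norm_sq, hv, WithLp.toLp_ofLp, hX.eigenvectorBasis.orthonormal.1 i]
      norm_num
    have h2 := dotProduct_mulVec_self_le X v
    rw [mulVec_dotProduct, Matrix.mulVec_mulVec, h1, dotProduct_smul, hv1] at h2
    simpa using h2
  rw [frobSq_eq_trace, hX.trace_eq_sum_eigenvalues, hr]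
  simp only [RCLike.ofReal_real_eq_id, id]
  rw [← Finset.sum_filter_ne_zero, ← nsmul_eq_mul]
  exact Finset.sum_le_card_nsmul _ _ _ fun i _ => hle i

/-- The deviation `𝒜* 𝒜 - I`. -/
def deviation (𝒜 : Matrix (Fin m) (Fin n) ℝ →ₗ[ℝ] EuclideanSpace ℝ (Fin N))
    (X : Matrix (Fin m) (Fin n) ℝ) : Matrix (Fin m) (Fin n) ℝ := adj 𝒜 (𝒜 X) - X

theorem deviation_add (𝒜 : Matrix (Fin m) (Fin n) ℝ →ₗ[ℝ] EuclideanSpace ℝ (Fin N))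
    (X V : Matrix (Fin m) (Fin n) ℝ) : deviation 𝒜 (X + V) = deviation 𝒜 X + deviation 𝒜 V := by
  ext i j
  simp only [deviation, adj, map_add, inner_add_right, Matrix.sub_apply, Matrix.of_apply,
    Matrix.add_apply]
  ring

theorem deviation_smul (𝒜 : Matrix (Fin m) (Fin n) ℝ →ₗ[ℝ] EuclideanSpace ℝ (Fin N)) (c : ℝ)
    (X : Matrix (Fin m) (Fin n) ℝ) : deviation 𝒜 (c • X) = c • deviation 𝒜 X := by
  ext i j
  simp only [deviation, adj, map_smul, inner_smul_right, Matrix.sub_apply, Matrix.of_apply,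
    Matrix.smul_apply, smul_eq_mul]
  ring

theorem deviation_sum (𝒜 : Matrix (Fin m) (Fin n) ℝ →ₗ[ℝ] EuclideanSpace ℝ (Fin N))
    {ι : Type*} (I : Finset ι) (X : ι → Matrix (Fin m) (Fin n) ℝ) :
    deviation 𝒜 (∑ i ∈ I, X i) = ∑ i ∈ I, deviation 𝒜 (X i) := by
  classical
  induction I using Finset.induction_on with
  | empty => simpa using deviation_smul 𝒜 0 0
  | insert i I hi ih => rw [Finset.sum_insert hi, Finset.sum_insert hi, deviation_add, ih]

theorem frobSq_add_sub_frobSq_sub (X V : Matrix (Fin m) (Fin n) ℝ) :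
    frobSq (V + X) - frobSq (V - X) = 4 * ∑ i, ∑ j, V i j * X i j := by
  simp only [frobSq, ← Finset.sum_sub_distrib, Finset.mul_sum, Matrix.add_apply, Matrix.sub_apply]
  refine Finset.sum_congr rfl fun i _ => Finset.sum_congr rfl fun j _ => ?_
  ring

theorem frobSq_parallelogram (X V : Matrix (Fin m) (Fin n) ℝ) :
    frobSq (V + X) + frobSq (V - X) = 2 * (frobSq V + frobSq X) := by
  simp only [frobSq, ← Finset.sum_add_distrib, Finset.mul_sum, Matrix.add_apply, Matrix.sub_apply]
  refine Finset.sum_congr rfl fun i _ => Finset.sum_congr rfl fun j _ => ?_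
  ring

theorem frobSq_vecMulVec (u : Fin m → ℝ) (v : Fin n → ℝ) :
    frobSq (Matrix.vecMulVec u v) = (u ⬝ᵥ u) * (v ⬝ᵥ v) := by
  simp only [frobSq, Matrix.vecMulVec_apply, dotProduct, Finset.sum_mul_sum]
  refine Finset.sum_congr rfl fun i _ => Finset.sum_congr rfl fun j _ => ?_
  ring

theorem dotProduct_deviation (𝒜 : Matrix (Fin m) (Fin n) ℝ →ₗ[ℝ] EuclideanSpace ℝ (Fin N))
    (X : Matrix (Fin m) (Fin n) ℝ) (u : Fin m → ℝ) (v : Fin n → ℝ) :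
    u ⬝ᵥ deviation 𝒜 X *ᵥ v = inner ℝ (𝒜 (Matrix.vecMulVec u v)) (𝒜 X)
      - ∑ i, ∑ j, Matrix.vecMulVec u v i j * X i j := by
  rw [← adj_spec, ← Finset.sum_sub_distrib]
  simp only [← Finset.sum_sub_distrib, dotProduct, Matrix.mulVec, Finset.mul_sum, deviation,
    Matrix.sub_apply, Matrix.vecMulVec_apply]
  refine Finset.sum_congr rfl fun i _ => Finset.sum_congr rfl fun j _ => ?_
  ring

/-- The constant cannot be negative once some nonzero matrix is tested. -/
theorem RIP.nonneg {𝒜 : Matrix (Fin m) (Fin n) ℝ →ₗ[ℝ] EuclideanSpace ℝ (Fin N)} {r : ℕ} {ρ : ℝ}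
    (hA : RIP 𝒜 (r + 1) ρ) {Y : Matrix (Fin m) (Fin n) ℝ} (hY : Y ≠ 0) (hr : Y.rank ≤ r + 1) :
    0 ≤ ρ := by
  have h1 := hA Y hr
  have h2 : 0 < frobSq Y :=
    lt_of_le_of_ne (frobSq_nonneg Y) fun h0 => hY (eq_zero_of_frobSq_eq_zero h0.symm)
  nlinarith [h1.1.trans h1.2]

theorem RIP.abs_sub_le {𝒜 : Matrix (Fin m) (Fin n) ℝ →ₗ[ℝ] EuclideanSpace ℝ (Fin N)} {s : ℕ} {ρ : ℝ}
    (hA : RIP 𝒜 s ρ) {X : Matrix (Fin m) (Fin n) ℝ} (hX : X.rank ≤ s) :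
    |‖𝒜 X‖ ^ 2 - frobSq X| ≤ ρ * frobSq X := by
  have := hA X hX
  rw [abs_le]; constructor <;> linarith

/-- On matrices of rank at most `r` the deviation `𝒜* 𝒜 - I` is small in operator norm: test it
against matrices of rank one and polarize. -/
theorem RIP.norm_deviation_le_frob {𝒜 : Matrix (Fin m) (Fin n) ℝ →ₗ[ℝ] EuclideanSpace ℝ (Fin N)}
    {r : ℕ} {ρ : ℝ} (hA : RIP 𝒜 (r + 1) ρ) (hρ : 0 ≤ ρ)
    {X : Matrix (Fin m) (Fin n) ℝ} (hX : X.rank ≤ r) :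
    ‖deviation 𝒜 X‖ ≤ ρ * √(frobSq X) := by
  rcases (frobSq_nonneg X).eq_or_lt with h0 | h0
  · rw [← h0, eq_zero_of_frobSq_eq_zero h0.symm]
    have h1 : deviation 𝒜 (0 : Matrix (Fin m) (Fin n) ℝ) = 0 := by
      simpa using deviation_smul 𝒜 0 0
    simp [h1]
  refine opNorm_le_of_bilin (by positivity) fun u v hu hv => ?_
  have hφ : 0 < √(frobSq X) := Real.sqrt_pos.2 h0
  have hφ2 : √(frobSq X) ^ 2 = frobSq X := Real.sq_sqrt h0.le
  set φ := √(frobSq X) with hφdef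
  -- polarization is sharp when both matrices have the same Frobenius norm
  set V := Matrix.vecMulVec (φ • u) v with hV
  have hVf : frobSq V = φ ^ 2 := by
    rw [hV, frobSq_vecMulVec, hv, dotProduct_smul, smul_dotProduct, hu]
    simp [pow_two]
  have hVr : V.rank ≤ 1 := Matrix.rank_vecMulVec_le _ _
  have h1 := hA.abs_sub_le (X := V + X) ((rank_add_le _ _).trans (by omega))
  have h2 := hA.abs_sub_le (X := V - X) (by
    rw [sub_eq_add_neg]
    refine (rank_add_le _ _).trans ?_
    have : (-X).rank ≤ X.rank := by
      have h := Matrix.rank_mul_le_left X (-1 : Matrix (Fin n) (Fin n) ℝ)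
      rwa [Matrix.mul_neg, Matrix.mul_one] at h
    omega)
  have h3 := frobSq_add_sub_frobSq_sub X V
  have h4 := frobSq_parallelogram X V
  have h5 := dotProduct_deviation 𝒜 X (φ • u) v
  rw [← hV, smul_dotProduct, smul_eq_mul] at h5
  have h6 : ‖𝒜 (V + X)‖ ^ 2 - ‖𝒜 (V - X)‖ ^ 2 = 4 * inner ℝ (𝒜 V) (𝒜 X) := by
    rw [map_add, map_sub, norm_add_sq_real, norm_sub_sq_real]; ring
  have h7 := (abs_le.1 h1).2
  have h8 := (abs_le.1 h2).1
  have h9 : φ * (u ⬝ᵥ deviation 𝒜 X *ᵥ v) ≤ φ * (ρ * φ) := by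
    rw [h5]
    have : ρ * frobSq (V + X) + ρ * frobSq (V - X) = 4 * (ρ * φ ^ 2) := by
      rw [← mul_add, h4, hVf, hφ2]; ring
    nlinarith
  exact le_of_mul_le_mul_left h9 hφ

theorem RIP.norm_deviation_le {𝒜 : Matrix (Fin m) (Fin n) ℝ →ₗ[ℝ] EuclideanSpace ℝ (Fin N)}
    {r : ℕ} {ρ : ℝ} (hA : RIP 𝒜 (r + 1) ρ) (hρ : 0 ≤ ρ)
    {X : Matrix (Fin m) (Fin n) ℝ} (hX : X.rank ≤ r) :
    ‖deviation 𝒜 X‖ ≤ ρ * √r * ‖X‖ := by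
  refine (hA.norm_deviation_le_frob hρ hX).trans ?_
  rw [mul_assoc]
  gcongr
  rw [← Real.sqrt_sq (norm_nonneg X), ← Real.sqrt_mul (by positivity)]
  refine Real.sqrt_le_sqrt ((frobSq_le_rank_mul X).trans ?_)
  gcongr

/-- The coordinate projection onto the `i`-th block of `r` consecutive coordinates. -/
def blockProj (r d i : ℕ) : Matrix (Fin d) (Fin d) ℝ :=
  Matrix.diagonal fun j => if (j : ℕ) / r = i then 1 else 0

theorem sum_blockProj (r d : ℕ) : ∑ i ∈ Finset.range (d / r + 1), blockProj r d i = 1 := by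
  ext a b
  rw [Matrix.sum_apply]
  rcases eq_or_ne a b with rfl | hab
  · simp only [blockProj, Matrix.diagonal_apply_eq, Matrix.one_apply_eq]
    rw [Finset.sum_ite_eq, if_pos]
    exact Finset.mem_range.2 (Nat.lt_succ_of_le (Nat.div_le_div_right a.2.le))
  · simp [blockProj, hab]

theorem norm_blockProj_le (r d i : ℕ) : ‖blockProj r d i‖ ≤ 1 := by
  rw [blockProj, Matrix.l2_opNorm_diagonal, pi_norm_le_iff_of_nonneg zero_le_one]
  intro j
  split_ifs <;> simp

theorem rank_blockProj_le {r : ℕ} (hr : 0 < r) (d i : ℕ) : (blockProj r d i).rank ≤ r := by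
  rw [blockProj, Matrix.rank_diagonal, Fintype.card_subtype]
  have : (Finset.univ.filter fun j : Fin d => (if (j : ℕ) / r = i then (1 : ℝ) else 0) ≠ 0).card
      ≤ (Finset.Ico (i * r) (i * r + r)).card := by
    refine Finset.card_le_card_of_injOn (fun j => (j : ℕ)) ?_ (fun _ _ _ _ h => Fin.ext h)
    intro j hj
    have hj' : (j : ℕ) / r = i := by simpa using hj
    have := (Nat.div_eq_iff hr).1 hj'
    simp only [Finset.coe_Ico, mem_Ico]
    omega
  simpa using this

/-- Without a rank restriction, cutting into blocks of `r` rows or columns costs a factor of the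
number of blocks. -/
theorem RIP.norm_deviation_le_gamma
    {𝒜 : Matrix (Fin m) (Fin n) ℝ →ₗ[ℝ] EuclideanSpace ℝ (Fin N)}
    {r : ℕ} {ρ : ℝ} (hA : RIP 𝒜 (r + 1) ρ) (hρ : 0 ≤ ρ) (hr : 0 < r) (hrm : r ≤ m) (hrn : r ≤ n)
    (X : Matrix (Fin m) (Fin n) ℝ) :
    ‖deviation 𝒜 X‖ ≤ ρ * √r * (2 * gamma r m n * ‖X‖) := by
  have hcount : ∀ d : ℕ, r ≤ d → ((d / r + 1 : ℕ) : ℝ) ≤ 2 * ((d : ℝ) / r) := by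
    intro d hd
    have h1 : ((d / r : ℕ) : ℝ) ≤ (d : ℝ) / r := Nat.cast_div_le
    have h2 : (1 : ℝ) ≤ (d : ℝ) / r := by
      rw [le_div_iff₀ (by exact_mod_cast hr), one_mul]; exact_mod_cast hd
    push_cast
    linarith
  have hcut : ∀ (d : ℕ) (P : ℕ → Matrix (Fin m) (Fin n) ℝ), r ≤ d →
      X = ∑ i ∈ Finset.range (d / r + 1), P i → (∀ i, (P i).rank ≤ r) → (∀ i, ‖P i‖ ≤ ‖X‖) →
      ‖deviation 𝒜 X‖ ≤ ρ * √r * (2 * ((d : ℝ) / r) * ‖X‖) := by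
    intro d P hd hX h1 h2
    rw [hX, deviation_sum, ← hX]
    have h3 : ∀ i ∈ Finset.range (d / r + 1), ‖deviation 𝒜 (P i)‖ ≤ ρ * √r * ‖X‖ := fun i _ =>
      (hA.norm_deviation_le hρ (h1 i)).trans (by gcongr; exact h2 i)
    refine (norm_sum_le_of_le _ h3).trans ?_
    rw [Finset.sum_const, Finset.card_range, nsmul_eq_mul]
    have h4 := mul_le_mul_of_nonneg_right (hcount d hd)
      (show 0 ≤ ρ * √r * ‖X‖ by positivity)
    linarith
  rw [gamma]
  rcases le_total m n with hmn | hmn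
  · rw [min_eq_left hmn]
    refine hcut m (fun i => blockProj r m i * X) hrm ?_ ?_ ?_
    · rw [← Matrix.sum_mul, sum_blockProj, Matrix.one_mul]
    · exact fun i => (Matrix.rank_mul_le_left _ _).trans (rank_blockProj_le hr m i)
    · intro i
      simpa using norm_mul_le_of_le (norm_blockProj_le r m i) (le_refl ‖X‖)
  · rw [min_eq_right hmn]
    refine hcut n (fun i => X * blockProj r n i) hrn ?_ ?_ ?_
    · rw [← Matrix.mul_sum, sum_blockProj, Matrix.mul_one]
    · exact fun i => (Matrix.rank_mul_le_right _ _).trans (rank_blockProj_le hr n i)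
    · intro i
      simpa using norm_mul_le_of_le (le_refl ‖X‖) (norm_blockProj_le r n i)

end Measurement

/-! ### The matrix logarithm near the identity -/

section Log

/-- First-order accuracy of the matrix logarithm near the identity. -/
theorem norm_log_one_add_sub_le {p : Type*} [Fintype p] [DecidableEq p] {X : Matrix p p ℝ}
    (hX : Xᵀ = X) (hn : ‖X‖ ≤ 1 / 2) : ‖CFC.log (1 + X) - X‖ ≤ 2 * ‖X‖ ^ 2 := by
  have hsa : IsSelfAdjoint (1 + X) := by
    rw [IsSelfAdjoint, Matrix.star_eq_conjTranspose, Matrix.conjTranspose_eq_transpose_of_trivial]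
    simp [hX]
  have hspec : ∀ x ∈ spectrum ℝ (1 + X), |x - 1| ≤ ‖X‖ := by
    intro x hx
    have h1 : x - 1 ∈ spectrum ℝ X := by
      have := (spectrum.add_mem_add_iff (R := ℝ) (a := X) (r := x - 1) (s := 1))
      rw [map_one] at this
      rw [← this, sub_add_cancel]; exact hx
    have h2 := spectrum.norm_le_norm_mul_of_mem h1
    have h3 : ‖(1 : Matrix p p ℝ)‖ ≤ 1 := norm_le_one_of_mul_self fun v => by simp
    exact h2.trans (mul_le_of_le_one_right (norm_nonneg X) h3)
  have hcont : ContinuousOn Real.log (spectrum ℝ (1 + X)) := by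
    intro x hx
    refine (Real.continuousAt_log ?_).continuousWithinAt
    have := (abs_le.1 (hspec x hx)).1
    linarith
  have e : CFC.log (1 + X) - X = cfc (fun x => Real.log x - (x - 1)) (1 + X) := by
    rw [cfc_sub Real.log (fun x => x - 1) (1 + X) hcont (by fun_prop),
      cfc_sub (fun x => x) (fun _ => 1) (1 + X) (by fun_prop) (by fun_prop),
      cfc_id' ℝ (1 + X), cfc_const_one ℝ (1 + X), CFC.log]
    abel
  rw [e]
  refine norm_cfc_le (by positivity) fun x hx => ?_
  have h1 := abs_le.1 (hspec x hx)
  have hx0 : 0 < x := by linarith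
  have h2 := Real.log_le_sub_one_of_pos hx0
  have h3 := Real.one_sub_inv_le_log_of_pos hx0
  have h4 : (x - 1) ^ 2 ≤ ‖X‖ ^ 2 := sq_le_sq' (by linarith) h1.2
  have h5 : x - 1 - (1 - x⁻¹) ≤ 2 * (x - 1) ^ 2 := by
    have e : x - 1 - (1 - x⁻¹) = x⁻¹ * (x - 1) ^ 2 := by field_simp
    rw [e]
    gcongr
    rw [inv_le_comm₀ hx0 (by norm_num)]
    linarith
  rw [Real.norm_eq_abs, abs_le]
  constructor <;> linarith

end Log

end

section

variable {m n h N : ℕ}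

/-! ### The smallest nonzero singular value -/

section SingularValues

variable {p q : Type*} [Fintype p] [DecidableEq p] [Fintype q] [DecidableEq q]

theorem adjoint_comp_toEuclideanLin_apply (X : Matrix p q ℝ) (v : EuclideanSpace ℝ q) :
    (LinearMap.adjoint (Matrix.toEuclideanLin X) ∘ₗ Matrix.toEuclideanLin X) v
      = WithLp.toLp 2 ((Xᵀ * X) *ᵥ v.ofLp) := by
  rw [← Matrix.toEuclideanLin_conjTranspose_eq_adjoint, LinearMap.comp_apply,
    Matrix.conjTranspose_eq_transpose_of_trivial, Matrix.toLpLin_apply, Matrix.toLpLin_apply,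
    Matrix.mulVec_mulVec]

theorem finrank_range_toEuclideanLin (X : Matrix p q ℝ) :
    Module.finrank ℝ (Matrix.toEuclideanLin X).range = X.rank := by
  rw [Matrix.rank_eq_finrank_range_toLin X (EuclideanSpace.basisFun p ℝ).toBasis
    (EuclideanSpace.basisFun q ℝ).toBasis, Matrix.toEuclideanLin_eq_toLin_orthonormal]

theorem sigma_pos_of_rank_eq {r : ℕ} (hr : 0 < r) {X : Matrix p q ℝ} (hX : X.rank = r) :
    0 < sigma r X := by
  rw [sigma, LinearMap.singularValues_pos_iff_lt_finrank_range, finrank_range_toEuclideanLin, hX]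
  omega

/-- The last nonzero singular value is attained. -/
theorem exists_mulVec_eq_sigma_sq {r : ℕ} (hr : 0 < r) {X : Matrix p q ℝ} (hX : X.rank = r) :
    ∃ v : q → ℝ, v ≠ 0 ∧ (Xᵀ * X) *ᵥ v = sigma r X ^ 2 • v := by
  have hlt : r - 1 < Module.finrank ℝ (EuclideanSpace ℝ q) := by
    have := Matrix.rank_le_card_width X
    rw [finrank_euclideanSpace]
    omega
  obtain ⟨v, hv⟩ := ((Matrix.toEuclideanLin X).hasEigenvalue_adjoint_comp_self_sq_singularValues
    hlt).exists_hasEigenvector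
  refine ⟨v.ofLp, fun h0 => hv.2 (by ext i; simpa using congrFun h0 i), ?_⟩
  have h1 := hv.apply_eq_smul
  rw [adjoint_comp_toEuclideanLin_apply] at h1
  have h2 := congrArg WithLp.ofLp h1
  simpa [sigma] using h2

/-- The last nonzero singular value is the smallest one. -/
theorem sigma_sq_le_of_mulVec_eq {r : ℕ} {X : Matrix p q ℝ} (hX : X.rank = r)
    {v : q → ℝ} {μ : ℝ} (hv : v ≠ 0) (hμ : 0 < μ) (h : (Xᵀ * X) *ᵥ v = μ • v) :
    sigma r X ^ 2 ≤ μ := by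
  set T := Matrix.toEuclideanLin X with hT
  have hev : Module.End.HasEigenvalue (LinearMap.adjoint T ∘ₗ T) μ := by
    refine Module.End.hasEigenvalue_of_hasEigenvector (x := WithLp.toLp 2 v) ⟨?_, ?_⟩
    · rw [Module.End.mem_eigenspace_iff, adjoint_comp_toEuclideanLin_apply]
      simp [h]
    · simpa using hv
  obtain ⟨i, hi⟩ := T.isSymmetric_adjoint_comp_self.exists_eigenvalues_eq rfl hev
  have h1 : T.singularValues i ^ 2 = μ := by
    rw [T.sq_singularValues_fin rfl i]; simpa using hi
  have h2 : (i : ℕ) < r := by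
    rw [← hX, ← finrank_range_toEuclideanLin, ← LinearMap.singularValues_pos_iff_lt_finrank_range]
    refine lt_of_le_of_ne (LinearMap.singularValues_nonneg _ _) fun h0 => ?_
    rw [← h0] at h1
    norm_num at h1
    linarith
  rw [← h1]
  exact pow_le_pow_left₀ (LinearMap.singularValues_nonneg _ _)
    (T.singularValues_antitone (by omega)) 2

theorem rank_eq_card_of_isUnit {A : Matrix p q ℝ} (h : IsUnit (A * Aᵀ)) :
    A.rank = Fintype.card p := by
  rw [← Matrix.rank_self_mul_transpose, Matrix.rank_of_isUnit _ h]

/-- Together with `posSemidef_of_le_sigma`: a lower bound on the `r`-th singular value of a matrix with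
`r` rows is a semidefinite constraint on its Gram matrix. -/
theorem le_sigma_of_posSemidef {r : ℕ} (hr : 0 < r) {A : Matrix (Fin r) q ℝ} {g : ℝ} (hg : 0 < g)
    (h : (A * Aᵀ - g • (1 : Matrix (Fin r) (Fin r) ℝ)).PosSemidef) : √g ≤ sigma r A := by
  have hrank : A.rank = r := by
    simpa using rank_eq_card_of_isUnit (isUnit_of_posSemidef_sub hg h)
  have hpos := sigma_pos_of_rank_eq hr hrank
  obtain ⟨v, hv, hev⟩ := exists_mulVec_eq_sigma_sq hr hrank
  rw [Real.sqrt_le_left hpos.le]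
  have h1 := h.dotProduct_nonneg (A *ᵥ v)
  have e1 : (A * Aᵀ) *ᵥ (A *ᵥ v) = sigma r A ^ 2 • (A *ᵥ v) := by
    rw [← Matrix.mulVec_mulVec, Matrix.mulVec_mulVec v Aᵀ, hev, Matrix.mulVec_smul]
  have e2 : (A *ᵥ v) ⬝ᵥ (A *ᵥ v) = sigma r A ^ 2 * (v ⬝ᵥ v) := by
    rw [mulVec_dotProduct, Matrix.mulVec_mulVec, hev, dotProduct_smul, smul_eq_mul]
  have hvv : 0 < v ⬝ᵥ v := by
    refine lt_of_le_of_ne (zero_le_dotProduct_self v) fun h0 => hv (dotProduct_self_eq_zero.1 h0.symm)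
  rw [Matrix.sub_mulVec, e1, Matrix.smul_mulVec, Matrix.one_mulVec, dotProduct_sub, dotProduct_smul,
    dotProduct_smul, smul_eq_mul, smul_eq_mul, ← sub_mul, e2] at h1
  have h2 : 0 < sigma r A ^ 2 * (v ⬝ᵥ v) := by positivity
  linarith [nonneg_of_mul_nonneg_left h1 h2]

theorem posSemidef_of_le_sigma {r : ℕ} (hr : 0 < r) {A : Matrix (Fin r) q ℝ} {b : ℝ} (hb : 0 < b)
    (h : b ≤ sigma r A) : (A * Aᵀ - b ^ 2 • (1 : Matrix (Fin r) (Fin r) ℝ)).PosSemidef := by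
  have hrank : A.rank = r := by
    refine le_antisymm (by simpa using Matrix.rank_le_card_height A) ?_
    have h1 : 0 < sigma r A := hb.trans_le h
    rw [sigma, LinearMap.singularValues_pos_iff_lt_finrank_range, finrank_range_toEuclideanLin] at h1
    omega
  have hM : (A * Aᵀ - b ^ 2 • (1 : Matrix (Fin r) (Fin r) ℝ)).IsHermitian := by
    rw [Matrix.IsHermitian, Matrix.conjTranspose_eq_transpose_of_trivial]; simp
  have hinj : ∀ u, Aᵀ *ᵥ u = 0 → u = 0 := by
    have h1 := LinearMap.finrank_range_add_finrank_ker Aᵀ.mulVecLin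
    have h2 : Module.finrank ℝ Aᵀ.mulVecLin.range = r := by
      rw [← Matrix.rank, Matrix.rank_transpose, hrank]
    rw [h2, Module.finrank_fin_fun, Nat.add_eq_left, Submodule.finrank_eq_zero] at h1
    exact LinearMap.ker_eq_bot'.1 h1
  rw [hM.posSemidef_iff_eigenvalues_nonneg]
  intro i
  have h0 : (hM.eigenvectorBasis i).ofLp ≠ 0 := fun h0 =>
    (hM.eigenvectorBasis).orthonormal.ne_zero i (by ext j; simpa using congrFun h0 j)
  have h1 := hM.mulVec_eigenvectorBasis i
  set u := (hM.eigenvectorBasis i).ofLp with hu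
  set μ := hM.eigenvalues i
  rw [Matrix.sub_mulVec, sub_eq_iff_eq_add, Matrix.smul_mulVec, Matrix.one_mulVec, ← add_smul,
    ← Matrix.mulVec_mulVec] at h1
  have h2 : Aᵀ *ᵥ u ≠ 0 := fun h2 => h0 (hinj u h2)
  have h3 : 0 < (Aᵀ *ᵥ u) ⬝ᵥ (Aᵀ *ᵥ u) :=
    lt_of_le_of_ne (zero_le_dotProduct_self _) fun h3 => h2 (dotProduct_self_eq_zero.1 h3.symm)
  have hpos : 0 < μ + b ^ 2 := by
    rw [mulVec_dotProduct, Matrix.transpose_transpose, h1, dotProduct_smul, smul_eq_mul] at h3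
    exact pos_of_mul_pos_left h3 (zero_le_dotProduct_self u)
  have h4 := sigma_sq_le_of_mulVec_eq hrank h2 hpos (by
    rw [← Matrix.mulVec_mulVec, h1, Matrix.mulVec_smul])
  have h5 := pow_le_pow_left₀ hb.le h 2
  simp only [Pi.zero_apply]
  linarith

end SingularValues

/-! ### The spectral frame of a diagonal target -/

section ConcreteFrame

variable {r : ℕ} {Y : Matrix (Fin m) (Fin n) ℝ}

theorem norm_dilation_le (Z : Matrix (Fin m) (Fin n) ℝ) : ‖dilation Z‖ ≤ ‖Z‖ := by
  refine opNorm_le_of_dotProduct (norm_nonneg _) fun w => ?_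
  have e : w = Sum.elim (w ∘ Sum.inl) (w ∘ Sum.inr) := by simp
  rw [e, dilation, Matrix.fromBlocks_mulVec]
  simp only [Sum.elim_comp_inl, Sum.elim_comp_inr, Matrix.zero_mulVec, zero_add, add_zero,
    sumElim_dotProduct_sumElim]
  have h1 := dotProduct_mulVec_self_le Z (w ∘ Sum.inr)
  have h2 := dotProduct_mulVec_self_le Zᵀ (w ∘ Sum.inl)
  rw [norm_transpose] at h2
  linarith

/-- The first `r` coordinates among `d`. -/
def headSel (r d : ℕ) : Matrix (Fin r) (Fin d) ℝ :=
  Matrix.of fun i j => if (i : ℕ) = j then 1 else 0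

/-- The last `d - r` coordinates among `d`. -/
def tailSel (r d : ℕ) : Matrix (Fin (d - r)) (Fin d) ℝ :=
  Matrix.of fun i j => if r + (i : ℕ) = j then 1 else 0

theorem PA_eq (r m n : ℕ) :
    PA r m n = Matrix.fromCols ((1 / √2) • headSel r m) ((1 / √2) • headSel r n) := by
  rw [PA]; congr 1 <;> · ext i j; simp [headSel]

theorem PN_eq (r m n : ℕ) :
    PN r m n = Matrix.fromBlocks (tailSel r m) 0 0 (tailSel r n) := rfl

theorem headSel_mul {r d : ℕ} (hr : r ≤ d) {ι : Type*} (X : Matrix (Fin d) ι ℝ) (i : Fin r)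
    (j : ι) : (headSel r d * X) i j = X (Fin.castLE hr i) j := by
  rw [Matrix.mul_apply, Finset.sum_eq_single (Fin.castLE hr i)]
  · simp [headSel]
  · intro l _ hl
    have : (i : ℕ) ≠ l := fun h => hl (Fin.ext h.symm)
    simp [headSel, this]
  · simp

theorem tailSel_mul {r d : ℕ} {ι : Type*} (X : Matrix (Fin d) ι ℝ) (i : Fin (d - r))
    (j : ι) : (tailSel r d * X) i j = X ⟨r + i, by omega⟩ j := by
  rw [Matrix.mul_apply, Finset.sum_eq_single ⟨r + i, by omega⟩]
  · simp [tailSel]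
  · intro l _ hl
    have : r + (i : ℕ) ≠ l := fun h => hl (Fin.ext h.symm)
    simp [tailSel, this]
  · simp

theorem headSel_add_tailSel {r d : ℕ} (hr : r ≤ d) :
    (headSel r d)ᵀ * headSel r d + (tailSel r d)ᵀ * tailSel r d = 1 := by
  ext i j
  rw [Matrix.add_apply, Matrix.mul_apply, Matrix.mul_apply, Matrix.one_apply]
  by_cases hi : (i : ℕ) < r
  · rw [Finset.sum_eq_single ⟨i, hi⟩, Finset.sum_eq_zero]
    · simp [headSel, Fin.ext_iff]
    · intro l _
      have : r + (l : ℕ) ≠ i := by omega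
      simp [tailSel, this]
    · intro l _ hl
      have : (l : ℕ) ≠ i := fun h => hl (Fin.ext h)
      simp [headSel, this]
    · simp
  · rw [Finset.sum_eq_zero, Finset.sum_eq_single ⟨i - r, by omega⟩]
    · have : r + (i - r : ℕ) = i := by omega
      simp [tailSel, Fin.ext_iff, this]
    · intro l _ hl
      have : r + (l : ℕ) ≠ i := fun h => hl (Fin.ext (by simp; omega))
      simp [tailSel, this]
    · simp
    · intro l _
      have : (l : ℕ) ≠ i := by omega
      simp [headSel, this]

/-- The `r` positive singular values of the diagonal matrix `Y`, as a diagonal block. -/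
def headBlock (r : ℕ) (Y : Matrix (Fin m) (Fin n) ℝ) (hm : r ≤ m) (hn : r ≤ n) :
    Matrix (Fin r) (Fin r) ℝ :=
  Matrix.diagonal fun i => Y (Fin.castLE hm i) (Fin.castLE hn i)

theorem transpose_mul_self_of_diagonal (hY : IsSortedDiagonal Y) :
    Yᵀ * Y = Matrix.diagonal fun j : Fin n =>
      if hj : (j : ℕ) < m then Y ⟨j, hj⟩ j ^ 2 else 0 := by
  ext i j
  rw [Matrix.mul_apply]
  simp only [Matrix.transpose_apply]
  by_cases hi : (i : ℕ) < m
  · rw [Finset.sum_eq_single ⟨i, hi⟩]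
    · rcases eq_or_ne i j with rfl | hij
      · simp [hi, pow_two]
      · rw [Matrix.diagonal_apply_ne _ hij, hY.off_diag ⟨i, hi⟩ j fun h => hij (Fin.ext h), mul_zero]
    · intro l _ hl
      rw [hY.off_diag l i fun h => hl (Fin.ext h), zero_mul]
    · simp
  · rw [Finset.sum_eq_zero fun l _ => by rw [hY.off_diag l i (by omega), zero_mul]]
    rcases eq_or_ne i j with rfl | hij
    · simp [hi]
    · rw [Matrix.diagonal_apply_ne _ hij]

/-- The nonzero diagonal entries of `Y` are the first `r`. -/
theorem diag_ne_zero_iff (hY : IsSortedDiagonal Y) (hrank : Y.rank = r) (i : Fin m) (j : Fin n)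
    (hij : (i : ℕ) = j) : Y i j ≠ 0 ↔ (j : ℕ) < r := by
  have hcard : (Finset.univ.filter fun j : Fin n =>
      (if hj : (j : ℕ) < m then Y ⟨j, hj⟩ j ^ 2 else 0) ≠ 0).card = r := by
    rw [← hrank, ← Matrix.rank_transpose_mul_self Y, transpose_mul_self_of_diagonal hY,
      Matrix.rank_diagonal, Fintype.card_subtype]
  have hi : (⟨j, hij ▸ i.2⟩ : Fin m) = i := Fin.ext hij.symm
  constructor
  · intro hne
    have h1 : (Finset.Iic j).card ≤ r := by
      rw [← hcard]
      refine Finset.card_le_card fun l hl => ?_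
      have hl' : l ≤ j := Finset.mem_Iic.1 hl
      have hlm : (l : ℕ) < m := lt_of_le_of_lt hl' (hij ▸ i.2)
      have h2 := hY.decreasing ⟨l, hlm⟩ i l j rfl hij (by rw [Fin.le_def]; simpa [hij] using hl')
      have h3 : 0 < Y i j := lt_of_le_of_ne (hY.nonneg i j hij) hne.symm
      have h4 : 0 < Y ⟨l, hlm⟩ l := h3.trans_le h2
      simp only [Finset.mem_filter, Finset.mem_univ, true_and, hlm, dif_pos]
      positivity
    simp at h1
    omega
  · intro hlt h0
    have h1 : r ≤ (Finset.Iio j).card := by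
      rw [← hcard]
      refine Finset.card_le_card fun l hl => ?_
      simp only [Finset.mem_filter, Finset.mem_univ, true_and] at hl
      rw [Finset.mem_Iio]
      by_contra! hjl
      by_cases hlm : (l : ℕ) < m
      · simp only [hlm, dif_pos] at hl
        have h2 := hY.decreasing i ⟨l, hlm⟩ j l hij rfl (by rw [Fin.le_def]; simpa [hij] using hjl)
        have h3 := hY.nonneg ⟨l, hlm⟩ l rfl
        rw [h0] at h2
        exact hl (by rw [le_antisymm h2 h3]; norm_num)
      · simp [hlm] at hl
    simp at h1
    omega

theorem sigma_le_diag (hY : IsSortedDiagonal Y) (hrank : Y.rank = r) (i : Fin m) (j : Fin n)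
    (hij : (i : ℕ) = j) (hj : (j : ℕ) < r) : sigma r Y ≤ Y i j := by
  have hne := (diag_ne_zero_iff hY hrank i j hij).2 hj
  have hpos : 0 < Y i j := lt_of_le_of_ne (hY.nonneg i j hij) hne.symm
  have hi : (⟨j, hij ▸ i.2⟩ : Fin m) = i := Fin.ext hij.symm
  refine le_of_sq_le_sq (sigma_sq_le_of_mulVec_eq hrank (v := Pi.single j 1) (by simp)
    (by positivity) ?_) hpos.le
  rw [transpose_mul_self_of_diagonal hY, Matrix.diagonal_mulVec_single]
  have hjm : (j : ℕ) < m := hij ▸ i.2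
  ext l
  rcases eq_or_ne l j with rfl | hl
  · simp [hjm, hi]
  · simp [hl]

/-- The matrices `P_A`, `P_⊥`, `P_N` form a spectral frame for the dilation of a sorted diagonal `Y` of
rank `r`, with gap `s = σ_r(Y)`. -/
theorem spectralFrame (hY : IsSortedDiagonal Y) (hrank : Y.rank = r) (hm : r ≤ m) (hn : r ≤ n) :
    SpectralFrame (PA r m n) (PP r m n) (PN r m n) (J m n) (dilation Y) (headBlock r Y hm hn)
      (Matrix.fromBlocks 0 0 0 (-headBlock r Y hm hn)) (Matrix.fromBlocks 1 0 0 (-1)) ‖Y‖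
      (sigma r Y) := by
  have hJt : (J m n)ᵀ = J m n := by simp [J, Matrix.fromBlocks_transpose]
  have hYJ : dilation Y * J m n = -(J m n * dilation Y) := by
    simp [J, dilation, Matrix.fromBlocks_multiply, Matrix.fromBlocks_neg]
  have hhead : headSel r m * Y = headBlock r Y hm hn * headSel r n := by
    ext i j
    rw [headSel_mul hm, headBlock, Matrix.diagonal_mul]
    by_cases hij : (i : ℕ) = j
    · have : Fin.castLE hn i = j := Fin.ext hij
      simp [headSel, hij, this]
    · rw [hY.off_diag _ _ (by simpa using hij)]
      simp [headSel, hij]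
  have hhead' : headSel r n * Yᵀ = headBlock r Y hm hn * headSel r m := by
    ext i j
    rw [headSel_mul hn, headBlock, Matrix.diagonal_mul, Matrix.transpose_apply]
    by_cases hij : (i : ℕ) = j
    · have : Fin.castLE hm i = j := Fin.ext hij
      simp [headSel, hij, this]
    · rw [hY.off_diag _ _ (by simpa using fun h => hij h.symm)]
      simp [headSel, hij]
  have htail : tailSel r m * Y = 0 := by
    ext i j
    rw [tailSel_mul, Matrix.zero_apply]
    by_contra hne
    by_cases hij : r + (i : ℕ) = j
    · have := (diag_ne_zero_iff hY hrank _ _ hij).1 hne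
      omega
    · exact hne (hY.off_diag _ _ hij)
  have htail' : tailSel r n * Yᵀ = 0 := by
    ext i j
    rw [tailSel_mul, Matrix.zero_apply, Matrix.transpose_apply]
    by_contra hne
    by_cases hij : (j : ℕ) = r + (i : ℕ)
    · have := (diag_ne_zero_iff hY hrank _ _ hij).1 hne
      simp at this
    · exact hne (hY.off_diag _ _ hij)
  have hPA : PA r m n * dilation Y = headBlock r Y hm hn * PA r m n := by
    rw [PA_eq, dilation, Matrix.fromCols_mul_fromBlocks, Matrix.mul_fromCols]
    simp [hhead, hhead']
  have hPN : PN r m n * dilation Y = 0 := by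
    rw [PN_eq, dilation, Matrix.fromBlocks_multiply]
    simp [htail, htail']
  have hPAJ : PA r m n * J m n * dilation Y = -(headBlock r Y hm hn * (PA r m n * J m n)) := by
    rw [Matrix.mul_assoc, ← neg_eq_iff_eq_neg.2 hYJ, Matrix.mul_neg, ← Matrix.mul_assoc, hPA,
      Matrix.mul_assoc]
  have hS : ∀ v : Fin r → ℝ, sigma r Y * (v ⬝ᵥ v) ≤ v ⬝ᵥ headBlock r Y hm hn *ᵥ v := by
    intro v
    simp only [dotProduct, headBlock, Matrix.mulVec_diagonal, Finset.mul_sum]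
    refine Finset.sum_le_sum fun i _ => ?_
    have := sigma_le_diag hY hrank (Fin.castLE hm i) (Fin.castLE hn i) rfl i.2
    nlinarith [mul_self_nonneg (v i)]
  have hJJ : J m n * J m n = 1 := by
    simp [J, Matrix.fromBlocks_multiply]
  have hsplit : (PP r m n)ᵀ * PP r m n
      = (PN r m n)ᵀ * PN r m n + (PA r m n * J m n)ᵀ * (PA r m n * J m n) := by
    rw [PP, Matrix.transpose_fromRows, Matrix.fromCols_mul_fromRows]
  refine
    { J_transpose := hJt
      J_mul_J := hJJ
      Yh_transpose := by simp [dilation, Matrix.fromBlocks_transpose]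
      Yh_mul_J := hYJ
      norm_Yh := norm_dilation_le Y
      resolution := ?_
      PA_mul_Yh := hPA
      PP_mul_Yh := ?_
      PN_mul_Yh := hPN
      PN_mul_J := ?_
      norm_JN := ?_
      PP_split := fun v => ?_
      S_lower := hS
      H_transpose := ?_
      H_nonpos := fun v => ?_ }
  · rw [hsplit, PN_eq, PA_eq, J, Matrix.fromCols_mul_fromBlocks, Matrix.transpose_fromCols,
      Matrix.transpose_fromCols, Matrix.fromRows_mul_fromCols, Matrix.fromRows_mul_fromCols,
      Matrix.fromBlocks_transpose, Matrix.fromBlocks_multiply, Matrix.fromBlocks_add,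
      Matrix.fromBlocks_add, ← Matrix.fromBlocks_one]
    have h2 : (√2)⁻¹ * (√2)⁻¹ = (2⁻¹ : ℝ) := by
      rw [← mul_inv, Real.mul_self_sqrt (by norm_num)]
    have e : ∀ d, r ≤ d → (2⁻¹ : ℝ) • ((headSel r d)ᵀ * headSel r d)
        + ((tailSel r d)ᵀ * tailSel r d + (2⁻¹ : ℝ) • ((headSel r d)ᵀ * headSel r d)) = 1 := by
      intro d hd
      rw [← headSel_add_tailSel hd, add_left_comm, ← add_smul, add_comm]; norm_num
    have em := e m hm
    have en := e n hn
    congr 1 <;> simp [smul_smul, h2] <;> simpa using by assumption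
  · rw [PP, Matrix.fromRows_mul, hPN, hPAJ, Matrix.fromBlocks_mul_fromRows]
    simp
  · rw [PN_eq, J, Matrix.fromBlocks_multiply, Matrix.fromBlocks_multiply]; simp
  · refine norm_le_one_of_mul_self fun v => ?_
    rw [mulVec_dotProduct, Matrix.mulVec_mulVec, Matrix.fromBlocks_transpose,
      Matrix.fromBlocks_multiply]
    simp
  · rw [mulVec_dotProduct, mulVec_dotProduct, mulVec_dotProduct, Matrix.mulVec_mulVec,
      Matrix.mulVec_mulVec, Matrix.mulVec_mulVec, hsplit, Matrix.add_mulVec, dotProduct_add]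
  · simp [Matrix.fromBlocks_transpose, headBlock]
  · have e : v = Sum.elim (v ∘ Sum.inl) (v ∘ Sum.inr) := by simp
    rw [e, Matrix.fromBlocks_mulVec]
    simp only [Sum.elim_comp_inl, Sum.elim_comp_inr, Matrix.zero_mulVec, zero_add, add_zero,
      sumElim_dotProduct_sumElim, dotProduct_zero, Matrix.neg_mulVec, dotProduct_neg]
    have h1 := hS (v ∘ Sum.inr)
    have h2 := mul_nonneg (LinearMap.singularValues_nonneg (Matrix.toEuclideanLin Y) (r - 1))
      (zero_le_dotProduct_self (v ∘ Sum.inr))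
    rw [sigma] at h1
    linarith

end ConcreteFrame

end

section

variable {m n h N r : ℕ} {Y : Matrix (Fin m) (Fin n) ℝ}
  {𝒜 : Matrix (Fin m) (Fin n) ℝ →ₗ[ℝ] EuclideanSpace ℝ (Fin N)} {α δ ε ρ η q s T t : ℝ}

/-! ### Relations between the parameters -/

section Parameters

theorem sigma_le_norm (hr : 0 < r) (hrank : Y.rank = r) : sigma r Y ≤ ‖Y‖ := by
  obtain ⟨v, hv, hev⟩ := exists_mulVec_eq_sigma_sq hr hrank
  have h1 := dotProduct_mulVec_self_le Y v
  have hvv : 0 < v ⬝ᵥ v :=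
    lt_of_le_of_ne (zero_le_dotProduct_self v) fun h0 => hv (dotProduct_self_eq_zero.1 h0.symm)
  rw [mulVec_dotProduct, Matrix.mulVec_mulVec, hev, dotProduct_smul, smul_eq_mul] at h1
  exact le_of_sq_le_sq (le_of_mul_le_mul_right h1 hvv) (norm_nonneg _)

namespace InitAssumption

variable {W₀ : Matrix (Fin m ⊕ Fin n) (Fin h) ℝ}

theorem eps_le_delta (hi : InitAssumption r Y α δ ε W₀) :
    ε ≤ δ / (3 * α) * √‖Y‖ :=
  hi.eps_le.trans (by gcongr; exact min_le_right _ _)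

theorem delta_pos (hi : InitAssumption r Y α δ ε W₀) :
    0 < δ := by
  have h1 := hi.eps_pos.trans_le (hi.eps_le_delta)
  have h2 := pos_of_mul_pos_left h1 (Real.sqrt_nonneg _)
  have h3 := hi.one_le_alpha
  exact (div_pos_iff_of_pos_right (by positivity)).1 h2

theorem delta_mul_le (hr : 0 < r) (hrank : Y.rank = r) (hi : InitAssumption r Y α δ ε W₀) :
    64 * α * δ * ‖Y‖ ≤ sigma r Y := by
  have h1 := hi.delta_le
  have hs := sigma_pos_of_rank_eq hr hrank
  have hy := hs.trans_le (sigma_le_norm hr hrank)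
  have h3 := hi.one_le_alpha
  rw [kappa, le_div_iff₀ (by positivity)] at h1
  have e : δ * (64 * α * (‖Y‖ / sigma r Y)) = 64 * α * δ * ‖Y‖ / sigma r Y := by ring
  rwa [e, div_le_one hs] at h1

theorem eps_sq_le (hr : 0 < r) (hrank : Y.rank = r) (hi : InitAssumption r Y α δ ε W₀) :
    ε ^ 2 ≤ sigma r Y / 10000 := by
  have hs := sigma_pos_of_rank_eq hr hrank
  have hsy := sigma_le_norm hr hrank
  have hδ := hi.delta_pos
  have h1 := hi.one_le_alpha
  have h2 := hi.delta_mul_le hr hrank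
  have h3 : ε ≤ δ / 3 * √‖Y‖ := by
    refine (hi.eps_le_delta).trans ?_
    gcongr; linarith
  have h4 : ε ^ 2 ≤ (δ / 3 * √‖Y‖) ^ 2 := pow_le_pow_left₀ hi.eps_pos.le h3 2
  rw [mul_pow, Real.sq_sqrt (norm_nonneg _)] at h4
  have h5 : 64 * (δ * ‖Y‖) ≤ sigma r Y := by
    have := mul_pos hδ (hs.trans_le hsy)
    nlinarith
  have h6 : δ ≤ 1 / 64 := by
    by_contra! h
    nlinarith
  have h7 : δ * (δ * ‖Y‖) ≤ 1 / 64 * (sigma r Y / 64) := by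
    have : 0 ≤ δ * ‖Y‖ := by positivity
    gcongr; linarith
  nlinarith

theorem sigma_mul_T2 (hr : 0 < r) (hrank : Y.rank = r) :
    sigma r Y * T2 r Y ε = 10 * Real.log (√(sigma r Y) / ε) := by
  have hs := sigma_pos_of_rank_eq hr hrank
  have e : sigma r Y / ε ^ 2 = (√(sigma r Y) / ε) ^ 2 := by
    rw [div_pow, Real.sq_sqrt hs.le]
  rw [T2, e, Real.log_pow]
  field_simp
  ring

/-- Throughout the warm-up phase the bound on the nuisance part stays below the geometric mean of `ε`
and `√σ_r(Y)`. -/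
theorem nuisance_sq_le (hr : 0 < r) (hrank : Y.rank = r) (hi : InitAssumption r Y α δ ε W₀)
    (ht : t ∈ Icc 0 (T2 r Y ε)) :
    (ε * Real.exp (3 * α * δ * ‖Y‖ * t)) ^ 2 ≤ ε * √(sigma r Y) := by
  have hs := sigma_pos_of_rank_eq hr hrank
  have hε := hi.eps_pos
  have h1 : 6 * α * δ * ‖Y‖ * t ≤ Real.log (√(sigma r Y) / ε) := by
    have h2 := hi.delta_mul_le hr hrank
    have h3 : 64 * α * δ * ‖Y‖ * t ≤ sigma r Y * t := mul_le_mul_of_nonneg_right h2 ht.1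
    have h4 : sigma r Y * t ≤ sigma r Y * T2 r Y ε := mul_le_mul_of_nonneg_left ht.2 hs.le
    have h5 := sigma_mul_T2 (ε := ε) hr hrank
    have h6 : 0 ≤ sigma r Y * t := mul_nonneg hs.le ht.1
    linarith
  have h2 : Real.exp (3 * α * δ * ‖Y‖ * t) ^ 2 ≤ √(sigma r Y) / ε := by
    rw [← Real.exp_nat_mul, ← Real.exp_log (show 0 < √(sigma r Y) / ε by positivity)]
    refine Real.exp_le_exp.2 ?_
    push_cast
    linarith
  rw [mul_pow]
  calc ε ^ 2 * Real.exp (3 * α * δ * ‖Y‖ * t) ^ 2 ≤ ε ^ 2 * (√(sigma r Y) / ε) := by gcongr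
    _ = ε * √(sigma r Y) := by field_simp

/-- The part of `U Vᵀ` of unrestricted rank, multiplied by the number of blocks into which it is cut,
is at most `‖Y‖`. -/
theorem gamma_mul_nuisance_sq_le (hr : 0 < r) (hm : r ≤ m) (hn : r ≤ n) (hrank : Y.rank = r)
    (hi : InitAssumption r Y α δ ε W₀) (ht : t ∈ Icc 0 (T2 r Y ε)) :
    gamma r m n * (ε * Real.exp (3 * α * δ * ‖Y‖ * t)) ^ 2 ≤ ‖Y‖ := by
  have hs := sigma_pos_of_rank_eq hr hrank
  have hy := hs.trans_le (sigma_le_norm hr hrank)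
  have hα := hi.one_le_alpha
  have hγ : 0 < gamma r m n := by
    rw [gamma]
    have : 0 < min m n := lt_min (by omega) (by omega)
    positivity
  have h1 : ε ≤ √(kappa r Y) / (α * gamma r m n) * √‖Y‖ :=
    hi.eps_le.trans (by gcongr; exact min_le_left _ _)
  have h2 : √(kappa r Y) * √‖Y‖ * √(sigma r Y) = ‖Y‖ := by
    rw [kappa, Real.sqrt_div hy.le]
    have := Real.sq_sqrt hy.le
    have hs' := Real.sqrt_pos.2 hs
    field_simp
    exact this
  calc gamma r m n * (ε * Real.exp (3 * α * δ * ‖Y‖ * t)) ^ 2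
      ≤ gamma r m n * (ε * √(sigma r Y)) := by gcongr; exact hi.nuisance_sq_le hr hrank ht
    _ ≤ gamma r m n * (√(kappa r Y) / (α * gamma r m n) * √‖Y‖ * √(sigma r Y)) := by gcongr
    _ = √(kappa r Y) * √‖Y‖ * √(sigma r Y) / α := by field_simp
    _ = ‖Y‖ / α := by rw [h2]
    _ ≤ ‖Y‖ := div_le_self hy.le hα

/-- The relations on which the propagation of the bounds rests follow from the assumptions on the
parameters; in particular `δ ≤ 1 / (64 α κ)` makes the nuisance part grow more slowly than the
signal. -/
theorem warmupParams (hr : 0 < r) (hrank : Y.rank = r) (hi : InitAssumption r Y α δ ε W₀) :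
    WarmupParams (√‖Y‖) (sigma r Y) α δ ε (T2 r Y ε) := by
  have hs := sigma_pos_of_rank_eq hr hrank
  have hsy := sigma_le_norm hr hrank
  have hε := hi.eps_pos
  have hα := hi.one_le_alpha
  have hsq : √‖Y‖ ^ 2 = ‖Y‖ := Real.sq_sqrt (norm_nonneg _)
  have h5 : 5 ≤ T2 r Y ε * sigma r Y := by
    rw [T2]
    have h1 : 1 ≤ Real.log (sigma r Y / ε ^ 2) := by
      rw [Real.le_log_iff_exp_le (by positivity)]
      have h2 := hi.eps_sq_le hr hrank
      have h3 : 3 ≤ sigma r Y / ε ^ 2 := by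
        rw [le_div_iff₀ (by positivity)]; linarith
      exact (Real.exp_one_lt_three.le).trans h3
    have e : 5 / sigma r Y * Real.log (sigma r Y / ε ^ 2) * sigma r Y
      = 5 * Real.log (sigma r Y / ε ^ 2) := by field_simp
    rw [e]; linarith
  refine ⟨Real.sqrt_pos.2 (hs.trans_le hsy), hs, hsq.symm ▸ hsy, hα, hi.delta_pos,
    hsq.symm ▸ hi.delta_mul_le hr hrank, hε, ?_, h5, fun t ht => ?_⟩
  · exact pos_of_mul_pos_left (by linarith) hs.le
  · rw [hsq, mul_min_of_nonneg _ _ (by positivity)]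
    refine le_min ?_ ?_
    · refine (hi.nuisance_sq_le hr hrank ht).trans ?_
      have h1 : ε ≤ √(sigma r Y) := by
        rw [Real.le_sqrt hε.le hs.le]
        linarith [hi.eps_sq_le hr hrank]
      have h2 : 1 ≤ α ^ 4 := one_le_pow₀ hα
      have h3 := Real.mul_self_sqrt hs.le
      nlinarith [Real.sqrt_nonneg (sigma r Y)]
    · rw [mul_pow, ← Real.exp_nat_mul]
      have e : α ^ 4 * (ε ^ 2 / α ^ 4 * Real.exp (4 * sigma r Y / 5 * t))
        = ε ^ 2 * Real.exp (4 * sigma r Y / 5 * t) := by field_simp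
      rw [e]
      refine mul_le_mul_of_nonneg_left (Real.exp_le_exp.2 ?_) (by positivity)
      have h2 := mul_le_mul_of_nonneg_right (hi.delta_mul_le hr hrank) ht.1
      have h3 := mul_nonneg hs.le ht.1
      push_cast
      linarith

end InitAssumption

end Parameters

/-! ### The projection onto the row space of the signal -/

section Projection

variable {p a c k : Type*} [Fintype p] [Fintype a] [Fintype c] [Fintype k]
  [DecidableEq p] [DecidableEq a] [DecidableEq c] [DecidableEq k]

theorem norm_le_one_of_transpose_mul_self {P : Matrix k k ℝ} (h : Pᵀ * P = P) : ‖P‖ ≤ 1 := by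
  refine norm_le_one_of_mul_self fun v => ?_
  have h1 : (P *ᵥ v) ⬝ᵥ (P *ᵥ v) = v ⬝ᵥ P *ᵥ v := by
    rw [mulVec_dotProduct, Matrix.mulVec_mulVec, h]
  have h2 := zero_le_dotProduct_self (v - P *ᵥ v)
  rw [dotProduct_sub, sub_dotProduct, sub_dotProduct, dotProduct_comm (P *ᵥ v) v, h1] at h2
  linarith

/-- The matrix `Aᵀ (A Aᵀ)⁻¹ A` is the orthogonal projection onto the row space of `A`. -/
theorem rowProj_transpose (A : Matrix a k ℝ) :
    (Aᵀ * (A * Aᵀ)⁻¹ * A)ᵀ = Aᵀ * (A * Aᵀ)⁻¹ * A := by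
  have : ((A * Aᵀ)⁻¹)ᵀ = (A * Aᵀ)⁻¹ := by rw [Matrix.transpose_nonsing_inv]; simp
  simp only [Matrix.transpose_mul, Matrix.transpose_transpose, this, Matrix.mul_assoc]

theorem mul_rowProj {A : Matrix a k ℝ} (h : A * Aᵀ * (A * Aᵀ)⁻¹ = 1) :
    A * (Aᵀ * (A * Aᵀ)⁻¹ * A) = A := by
  rw [← Matrix.mul_assoc, ← Matrix.mul_assoc, h, Matrix.one_mul]

theorem rowProj_mul_self {A : Matrix a k ℝ} (h : A * Aᵀ * (A * Aᵀ)⁻¹ = 1) :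
    (Aᵀ * (A * Aᵀ)⁻¹ * A) * (Aᵀ * (A * Aᵀ)⁻¹ * A) = Aᵀ * (A * Aᵀ)⁻¹ * A := by
  rw [Matrix.mul_assoc _ A, mul_rowProj h]

theorem norm_rowProj_le {A : Matrix a k ℝ} (h : A * Aᵀ * (A * Aᵀ)⁻¹ = 1) :
    ‖Aᵀ * (A * Aᵀ)⁻¹ * A‖ ≤ 1 :=
  norm_le_one_of_transpose_mul_self (by rw [rowProj_transpose, rowProj_mul_self h])

theorem compl_rowProj_mul {A : Matrix a k ℝ} (h : A * Aᵀ * (A * Aᵀ)⁻¹ = 1) :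
    (1 - Aᵀ * (A * Aᵀ)⁻¹ * A) * (1 - Aᵀ * (A * Aᵀ)⁻¹ * A) = 1 - Aᵀ * (A * Aᵀ)⁻¹ * A := by
  rw [Matrix.mul_sub, Matrix.mul_one, Matrix.sub_mul, Matrix.one_mul, rowProj_mul_self h, sub_self,
    sub_zero]

theorem norm_compl_rowProj_le {A : Matrix a k ℝ} (h : A * Aᵀ * (A * Aᵀ)⁻¹ = 1) :
    ‖1 - Aᵀ * (A * Aᵀ)⁻¹ * A‖ ≤ 1 :=
  norm_le_one_of_transpose_mul_self (by
    rw [Matrix.transpose_sub, rowProj_transpose, Matrix.transpose_one, compl_rowProj_mul h])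

theorem norm_pinv_le {A : Matrix a k ℝ} {b : ℝ} (hb : 0 < b)
    (h : (A * Aᵀ - b ^ 2 • (1 : Matrix a a ℝ)).PosSemidef) : ‖Aᵀ * (A * Aᵀ)⁻¹‖ ≤ b⁻¹ := by
  have hM : A * Aᵀ * (A * Aᵀ)⁻¹ = 1 := Matrix.mul_nonsing_inv _
    ((Matrix.isUnit_iff_isUnit_det _).1 (isUnit_of_posSemidef_sub (by positivity) h))
  have ht : ((A * Aᵀ)⁻¹)ᵀ = (A * Aᵀ)⁻¹ := by rw [Matrix.transpose_nonsing_inv]; simp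
  have e : (Aᵀ * (A * Aᵀ)⁻¹)ᵀ * (Aᵀ * (A * Aᵀ)⁻¹) = (A * Aᵀ)⁻¹ := by
    rw [Matrix.transpose_mul, Matrix.transpose_transpose, ht, Matrix.mul_assoc,
      ← Matrix.mul_assoc A, hM, Matrix.mul_one]
  have h1 := Matrix.l2_opNorm_conjTranspose_mul_self (Aᵀ * (A * Aᵀ)⁻¹)
  rw [Matrix.conjTranspose_eq_transpose_of_trivial, e] at h1
  have h2 := norm_inv_le_of_posSemidef_sub (by positivity) h
  rw [h1, ← inv_pow, ← pow_two] at h2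
  exact le_of_sq_le_sq h2 (by positivity)

/-- The nuisance part `W - W Q` has no component in the signal directions, so its norm is that of its
image under `PP`. -/
theorem nuisance_norm_le {PA : Matrix a p ℝ} {PP : Matrix c p ℝ} (hres : PAᵀ * PA + PPᵀ * PP = 1)
    (hPP : ‖PP‖ ≤ 1) {W : Matrix p k ℝ}
    (h : PA * W * (PA * W)ᵀ * (PA * W * (PA * W)ᵀ)⁻¹ = 1) :
    ‖W - W * ((PA * W)ᵀ * (PA * W * (PA * W)ᵀ)⁻¹ * (PA * W))‖
      ≤ ‖PP * W - PP * W * (PA * W)ᵀ * (PA * W * (PA * W)ᵀ)⁻¹ * (PA * W)‖ := by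
  set X := W - W * ((PA * W)ᵀ * (PA * W * (PA * W)ᵀ)⁻¹ * (PA * W)) with hX
  have h1 : PA * X = 0 := by
    rw [hX, Matrix.mul_sub, ← Matrix.mul_assoc, mul_rowProj h, sub_self]
  have h2 : PP * X = PP * W - PP * W * (PA * W)ᵀ * (PA * W * (PA * W)ᵀ)⁻¹ * (PA * W) := by
    rw [hX, Matrix.mul_sub]
    simp only [Matrix.mul_assoc]
  have h3 : X = PPᵀ * (PP * X) := by
    conv_lhs => rw [← Matrix.one_mul X, ← hres, Matrix.add_mul, Matrix.mul_assoc, h1,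
      Matrix.mul_zero, zero_add, Matrix.mul_assoc]
  rw [← h2]
  conv_lhs => rw [h3]
  simpa using norm_mul_le_of_le (norm_transpose_le hPP) (le_refl ‖PP * X‖)

end Projection

end

section

variable {m n h N r : ℕ} {Y : Matrix (Fin m) (Fin n) ℝ}
  {𝒜 : Matrix (Fin m) (Fin n) ℝ →ₗ[ℝ] EuclideanSpace ℝ (Fin N)} {α δ ε ρ η q s T t : ℝ}

/-! ### The size of the perturbation -/

section Perturbation

theorem norm_toRows₁_le (W : Matrix (Fin m ⊕ Fin n) (Fin h) ℝ) : ‖W.toRows₁‖ ≤ ‖W‖ := by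
  refine opNorm_le_of_dotProduct (norm_nonneg _) fun u => ?_
  refine le_trans ?_ (dotProduct_mulVec_self_le W u)
  have e : (W *ᵥ u) ⬝ᵥ (W *ᵥ u) = (W.toRows₁ *ᵥ u) ⬝ᵥ (W.toRows₁ *ᵥ u)
      + (W.toRows₂ *ᵥ u) ⬝ᵥ (W.toRows₂ *ᵥ u) := by
    conv_lhs => rw [← Matrix.fromRows_toRows W, Matrix.fromRows_mulVec, sumElim_dotProduct_sumElim]
  rw [e]
  linarith [zero_le_dotProduct_self (W.toRows₂ *ᵥ u)]

theorem norm_toRows₂_le (W : Matrix (Fin m ⊕ Fin n) (Fin h) ℝ) : ‖W.toRows₂‖ ≤ ‖W‖ := by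
  refine opNorm_le_of_dotProduct (norm_nonneg _) fun u => ?_
  refine le_trans ?_ (dotProduct_mulVec_self_le W u)
  have e : (W *ᵥ u) ⬝ᵥ (W *ᵥ u) = (W.toRows₁ *ᵥ u) ⬝ᵥ (W.toRows₁ *ᵥ u)
      + (W.toRows₂ *ᵥ u) ⬝ᵥ (W.toRows₂ *ᵥ u) := by
    conv_lhs => rw [← Matrix.fromRows_toRows W, Matrix.fromRows_mulVec, sumElim_dotProduct_sumElim]
  rw [e]
  linarith [zero_le_dotProduct_self (W.toRows₁ *ᵥ u)]

theorem toRows₁_mul (W : Matrix (Fin m ⊕ Fin n) (Fin h) ℝ) (P : Matrix (Fin h) (Fin h) ℝ) :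
    (W * P).toRows₁ = W.toRows₁ * P := by
  ext i j; simp [Matrix.mul_apply]

theorem toRows₂_mul (W : Matrix (Fin m ⊕ Fin n) (Fin h) ℝ) (P : Matrix (Fin h) (Fin h) ℝ) :
    (W * P).toRows₂ = W.toRows₂ * P := by
  ext i j; simp [Matrix.mul_apply]

/-- The bounds along the flow, for the geometry of `Y`. -/
abbrev Bounds (r : ℕ) (Y : Matrix (Fin m) (Fin n) ℝ) (hm : r ≤ m) (hn : r ≤ n) (α δ ε t : ℝ)
    (W : Matrix (Fin m ⊕ Fin n) (Fin h) ℝ) : Prop :=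
  WarmupBounds (PA r m n) (PP r m n) (PN r m n) (J m n)
    (Matrix.fromBlocks 0 0 0 (-headBlock r Y hm hn)) (√‖Y‖) (sigma r Y) α δ ε (T2 r Y ε) t W

theorem SensingAssumption.rho_mul_sqrt_le (hr : 0 < r) (hy : 0 < ‖Y‖) (hT : 0 < T)
    (hs : SensingAssumption 𝒜 r Y δ ρ η T) : ρ * √r * ‖Y‖ ≤ δ ^ 2 / T / 16 := by
  have hr' : 0 < √(r : ℝ) := Real.sqrt_pos.2 (by exact_mod_cast hr)
  calc ρ * √r * ‖Y‖ ≤ δ ^ 2 / (16 * √r * T * ‖Y‖) * √r * ‖Y‖ := by gcongr; exact hs.rho_le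
    _ = δ ^ 2 / T / 16 := by field_simp

/-- The measurement error at a time when the bounds hold. With the projection `Q` onto the row space of
the signal, `U Vᵀ = U Q Vᵀ + Ũ Ṽᵀ`. The matrices `Y` and `U Q Vᵀ` have rank at most `r`, and the rest is
so small that its missing rank restriction does not matter. The constant is
`(1 + 9 / 4 + 2) / 16 = 21 / 64`. -/
theorem norm_measError_le (hr : 0 < r) (hrank : Y.rank = r) (hm : r ≤ m) (hn : r ≤ n)
    {W₀ W : Matrix (Fin m ⊕ Fin n) (Fin h) ℝ} (hY : IsSortedDiagonal Y)
    (hi : InitAssumption r Y α δ ε W₀) (hs : SensingAssumption 𝒜 r Y δ ρ η (T2 r Y ε))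
    (ht : t ∈ Icc 0 (T2 r Y ε)) (hb : Bounds r Y hm hn α δ ε t W) :
    ‖measError 𝒜 Y W‖ ≤ δ ^ 2 / T2 r Y ε * (21 / 64) := by
  have hp := hi.warmupParams hr hrank
  have hf := spectralFrame hY hrank hm hn
  have hsig := sigma_pos_of_rank_eq hr hrank
  have hy := hsig.trans_le (sigma_le_norm hr hrank)
  have hρ : 0 ≤ ρ := hs.rip.nonneg (norm_pos_iff.1 hy) (by omega)
  have hq : √‖Y‖ ^ 2 = ‖Y‖ := Real.sq_sqrt hy.le
  have hM := hb.gram_mul_inv hp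
  set A := PA r m n * W with hA
  set Q := Aᵀ * (A * Aᵀ)⁻¹ * A with hQ
  set U := W.toRows₁
  set V := W.toRows₂
  have hdec : Y - U * Vᵀ = Y + (-1 : ℝ) • (U * Q * Vᵀ)
      + (-1 : ℝ) • ((W - W * Q).toRows₁ * ((W - W * Q).toRows₂)ᵀ) := by
    have e : W - W * Q = W * (1 - Q) := by rw [Matrix.mul_sub, Matrix.mul_one]
    have eP : (1 - Q) * (1 - Q)ᵀ = 1 - Q := by
      rw [Matrix.transpose_sub, Matrix.transpose_one, rowProj_transpose, compl_rowProj_mul hM]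
    have e2 : U * (1 - Q) * ((1 - Q)ᵀ * Vᵀ) = U * Vᵀ - U * Q * Vᵀ := by
      rw [← Matrix.mul_assoc, Matrix.mul_assoc U (1 - Q), eP, Matrix.mul_sub, Matrix.sub_mul,
        Matrix.mul_one]
    have e3 : (W - W * Q).toRows₁ * ((W - W * Q).toRows₂)ᵀ = U * Vᵀ - U * Q * Vᵀ := by
      rw [e, toRows₁_mul, toRows₂_mul, Matrix.transpose_mul]
      exact e2
    rw [e3]
    simp only [neg_smul, one_smul]
    abel
  have hdev : measError 𝒜 Y W = deviation 𝒜 (Y - U * Vᵀ) := rfl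
  rw [hdev, hdec, deviation_add, deviation_add, deviation_smul, deviation_smul]
  have hW2 : ‖U * Q * Vᵀ‖ ≤ 9 / 4 * ‖Y‖ := by
    refine (norm_mul_le_of_le (norm_mul_le_of_le ((norm_toRows₁_le W).trans hb.norm_W)
      (norm_rowProj_le hM)) (norm_transpose_le ((norm_toRows₂_le W).trans hb.norm_W))).trans_eq ?_
    linear_combination (9 / 4) * hq
  have hrk : (U * Q * Vᵀ).rank ≤ r := by
    refine (Matrix.rank_mul_le_left _ _).trans ((Matrix.rank_mul_le_right _ _).trans ?_)
    refine (Matrix.rank_mul_le_right _ _).trans ?_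
    simpa using Matrix.rank_le_card_height A
  have hn2 : ‖(W - W * Q).toRows₁ * ((W - W * Q).toRows₂)ᵀ‖
      ≤ (ε * Real.exp (3 * α * δ * ‖Y‖ * t)) ^ 2 := by
    have h1 := (nuisance_norm_le hf.resolution hf.norm_PP hM).trans hb.norm_nuisance
    rw [hq] at h1
    rw [pow_two]
    exact norm_mul_le_of_le ((norm_toRows₁_le _).trans h1)
      (norm_transpose_le ((norm_toRows₂_le _).trans h1))
  have hγ := hi.gamma_mul_nuisance_sq_le hr hm hn hrank ht
  have hγ0 : 0 ≤ gamma r m n := by rw [gamma]; positivity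
  have d1 := hs.rip.norm_deviation_le hρ hrank.le
  have d2 := hs.rip.norm_deviation_le hρ hrk
  have d3 := hs.rip.norm_deviation_le_gamma hρ hr hm hn
    ((W - W * Q).toRows₁ * ((W - W * Q).toRows₂)ᵀ)
  have hρr : 0 ≤ ρ * √(r : ℝ) := by positivity
  have key := hs.rho_mul_sqrt_le hr hy hp.T_pos
  have d2' : ‖deviation 𝒜 (U * Q * Vᵀ)‖ ≤ ρ * √r * (9 / 4 * ‖Y‖) := d2.trans (by gcongr)
  have d3' : ‖deviation 𝒜 ((W - W * Q).toRows₁ * ((W - W * Q).toRows₂)ᵀ)‖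
      ≤ ρ * √r * (2 * ‖Y‖) := by
    refine d3.trans (mul_le_mul_of_nonneg_left ?_ hρr)
    have := mul_le_mul_of_nonneg_left hn2 hγ0
    linarith
  have n1 : ∀ X : Matrix (Fin m) (Fin n) ℝ, ‖(-1 : ℝ) • X‖ = ‖X‖ := fun X => by
    rw [neg_smul, one_smul, norm_neg]
  refine (norm_add_le _ _).trans ((add_le_add_left (norm_add_le _ _) _).trans ?_)
  rw [n1, n1]
  linarith

theorem norm_residualR_sub_le {W V : Matrix (Fin m ⊕ Fin n) (Fin h) ℝ} {w d : ℝ}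
    (hJ : ‖J m n‖ ≤ 1) (hW : ‖W‖ ≤ w) (hV : ‖V‖ ≤ w) (hd : ‖W - V‖ ≤ d) :
    ‖residualR Y W - residualR Y V‖ ≤ 2 * w * d := by
  have hx : ‖W * Wᵀ - V * Vᵀ‖ ≤ w * d + d * w := by
    have e : W * Wᵀ - V * Vᵀ = W * (W - V)ᵀ + (W - V) * Vᵀ := by
      rw [Matrix.transpose_sub, Matrix.mul_sub, Matrix.sub_mul]; abel
    rw [e]
    exact (norm_add_le _ _).trans (add_le_add (norm_mul_le_of_le hW (norm_transpose_le hd))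
      (norm_mul_le_of_le hd (norm_transpose_le hV)))
  have e : residualR Y W - residualR Y V = -((1 / 2 : ℝ) • ((W * Wᵀ - V * Vᵀ)
      - J m n * (W * Wᵀ - V * Vᵀ) * J m n)) := by
    simp only [residualR, Matrix.mul_sub, Matrix.sub_mul, ← Matrix.mul_assoc, smul_sub]
    abel
  rw [e, norm_neg, norm_smul, Real.norm_of_nonneg (by norm_num)]
  have h1 := (norm_sub_le (W * Wᵀ - V * Vᵀ) (J m n * (W * Wᵀ - V * Vᵀ) * J m n)).trans
    (add_le_add hx (norm_mul_le_of_le (norm_mul_le_of_le hJ hx) hJ))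
  linarith

theorem norm_residualR_le {W : Matrix (Fin m ⊕ Fin n) (Fin h) ℝ} {w : ℝ}
    (hJ : ‖J m n‖ ≤ 1) (hW : ‖W‖ ≤ w) : ‖residualR Y W‖ ≤ ‖Y‖ + w ^ 2 := by
  have hx : ‖W * Wᵀ‖ ≤ w * w := norm_mul_le_of_le hW (norm_transpose_le hW)
  rw [residualR]
  refine (norm_sub_le _ _).trans (add_le_add (norm_dilation_le Y) ?_)
  rw [norm_smul, Real.norm_of_nonneg (by norm_num), Matrix.mul_assoc (J m n)]
  have h1 := (norm_sub_le (W * Wᵀ) (J m n * (W * Wᵀ) * J m n)).trans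
    (add_le_add hx (norm_mul_le_of_le (norm_mul_le_of_le hJ hx) hJ))
  linarith

theorem residualR_transpose (W : Matrix (Fin m ⊕ Fin n) (Fin h) ℝ) :
    (residualR Y W)ᵀ = residualR Y W := by
  have hJ : (J m n)ᵀ = J m n := by simp [J, Matrix.fromBlocks_transpose]
  simp [residualR, dilation, Matrix.fromBlocks_transpose, hJ, Matrix.mul_assoc]

/-- The right-hand side of the flow is the expanded velocity. -/
theorem residualR_add_mul (W : Matrix (Fin m ⊕ Fin n) (Fin h) ℝ)
    (E : Matrix (Fin m ⊕ Fin n) (Fin m ⊕ Fin n) ℝ) :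
    (residualR Y W + E) * W = velocity (J m n) (dilation Y) E W := by
  simp only [residualR, velocity, Matrix.add_mul, Matrix.sub_mul, Matrix.smul_mul, Matrix.mul_assoc,
    smul_sub]
  abel

/-- The perturbation is at most `δ² / T₂` as long as the bounds have held so far. It is the sum of the
measurement error, the error of the logarithm to first order, and the drift of the residual since the
last multiple of `η`; these take up the fractions `21 / 64`, `3 / 10` and `1 / 5`. -/
theorem norm_perturbation_le (hr : 0 < r) (hrank : Y.rank = r) (hm : r ≤ m) (hn : r ≤ n)
    {W : ℝ → Matrix (Fin m ⊕ Fin n) (Fin h) ℝ} (hY : IsSortedDiagonal Y)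
    (hi : InitAssumption r Y α δ ε (W 0)) (hs : SensingAssumption 𝒜 r Y δ ρ η (T2 r Y ε))
    (hflow : IsPerturbedGradientFlow 𝒜 Y η (T2 r Y ε) W)
    (ht : t ∈ Ico 0 (T2 r Y ε)) (hb : ∀ x ∈ Icc 0 t, Bounds r Y hm hn α δ ε x (W x)) :
    ‖perturbation 𝒜 Y η W t‖ ≤ δ ^ 2 / T2 r Y ε := by
  have hp := hi.warmupParams hr hrank
  have hf := spectralFrame hY hrank hm hn
  have hsig := sigma_pos_of_rank_eq hr hrank
  have hsy := sigma_le_norm hr hrank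
  have hy := hsig.trans_le hsy
  have hq : √‖Y‖ ^ 2 = ‖Y‖ := Real.sq_sqrt hy.le
  have hη := hs.eta_pos
  have hT := hp.T_pos
  set θ := δ ^ 2 / T2 r Y ε with hθ
  have hθ0 : 0 < θ := by have := hp.delta_pos; positivity
  have hθy : θ ≤ ‖Y‖ / 20000 := by
    have h1 := hp.perturbation_le
    have h2 := hp.delta_le_one_div
    have h3 := hp.delta_pos
    have h4 : δ ^ 2 ≤ (1 / 64) ^ 2 := by gcongr
    nlinarith
  have hηy : η * ‖Y‖ ^ 2 ≤ θ / 80 := by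
    calc η * ‖Y‖ ^ 2 ≤ δ ^ 2 / (80 * T2 r Y ε * ‖Y‖ ^ 2) * ‖Y‖ ^ 2 := by gcongr; exact hs.eta_le
      _ = θ / 80 := by rw [hθ]; field_simp
  have hηy1 : η * ‖Y‖ ≤ 1 / 1000 := by
    by_contra! hlt
    nlinarith
  set k := ⌊t / η⌋₊ with hk
  set τ := (k : ℝ) * η with hτ
  have hτ0 : 0 ≤ τ := by positivity
  have hτt : τ ≤ t := by
    have := Nat.floor_le (div_nonneg ht.1 hη.le)
    rwa [le_div_iff₀ hη] at this
  have htτ : t - τ ≤ η := by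
    have := Nat.lt_floor_add_one (t / η)
    rw [div_lt_iff₀ hη] at this
    linarith
  have hbτ := hb τ ⟨hτ0, hτt⟩
  have hbt := hb t ⟨ht.1, le_rfl⟩
  have hme := norm_measError_le hr hrank hm hn hY hi hs ⟨hτ0, hτt.trans ht.2.le⟩ hbτ
  set X := residualR Y (W τ) + dilation (measError 𝒜 Y (W τ)) with hX
  have hXt : Xᵀ = X := by
    rw [hX, Matrix.transpose_add, residualR_transpose]
    simp [dilation, Matrix.fromBlocks_transpose]
  have hRn := norm_residualR_le (Y := Y) hf.norm_J hbτ.norm_W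
  rw [mul_pow, hq] at hRn
  have hXn : ‖X‖ ≤ 33 / 10 * ‖Y‖ := by
    have h1 := (norm_add_le (residualR Y (W τ)) (dilation (measError 𝒜 Y (W τ)))).trans
      (add_le_add hRn ((norm_dilation_le _).trans hme))
    linarith
  have hηX : ‖η • X‖ ≤ 33 / 10 * (η * ‖Y‖) := by
    rw [norm_smul, Real.norm_of_nonneg hη.le]
    have := mul_le_mul_of_nonneg_left hXn hη.le
    linarith
  have hηXt : (η • X)ᵀ = η • X := by rw [Matrix.transpose_smul, hXt]
  have hlog := norm_log_one_add_sub_le hηXt (by linarith)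
  -- on the current step of length `η` the flow is linear, with the constant matrix `L`
  set L := (1 / η) • CFC.log (1 + η • X) with hL
  have hLX : ‖L - X‖ ≤ 3 / 10 * θ := by
    have e : L - X = (1 / η) • (CFC.log (1 + η • X) - η • X) := by
      rw [smul_sub, smul_smul, one_div_mul_cancel hη.ne', one_smul]
    rw [e, norm_smul, Real.norm_of_nonneg (by positivity), one_div, inv_mul_le_iff₀ hη]
    have h1 : ‖η • X‖ ^ 2 ≤ (33 / 10 * (η * ‖Y‖)) ^ 2 := by gcongr
    have h2 : η * (η * ‖Y‖ ^ 2) ≤ η * (θ / 80) := mul_le_mul_of_nonneg_left hηy hη.le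
    nlinarith
  have hLn : ‖L‖ ≤ 34 / 10 * ‖Y‖ := by
    have h1 : ‖L‖ ≤ ‖L - X‖ + ‖X‖ := by
      simpa using norm_add_le (L - X) X
    linarith
  have hpert : ∀ x, ⌊x / η⌋₊ = k → residualR Y (W x) + perturbation 𝒜 Y η W x = L := by
    intro x hx
    rw [perturbation, hx, ← hτ, add_sub_cancel, add_assoc, ← smul_add]
  have hdiff : ‖W t - W τ‖ ≤ 34 / 10 * ‖Y‖ * (3 / 2 * √‖Y‖) * (t - τ) := by
    refine norm_image_sub_le_of_norm_deriv_right_le_segment (f := W)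
      (f' := fun x => L * W x)
      (hflow.continuousOn.mono (Icc_subset_Icc hτ0 ht.2.le)) (fun x hx => ?_) (fun x hx => ?_) t
      ⟨hτt, le_rfl⟩
    · have hfl : ⌊x / η⌋₊ = k := by
        refine le_antisymm (Nat.floor_le_floor (by gcongr; exact hx.2.le)) (Nat.le_floor ?_)
        rw [le_div_iff₀ hη]; exact hx.1
      rw [← hpert x hfl]
      exact hflow.rightDeriv x ⟨hτ0.trans hx.1, hx.2.trans ht.2⟩
    · exact norm_mul_le_of_le hLn (hb x ⟨hτ0.trans hx.1, hx.2.le⟩).norm_W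
  have hRd := norm_residualR_sub_le (Y := Y) hf.norm_J hbτ.norm_W hbt.norm_W
    ((norm_sub_rev _ _).trans_le hdiff)
  have hRd' : ‖residualR Y (W τ) - residualR Y (W t)‖ ≤ 1 / 5 * θ := by
    refine hRd.trans ?_
    have e : 2 * (3 / 2 * √‖Y‖) * (34 / 10 * ‖Y‖ * (3 / 2 * √‖Y‖) * (t - τ))
        = 153 / 10 * ((t - τ) * ‖Y‖ ^ 2) := by
      linear_combination (153 / 10 * ‖Y‖ * (t - τ)) * hq
    rw [e]
    have := mul_le_mul_of_nonneg_right htτ (sq_nonneg ‖Y‖)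
    linarith
  have e : perturbation 𝒜 Y η W t = (L - X) + dilation (measError 𝒜 Y (W τ))
      + (residualR Y (W τ) - residualR Y (W t)) := by
    rw [← hpert t rfl, hX]; abel
  rw [e]
  have h1 := (norm_add_le (L - X + dilation (measError 𝒜 Y (W τ)))
    (residualR Y (W τ) - residualR Y (W t))).trans
    (add_le_add ((norm_add_le _ _).trans (add_le_add hLX ((norm_dilation_le _).trans hme))) hRd')
  linarith

end Perturbation

/-! ### The bounds at time zero -/

section Initial

/-- At time zero everything is at most of the size `ε` of the initialization; the bounds that
involve `A†` and the bound on the signal also use the lower bound on `σ_r(A₀)`. -/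
theorem warmupBounds_zero (hr : 0 < r) (hrank : Y.rank = r) (hm : r ≤ m) (hn : r ≤ n)
    {W : Matrix (Fin m ⊕ Fin n) (Fin h) ℝ} (hY : IsSortedDiagonal Y)
    (hi : InitAssumption r Y α δ ε W) : Bounds r Y hm hn α δ ε 0 W := by
  have hp := hi.warmupParams hr hrank
  have hf := spectralFrame hY hrank hm hn
  have hq := hp.q_pos
  have hδ := hp.delta_pos
  have hα := hp.one_le_alpha
  have hε := hp.eps_pos
  have hε1 := hi.eps_le_delta
  have hε2 : ε ≤ δ * √‖Y‖ / 3 := by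
    refine hε1.trans ?_
    rw [div_mul_eq_mul_div]
    gcongr
    linarith
  have hδ1 := hp.delta_le_one_div
  have hδq : δ * √‖Y‖ ≤ 1 / 64 * √‖Y‖ := by gcongr
  have hδq0 : 0 < δ * √‖Y‖ := by positivity
  have hε3 : ε ^ 2 ≤ δ ^ 2 * √‖Y‖ ^ 2 / 9 := by
    have : ε ^ 2 ≤ (δ * √‖Y‖ / 3) ^ 2 := by gcongr
    linarith [this, show (δ * √‖Y‖ / 3) ^ 2 = δ ^ 2 * √‖Y‖ ^ 2 / 9 by ring]
  have hb0 : 0 < ε / α ^ 2 := by positivity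
  have hA := posSemidef_of_le_sigma hr hb0 hi.le_sigma
  rw [signalA] at hA
  have hM : PA r m n * W * (PA r m n * W)ᵀ * (PA r m n * W * (PA r m n * W)ᵀ)⁻¹ = 1 :=
    Matrix.mul_nonsing_inv _
      ((Matrix.isUnit_iff_isUnit_det _).1 (isUnit_of_posSemidef_sub (by positivity) hA))
  have hPPW : ‖PP r m n * W‖ ≤ 1 * ε := norm_mul_le_of_le hf.norm_PP hi.norm_le
  refine ⟨?_, ?_, ?_, ?_, ?_, ?_, ?_, ?_⟩
  · exact hi.norm_le.trans (by linarith)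
  · refine (norm_mul_le_of_le (norm_mul_le_of_le (norm_transpose_le hi.norm_le) hf.norm_J)
      hi.norm_le).trans ?_
    have : 0 ≤ δ ^ 2 * √‖Y‖ ^ 2 := by positivity
    simp only [mul_zero, zero_div, add_zero]
    linarith
  · refine (norm_mul_le_of_le (norm_mul_le_of_le hf.norm_PA hf.norm_J) hi.norm_le).trans ?_
    linarith
  · refine (norm_mul_le_of_le hf.norm_PN hi.norm_le).trans ?_
    simp only [zero_div, add_zero]
    linarith
  · refine posSemidef_of_dotProduct (by simp [hf.H_transpose]) fun u => ?_
    rw [Matrix.sub_mulVec, dotProduct_sub, Matrix.smul_mulVec, Matrix.one_mulVec, dotProduct_smul,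
      Matrix.add_mulVec, dotProduct_add, Matrix.smul_mulVec, dotProduct_smul,
      ← Matrix.mulVec_mulVec]
    have h1 := hf.H_nonpos u
    have hZ : ‖(PP r m n * J m n * W)ᵀ‖ ≤ 1 * 1 * ε := norm_transpose_le
      (norm_mul_le_of_le (norm_mul_le_of_le hf.norm_PP hf.norm_J) hi.norm_le)
    have h2 := dotProduct_mulVec_self_le (PP r m n * J m n * W)ᵀ u
    rw [mulVec_dotProduct, Matrix.transpose_transpose] at h2
    have h3 : ‖(PP r m n * J m n * W)ᵀ‖ ^ 2 ≤ ε ^ 2 := by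
      refine pow_le_pow_left₀ (norm_nonneg _) ?_ 2
      linarith
    have h4 := zero_le_dotProduct_self u
    have h5 : ε ^ 2 ≤ 2 * δ * √‖Y‖ ^ 2 := by
      have : δ ^ 2 * √‖Y‖ ^ 2 ≤ δ * √‖Y‖ ^ 2 := by
        gcongr; nlinarith
      have : 0 ≤ δ * √‖Y‖ ^ 2 := by positivity
      linarith
    simp only [smul_eq_mul]
    nlinarith [mul_le_mul_of_nonneg_right (h3.trans h5) h4]
  · rw [Matrix.mul_assoc]
    refine (norm_mul_le_of_le hPPW (norm_pinv_le hb0 hA)).trans_eq ?_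
    field_simp
  · simp only [mul_zero, Real.exp_zero, mul_one]
    have e : PP r m n * W - PP r m n * W * (PA r m n * W)ᵀ
        * (PA r m n * W * (PA r m n * W)ᵀ)⁻¹ * (PA r m n * W)
        = PP r m n * W * (1 - (PA r m n * W)ᵀ * (PA r m n * W * (PA r m n * W)ᵀ)⁻¹
          * (PA r m n * W)) := by
      rw [Matrix.mul_sub, Matrix.mul_one]
      simp only [Matrix.mul_assoc]
    rw [e]
    refine (norm_mul_le_of_le hPPW (norm_compl_rowProj_le hM)).trans_eq (by ring)
  · have h1 : min (sigma r Y) (ε ^ 2 / α ^ 4 * Real.exp (4 * sigma r Y / 5 * 0))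
        ≤ (ε / α ^ 2) ^ 2 := by
      refine (min_le_right _ _).trans_eq ?_
      simp only [mul_zero, Real.exp_zero, mul_one]
      ring
    have h2 : (((ε / α ^ 2) ^ 2 - min (sigma r Y)
        (ε ^ 2 / α ^ 4 * Real.exp (4 * sigma r Y / 5 * 0))) •
        (1 : Matrix (Fin r) (Fin r) ℝ)).PosSemidef :=
      Matrix.PosSemidef.one.smul (sub_nonneg.2 h1)
    have h3 := hA.add h2
    rw [sub_smul] at h3
    simpa using h3

end Initial

/-! ### From the propagated bounds to the warm-up set -/

section Conclusion

theorem lambdaMax_le {p : Type*} [Fintype p] [DecidableEq p] {X : Matrix p p ℝ} {c : ℝ}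
    (hc : 0 ≤ c) (h : (c • (1 : Matrix p p ℝ) - X).PosSemidef) : lambdaMax X ≤ c := by
  refine Real.sSup_le (fun x hx => ?_) hc
  rw [spectrum.mem_iff, Matrix.isUnit_iff_isUnit_det, isUnit_iff_ne_zero, not_not] at hx
  obtain ⟨v, hv, hev⟩ := Matrix.exists_mulVec_eq_zero_iff.2 hx
  rw [Matrix.sub_mulVec, sub_eq_zero, Algebra.algebraMap_eq_smul_one, Matrix.smul_mulVec,
    Matrix.one_mulVec] at hev
  have h1 := h.dotProduct_nonneg v
  rw [Matrix.sub_mulVec, ← hev, Matrix.smul_mulVec, Matrix.one_mulVec, dotProduct_sub,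
    dotProduct_smul, dotProduct_smul, smul_eq_mul, smul_eq_mul, ← sub_mul] at h1
  have hvv : 0 < v ⬝ᵥ v :=
    lt_of_le_of_ne (zero_le_dotProduct_self v) fun h0 => hv (dotProduct_self_eq_zero.1 h0.symm)
  linarith [nonneg_of_mul_nonneg_left h1 hvv]

theorem PP_mul_transpose (hm : r ≤ m) (hn : r ≤ n) : PP r m n * (PP r m n)ᵀ = 1 := by
  have hhh : ∀ d, r ≤ d → headSel r d * (headSel r d)ᵀ = 1 := by
    intro d hd
    ext i j
    rw [headSel_mul hd]
    simp [headSel, Matrix.one_apply, Fin.ext_iff, eq_comm]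
  have hth : ∀ d, r ≤ d → tailSel r d * (headSel r d)ᵀ = 0 := by
    intro d hd
    ext i j
    rw [tailSel_mul]
    have : (j : ℕ) ≠ r + i := by omega
    simp [headSel, this]
  have hht : ∀ d, r ≤ d → headSel r d * (tailSel r d)ᵀ = 0 := by
    intro d hd
    rw [← Matrix.transpose_eq_zero, Matrix.transpose_mul, Matrix.transpose_transpose, hth d hd]
  have htt : ∀ d, tailSel r d * (tailSel r d)ᵀ = 1 := by
    intro d
    ext i j
    rw [tailSel_mul]
    simp [tailSel, Matrix.one_apply, Fin.ext_iff, eq_comm]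
  have h2 : (√2)⁻¹ * (√2)⁻¹ = (2⁻¹ : ℝ) := by
    rw [← mul_inv, Real.mul_self_sqrt (by norm_num)]
  rw [PP, Matrix.transpose_fromRows, Matrix.fromRows_mul_fromCols, PN_eq, PA_eq, J,
    Matrix.fromCols_mul_fromBlocks, Matrix.transpose_fromCols, Matrix.fromBlocks_transpose,
    Matrix.fromBlocks_multiply, Matrix.fromBlocks_mul_fromRows, Matrix.fromCols_mul_fromBlocks,
    Matrix.fromCols_mul_fromRows, ← Matrix.fromBlocks_one]
  congr 1
  · simp [htt]
  · simp [hth m hm, hth n hn]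
  · simp [hht m hm, hht n hn]
  · simp [hhh m hm, hhh n hn, smul_smul, h2, ← add_smul]
    norm_num

/-- The propagated bounds imply the eight bounds of the warm-up set. The bound on `PN * W` uses
`5 / 2 + 1 / 4 ≤ √8`. -/
theorem mem_warmupSet (hr : 0 < r) (hrank : Y.rank = r) (hm : r ≤ m) (hn : r ≤ n)
    {W : ℝ → Matrix (Fin m ⊕ Fin n) (Fin h) ℝ} (hY : IsSortedDiagonal Y)
    (hi : InitAssumption r Y α δ ε (W 0)) (ht : t ∈ Icc 0 (T2 r Y ε))
    (hb : Bounds r Y hm hn α δ ε t (W t)) : t ∈ warmupSet r Y α δ ε W := by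
  have hp := hi.warmupParams hr hrank
  have hf := spectralFrame hY hrank hm hn
  have hM := hb.gram_mul_inv hp
  have hq : √‖Y‖ ^ 2 = ‖Y‖ := Real.sq_sqrt (norm_nonneg _)
  have hδ := hp.delta_pos
  have hα : 0 < α := zero_lt_one.trans_le hp.one_le_alpha
  have hε := hp.eps_pos
  refine ⟨ht, hb.norm_W, ?_, hb.norm_B, ?_, ?_, ?_, ?_, ?_⟩
  · have := hb.norm_imbalance
    rwa [hq] at this
  · refine hb.norm_N.trans ?_
    have h1 : t / (4 * T2 r Y ε) ≤ 1 / 4 := by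
      rw [div_le_div_iff₀ (by linarith [hp.T_pos]) (by norm_num)]; linarith [ht.2]
    have h2 : 11 / 4 ≤ √8 := Real.le_sqrt_of_sq_le (by norm_num)
    rw [Real.sqrt_mul (by norm_num), mul_comm (5 / 2 + _), mul_assoc]
    gcongr
    linarith
  · have h1 := hb.top_eigenvalue
    rw [hq] at h1
    refine lambdaMax_le (by positivity) ?_
    convert! h1 using 2
    rw [Matrix.mul_add, Matrix.add_mul, hf.PP_mul_Yh, Matrix.mul_assoc _ (PP r m n),
      PP_mul_transpose hm hn, Matrix.mul_one]
    congr 1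
    simp [Matrix.mul_assoc, hf.J_transpose]
  · have := hb.norm_F
    rwa [Matrix.mul_assoc (PP r m n * W t)] at this
  · have h1 := (nuisance_norm_le hf.resolution hf.norm_PP hM).trans hb.norm_nuisance
    rw [hq] at h1
    exact h1
  · refine le_trans ?_ (le_sigma_of_posSemidef hr (hp.threshold_pos t) hb.signal)
    refine Real.le_sqrt_of_sq_le (le_min ?_ ?_)
    · refine (pow_le_pow_left₀ (by positivity) (min_le_left _ _) 2).trans_eq ?_
      exact Real.sq_sqrt hp.s_pos.le
    · refine (pow_le_pow_left₀ (by positivity) (min_le_right _ _) 2).trans_eq ?_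
      rw [mul_pow, ← Real.exp_nat_mul, div_pow, ← pow_mul]
      congr 2
      push_cast
      ring

end Conclusion

end

end MatrixSensing

end

theorem mainTheorem2 {m n h N r : ℕ} (hr : 0 < r)
    (Y : Matrix (Fin m) (Fin n) ℝ) (hY : MatrixSensing.IsSortedDiagonal Y) (hrank : Y.rank = r)
    (𝒜 : Matrix (Fin m) (Fin n) ℝ →ₗ[ℝ] EuclideanSpace ℝ (Fin N))
    (α δ ε ρ η : ℝ) (W : ℝ → Matrix (Fin m ⊕ Fin n) (Fin h) ℝ)
    (hinit : MatrixSensing.InitAssumption r Y α δ ε (W 0))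
    (hsens : MatrixSensing.SensingAssumption 𝒜 r Y δ ρ η (MatrixSensing.T2 r Y ε))
    (hflow : MatrixSensing.IsPerturbedGradientFlow 𝒜 Y η (MatrixSensing.T2 r Y ε) W) :
    MatrixSensing.warmupSet r Y α δ ε W = Set.Icc 0 (MatrixSensing.T2 r Y ε) := by
  have hm : r ≤ m := by
    have := Matrix.rank_le_card_height Y
    rwa [hrank, Fintype.card_fin] at this
  have hn : r ≤ n := by
    have := Matrix.rank_le_card_width Y
    rwa [hrank, Fintype.card_fin] at this
  have hp := hinit.warmupParams hr hrank
  have hf := MatrixSensing.spectralFrame hY hrank hm hn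
  have hq : √‖Y‖ ^ 2 = ‖Y‖ := Real.sq_sqrt (norm_nonneg _)
  rw [← hq] at hf
  refine Set.Subset.antisymm (fun t ht => ht.1) fun t ht => ?_
  refine MatrixSensing.mem_warmupSet hr hrank hm hn hY hinit ht ?_
  refine MatrixSensing.forall_mem_Icc_of_real_induction
    (P := fun t => MatrixSensing.Bounds r Y hm hn α δ ε t (W t))
    (MatrixSensing.warmupBounds_zero hr hrank hm hn hY hinit) (fun t ht hbt => ?_)
    (fun t ht hbt => ?_) t ht
  · have : (nhdsWithin t (Set.Ico 0 t)).NeBot := by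
      rw [← mem_closure_iff_nhdsWithin_neBot, closure_Ico ht.1.ne]
      exact ⟨ht.1.le, le_rfl⟩
    refine MatrixSensing.warmupBounds_of_tendsto hp (l := nhdsWithin t (Set.Ico 0 t))
      nhdsWithin_le_nhds ?_ ?_
    · exact (hflow.continuousOn t ⟨ht.1.le, ht.2⟩).mono_left
        (nhdsWithin_mono _ fun x hx => ⟨hx.1, hx.2.le.trans ht.2⟩)
    · filter_upwards [self_mem_nhdsWithin] with x hx using hbt x hx
  · have hd := hflow.rightDeriv t ht
    rw [MatrixSensing.residualR_add_mul] at hd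
    exact MatrixSensing.eventually_warmupBounds hf hp ht
      (MatrixSensing.norm_perturbation_le hr hrank hm hn hY hinit hsens hflow ht hbt) hd
      (hbt t ⟨ht.1, le_rfl⟩)
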